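/- An instance of gathering on a tree consists of a finite tree $T$ with nonnegative edge lengths, a finite set $\mathcal U$ of users and a finite set $\mathcal F$ of facilities, each located at a vertex of $T$, and an integer $r\ge 0$; $d$ is the tree metric (the sum of the edge lengths on the unique path). A solution is a set $S\subseteq\mathcal F$ of open facilities together with an assignment of some of the users to facilities in $S$ such that every facility in $S$ is assigned at least $r$ users. Its cost is the maximum distance between an assigned user and its facility ($0$ if no user is assigned). Consider two minimization problems. (a) Min-max $(r,\eta)$-gathering: a number $\eta\in[0,1]$ is also given, and a solution is feasible if at most $\eta|\mathcal U|$ users are unassigned. (b) Min-max $r$-gathering with constraints on the number of open facilities: integers $0\le k_1,k_2$ are also given, and a solution is feasible if every user is assigned and $k_1\le|S|\le k_2$. Theorem. Each of the problems (a) and (b) on a tree admits a strongly polynomial-time approximation scheme: there is an algorithm that receives an instance (the tree being given as a list of its edges with their lengths) and a real number $\varepsilon>0$, and outputs a feasible solution whose cost is at most $(1+\varepsilon)$ times the cost of every feasible solution, or reports infeasibility if there is no feasible solution. For every fixed $\varepsilon>0$ its number of steps is bounded by a polynomial in $|V(T)|+|\mathcal U|+|\mathcal F|$, independently of the magnitudes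 of the numbers in the instance. Here a step is an elementary operation on pointers, lists and integers (constants, addition, truncated subtraction, comparison), or an addition, subtraction or comparison of real numbers, or the introduction of the constant $1$; no multiplication, division or rounding of real numbers is used, so that the bit lengths of all numbers also remain polynomial on rational inputs. -/

import Mathlib

open scoped NNReal

/-! ### Strongly polynomial computation

Programs are first-order functional programs with loops over natural numbers, real numbers, pairs,
tagged unions and linked lists.  Every elementary step has unit cost.  The only operations on
real numbers are the constant `1`, addition, subtraction and comparison, and the only ones on
natural numbers are the constants, addition, truncated subtraction and comparison.  There is no
multiplication, division or rounding.  Hence after `t` steps every number that occurs is an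
integer combination of the input numbers and `1` with coefficients of absolute value at most
`2 ^ t`, and a number of steps that is polynomial in the number of input items is strongly
polynomial time in the usual sense (the bit lengths stay polynomial on rational inputs). -/

/-- Data types of the programming language. -/
inductive Ty : Type
  | unit : Ty
  | nat : Ty
  | real : Ty
  | prod : Ty → Ty → Ty
  | sum : Ty → Ty → Ty
  | list : Ty → Ty

/-- The values of a data type. -/
abbrev Ty.Val : Ty → Type
  | .unit => Unit
  | .nat => ℕ
  | .real => ℝ
  | .prod a b => a.Val × b.Val
  | .sum a b => a.Val ⊕ b.Val
  | .list a => List a.Val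

/-- Truth values; `inl` is "true" and `inr` is "false". -/
abbrev Ty.bool : Ty := .sum .unit .unit

/-- An optional value; `inl` is "none". -/
abbrev Ty.opt (a : Ty) : Ty := .sum .unit a

/-- The value of type `Ty.bool` of a proposition. -/
noncomputable def boolVal (p : Prop) : Ty.bool.Val :=
  open Classical in if p then Sum.inl () else Sum.inr ()

/-- The value of type `Ty.opt .nat` of an optional element of `Fin k`. -/
def optVal {k : ℕ} : Option (Fin k) → (Ty.opt .nat).Val
  | none => Sum.inl ()
  | some j => Sum.inr j.val

/-- Programs with an input of type `a` and an output of type `b`: finite syntax trees. -/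
inductive Prog : Ty → Ty → Type
  | ident {a : Ty} : Prog a a
  | comp {a b c : Ty} (g : Prog b c) (f : Prog a b) : Prog a c
  | triv {a : Ty} : Prog a .unit
  | pair {a b c : Ty} (f : Prog a b) (g : Prog a c) : Prog a (.prod b c)
  | fst {a b : Ty} : Prog (.prod a b) a
  | snd {a b : Ty} : Prog (.prod a b) b
  | inl {a b : Ty} : Prog a (.sum a b)
  | inr {a b : Ty} : Prog b (.sum a b)
  | branch {a b c d : Ty} (f : Prog (.prod c a) d) (g : Prog (.prod c b) d) :
      Prog (.prod c (.sum a b)) d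
  | nil {a b : Ty} : Prog a (.list b)
  | cons {a : Ty} : Prog (.prod a (.list a)) (.list a)
  | uncons {a : Ty} : Prog (.list a) (.opt (.prod a (.list a)))
  | natZero {a : Ty} : Prog a .nat
  | natOne {a : Ty} : Prog a .nat
  | natAdd : Prog (.prod .nat .nat) .nat
  | natSub : Prog (.prod .nat .nat) .nat
  | natLt : Prog (.prod .nat .nat) .bool
  | realOne {a : Ty} : Prog a .real
  | realAdd : Prog (.prod .real .real) .real
  | realSub : Prog (.prod .real .real) .real
  | realLt : Prog (.prod .real .real) .bool
  /-- Run the body again on its result as long as that is `inl`; stop with `y` at `inr y`. -/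
  | loop {a b : Ty} (f : Prog a (.sum a b)) : Prog a b

/-- `Runs p x y t`: on input `x` the program `p` halts with output `y` after `t` steps. -/
inductive Runs : {a b : Ty} → Prog a b → a.Val → b.Val → ℕ → Prop
  | ident {a : Ty} (x : a.Val) : Runs (.ident (a := a)) x x 1
  | comp {a b c : Ty} {g : Prog b c} {f : Prog a b} {x : a.Val} {y : b.Val} {z : c.Val}
      {s t : ℕ} (hf : Runs f x y s) (hg : Runs g y z t) : Runs (.comp g f) x z (s + t + 1)
  | triv {a : Ty} (x : a.Val) : Runs (.triv (a := a)) x () 1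
  | pair {a b c : Ty} {f : Prog a b} {g : Prog a c} {x : a.Val} {y : b.Val} {z : c.Val}
      {s t : ℕ} (hf : Runs f x y s) (hg : Runs g x z t) : Runs (.pair f g) x (y, z) (s + t + 1)
  | fst {a b : Ty} (x : a.Val) (y : b.Val) : Runs (.fst (a := a) (b := b)) (x, y) x 1
  | snd {a b : Ty} (x : a.Val) (y : b.Val) : Runs (.snd (a := a) (b := b)) (x, y) y 1
  | inl {a b : Ty} (x : a.Val) : Runs (.inl (a := a) (b := b)) x (Sum.inl x) 1
  | inr {a b : Ty} (y : b.Val) : Runs (.inr (a := a) (b := b)) y (Sum.inr y) 1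
  | branchInl {a b c d : Ty} {f : Prog (.prod c a) d} {g : Prog (.prod c b) d}
      {w : c.Val} {x : a.Val} {z : d.Val} {t : ℕ} (hf : Runs f (w, x) z t) :
      Runs (.branch f g) (w, Sum.inl x) z (t + 1)
  | branchInr {a b c d : Ty} {f : Prog (.prod c a) d} {g : Prog (.prod c b) d}
      {w : c.Val} {y : b.Val} {z : d.Val} {t : ℕ} (hg : Runs g (w, y) z t) :
      Runs (.branch f g) (w, Sum.inr y) z (t + 1)
  | nil {a b : Ty} (x : a.Val) : Runs (.nil (a := a) (b := b)) x [] 1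
  | cons {a : Ty} (x : a.Val) (l : List a.Val) : Runs (.cons (a := a)) (x, l) (x :: l) 1
  | unconsNil {a : Ty} : Runs (.uncons (a := a)) [] (Sum.inl ()) 1
  | unconsCons {a : Ty} (x : a.Val) (l : List a.Val) :
      Runs (.uncons (a := a)) (x :: l) (Sum.inr (x, l)) 1
  | natZero {a : Ty} (x : a.Val) : Runs (.natZero (a := a)) x (0 : ℕ) 1
  | natOne {a : Ty} (x : a.Val) : Runs (.natOne (a := a)) x (1 : ℕ) 1
  | natAdd (m n : ℕ) : Runs .natAdd (m, n) (m + n : ℕ) 1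
  | natSub (m n : ℕ) : Runs .natSub (m, n) (m - n : ℕ) 1
  | natLt (m n : ℕ) : Runs .natLt (m, n) (boolVal (m < n)) 1
  | realOne {a : Ty} (x : a.Val) : Runs (.realOne (a := a)) x (1 : ℝ) 1
  | realAdd (x y : ℝ) : Runs .realAdd (x, y) (x + y : ℝ) 1
  | realSub (x y : ℝ) : Runs .realSub (x, y) (x - y : ℝ) 1
  | realLt (x y : ℝ) : Runs .realLt (x, y) (boolVal (x < y)) 1
  | loopStop {a b : Ty} {f : Prog a (.sum a b)} {x : a.Val} {y : b.Val} {t : ℕ}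
      (hf : Runs f x (Sum.inr y) t) : Runs (.loop f) x y (t + 1)
  | loopStep {a b : Ty} {f : Prog a (.sum a b)} {x x' : a.Val} {y : b.Val} {s t : ℕ}
      (hf : Runs f x (Sum.inl x') s) (hl : Runs (.loop f) x' y t) :
      Runs (.loop f) x y (s + t + 1)

/-- A minimization problem with encodings of its instances and solutions as data.  `size` is the
number of items of an instance; it does not depend on the magnitudes of the numbers. -/
structure MinProblem where
  Inst : Type
  size : Inst → ℕ
  Sol : Inst → Type
  Feasible : (I : Inst) → Sol I → Prop
  cost : (I : Inst) → Sol I → ℝ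
  inTy : Ty
  outTy : Ty
  Encodes : Inst → inTy.Val → Prop
  encodeSol : (I : Inst) → Sol I → outTy.Val

/-- `y` is a correct answer for `I` with ratio `1 + ε`: a feasible solution of cost at most
`1 + ε` times the cost of every feasible solution, or the answer "infeasible" (`inl`) if there is
no feasible solution. -/
def MinProblem.CorrectAnswer (P : MinProblem) (I : P.Inst) (ε : ℝ)
    (y : (Ty.opt P.outTy).Val) : Prop :=
  (∃ s : P.Sol I, y = Sum.inr (P.encodeSol I s) ∧ P.Feasible I s ∧
    ∀ s' : P.Sol I, P.Feasible I s' → P.cost I s ≤ (1 + ε) * P.cost I s') ∨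
  (y = Sum.inl () ∧ ∀ s : P.Sol I, ¬ P.Feasible I s)

/-- `P` has a strongly polynomial-time approximation scheme: a single program that receives an
instance together with `ε > 0` and outputs a `(1 + ε)`-approximate solution, in a number of steps
that, for every fixed `ε`, is polynomial in the number of items of the instance. -/
def MinProblem.HasStronglyPolynomialPTAS (P : MinProblem) : Prop :=
  ∃ p : Prog (.prod P.inTy .real) (.opt P.outTy),
    ∀ ε : ℝ, 0 < ε → ∃ q : Polynomial ℕ,
      ∀ (I : P.Inst) (x : P.inTy.Val), P.Encodes I x →
        ∃ (y : (Ty.opt P.outTy).Val) (t : ℕ),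
          Runs p (x, ε) y t ∧ t ≤ q.eval (P.size I) ∧ P.CorrectAnswer I ε y

/-! ### Gathering on weighted trees -/

/-- Users and facilities on the vertices of a tree with nonnegative edge lengths, and the
parameter `r`.  Several users and facilities may share a vertex; `len` only matters on edges. -/
structure TreeGathering where
  numVertices : ℕ
  numUsers : ℕ
  numFacilities : ℕ
  tree : SimpleGraph (Fin numVertices)
  isTree : tree.IsTree
  len : Sym2 (Fin numVertices) → ℝ≥0
  userAt : Fin numUsers → Fin numVertices
  facilityAt : Fin numFacilities → Fin numVertices
  r : ℕ

namespace TreeGathering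

/-- The tree metric: the sum of the edge lengths on the unique path from `v` to `w`. -/
noncomputable def dist (I : TreeGathering) (v w : Fin I.numVertices) : ℝ≥0 :=
  ((I.isTree.existsUnique_path v w).exists.choose.edges.map I.len).sum

/-- The number of items of the instance. -/
def size (I : TreeGathering) : ℕ := I.numVertices + I.numUsers + I.numFacilities

/-- A choice of facilities to open and of a facility for each user (`none`: left unassigned). -/
structure Solution (I : TreeGathering) where
  opened : Finset (Fin I.numFacilities)
  assign : Fin I.numUsers → Option (Fin I.numFacilities)

namespace Solution

variable {I : TreeGathering}

/-- Users are assigned to open facilities only, and every open facility gets at least `r` users. -/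
def IsGathering (s : Solution I) : Prop :=
  (∀ u f, s.assign u = some f → f ∈ s.opened) ∧
  ∀ f ∈ s.opened, I.r ≤ (Finset.univ.filter fun u => s.assign u = some f).card

/-- The number of users that are left unassigned. -/
def numIgnored (s : Solution I) : ℕ := (Finset.univ.filter fun u => s.assign u = none).card

/-- The maximum distance from an assigned user to its facility (`0` if no user is assigned). -/
noncomputable def cost (s : Solution I) : ℝ≥0 :=
  Finset.univ.sup fun u =>
    match s.assign u with
    | none => 0
    | some f => I.dist (I.userAt u) (I.facilityAt f)

end Solution

/-- Data type of an instance: number of vertices, list of edges `(v, w, length)`, positions of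
the users, positions of the facilities, `r`. -/
abbrev inTy : Ty :=
  .prod .nat (.prod (.list (.prod .nat (.prod .nat .real)))
    (.prod (.list .nat) (.prod (.list .nat) .nat)))

/-- `x` describes `I`; each edge of the tree is listed once, in any order and orientation. -/
def Encodes (I : TreeGathering) (x : inTy.Val) : Prop :=
  ∃ E : List (Fin I.numVertices × Fin I.numVertices),
    (E.map fun e => s(e.1, e.2)).Nodup ∧
    (∀ e, e ∈ E.map (fun e => s(e.1, e.2)) ↔ e ∈ I.tree.edgeSet) ∧
    x = (I.numVertices,
      E.map (fun e => (e.1.val, e.2.val, (I.len s(e.1, e.2) : ℝ))),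
      List.ofFn (fun u => (I.userAt u).val),
      List.ofFn (fun f => (I.facilityAt f).val),
      I.r)

/-- Data type of a solution: for each facility whether it is open, and for each user the facility
it is assigned to, if any. -/
abbrev outTy : Ty := .prod (.list .bool) (.list (.opt .nat))

/-- The encoding of a solution. -/
noncomputable def encodeSol (I : TreeGathering) (s : Solution I) : outTy.Val :=
  (List.ofFn fun f => boolVal (f ∈ s.opened), List.ofFn fun u => optVal (s.assign u))

end TreeGathering

/-- An instance of the `(r, η)`-gathering problem on a tree. -/
structure OutlierInstance extends TreeGathering where
  η : ℝ
  η_nonneg : 0 ≤ η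
  η_le_one : η ≤ 1

/-- Min-max `(r, η)`-gathering on a tree: at most an `η` fraction of the users may be left
unassigned. -/
noncomputable def outlierGathering : MinProblem where
  Inst := OutlierInstance
  size I := I.toTreeGathering.size
  Sol I := TreeGathering.Solution I.toTreeGathering
  Feasible I s := s.IsGathering ∧ (s.numIgnored : ℝ) ≤ I.η * I.numUsers
  cost _ s := s.cost
  inTy := .prod TreeGathering.inTy .real
  outTy := TreeGathering.outTy
  Encodes I x := I.toTreeGathering.Encodes x.1 ∧ x.2 = I.η
  encodeSol I s := I.toTreeGathering.encodeSol s

/-- An instance of the `r`-gathering problem on a tree with bounds on the number of open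
facilities. -/
structure BoundedInstance extends TreeGathering where
  lower : ℕ
  upper : ℕ

/-- Min-max `r`-gathering on a tree with constraints on the number of open facilities: every user
is assigned, and the number of open facilities lies between `lower` and `upper`.  (`lower = 0`
gives "at most", `upper = numFacilities` gives "at least", `lower = upper` gives "exactly".) -/
noncomputable def boundedGathering : MinProblem where
  Inst := BoundedInstance
  size I := I.toTreeGathering.size
  Sol I := TreeGathering.Solution I.toTreeGathering
  Feasible I s := s.IsGathering ∧ s.numIgnored = 0 ∧
    I.lower ≤ s.opened.card ∧ s.opened.card ≤ I.upper
  cost _ s := s.cost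
  inTy := .prod TreeGathering.inTy (.prod .nat .nat)
  outTy := TreeGathering.outTy
  Encodes I x := I.toTreeGathering.Encodes x.1 ∧ x.2 = (I.lower, I.upper)
  encodeSol I s := I.toTreeGathering.encodeSol s

/-! ### Encodings of Lean types as data of the programming language -/

/-! The cost of a solution is `0` or the distance of a user and a facility, and in a rooted tree
`d(x, y) = depth x + depth y - 2 * depth a` for the branching vertex `a`. Taking all triples of
vertices therefore gives polynomially many candidates `b` that include the optimal cost. For each
candidate a relaxed decision problem is solved, and the answer for the smallest successful candidate
is returned (`bestOf_spec`, `cost_mem_candidates`).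

Let `B = ⌈4 / ε⌉`. For a candidate `b` the lengths are multiplied by `B` and divided by `b` with an
integer quotient. The remainder `ρ` at a parent is carried over to its children, so rounding errors
do not accumulate along a path: the rounded distance `D` satisfies `b * D + ρ + ρ' = 2 * s + B * d`
with `ρ`, `ρ'`, `s` in `[0, b]`, unless both `D > B + 2` and `d > b` (`round_spec`). Quotients are
capped at `B + 3`, which bounds the work independently of the lengths. Consequently `d ≤ b` implies
`D ≤ B + 2` (`RoundsTo.le_of_le`), and `D ≤ B + 2` implies `B * d ≤ (B + 4) * b`, hence `d ≤ (1 + ε)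
* b` (`RoundsTo.dist_le`).

What remains is gathering with integer distances and a radius `R = B + 2` that is bounded for fixed
`ε`. Leaves are contracted into their neighbours, and each vertex carries a table of partial
solutions for the items contracted to it. The future of a partial solution depends only on its
profile: the numbers of open facilities and ignored users, and the multisets of distances of waiting
users and of free places in open facilities. Distances above `R` are useless, so the profiles are
two counters and two histograms on `0, ..., R`; there are polynomially many for fixed `R`
(`length_le_tableBound`), and one witness for each is kept. Merging two tables adds partial
solutions and then matches waiting users with free places. Soundness needs only the triangle
inequality (`Wit.Sound.matched`). For completeness one follows the restrictions of a fixed target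
solution: a path between two blocks passes through the vertex at which they are joined, so the users
that the target assigns across can be matched exactly there (`targetProfile_add`,
`hasProfile_merge`, `Contracted.step`).

Feasibility in both problems depends only on the pair of the numbers of open facilities and ignored
users, which the profile records. Both are thus instances of one scheme with a list `A` of
admissible pairs (`TreeGathering.scheme_correct`).

The running time is proved by writing the algorithm with combinators for `Calc`, which assert the
existence of one program for a whole family of inputs together with a bound `(n + 2) ^ h k`; here `k
= ⌈4 / ε⌉` and `h` is arbitrary, so that the degree may depend on `ε` while the program does not. -/

/-- A type whose elements are represented by values of a data type. -/
class Code (α : Type) where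
  ty : Ty
  enc : α → ty.Val

open Code

instance : Code ℕ := ⟨.nat, fun x => x⟩
noncomputable instance : Code ℝ := ⟨.real, fun x => x⟩
instance : Code Bool := ⟨.bool, fun b => match b with | true => Sum.inl () | false => Sum.inr ()⟩
instance {α β : Type} [Code α] [Code β] : Code (α × β) :=
  ⟨.prod (ty α) (ty β), fun x => (enc x.1, enc x.2)⟩
instance {α : Type} [Code α] : Code (List α) := ⟨.list (ty α), List.map enc⟩
instance {α : Type} [Code α] : Code (Option α) :=
  ⟨.opt (ty α), fun o => match o with | none => Sum.inl () | some a => Sum.inr (enc a)⟩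

theorem boolVal_eq_enc (p : Prop) [Decidable p] : boolVal p = enc (decide p) := by
  unfold boolVal
  by_cases h : p <;> simp [h] <;> rfl

/-- `p` takes `x` to `y` in at most `T` steps. -/
def RunsIn {a b : Ty} (p : Prog a b) (x : a.Val) (y : b.Val) (T : ℕ) : Prop :=
  ∃ t ≤ T, Runs p x y t

namespace RunsIn

variable {a b c d : Ty}

theorem mono {p : Prog a b} {x : a.Val} {y : b.Val} {S T : ℕ} (h : RunsIn p x y S)
    (hST : S ≤ T) : RunsIn p x y T :=
  let ⟨t, ht, hr⟩ := h; ⟨t, ht.trans hST, hr⟩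

theorem of_runs {p : Prog a b} {x : a.Val} {y : b.Val} {t : ℕ} (h : Runs p x y t) :
    RunsIn p x y t := ⟨t, le_rfl, h⟩

theorem comp {g : Prog b c} {f : Prog a b} {x : a.Val} {y : b.Val} {z : c.Val} {S T : ℕ}
    (hf : RunsIn f x y S) (hg : RunsIn g y z T) : RunsIn (.comp g f) x z (S + T + 1) :=
  let ⟨s, hs, hf⟩ := hf; let ⟨t, ht, hg⟩ := hg; ⟨s + t + 1, by omega, .comp hf hg⟩

theorem pair {f : Prog a b} {g : Prog a c} {x : a.Val} {y : b.Val} {z : c.Val} {S T : ℕ}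
    (hf : RunsIn f x y S) (hg : RunsIn g x z T) : RunsIn (.pair f g) x (y, z) (S + T + 1) :=
  let ⟨s, hs, hf⟩ := hf; let ⟨t, ht, hg⟩ := hg; ⟨s + t + 1, by omega, .pair hf hg⟩

theorem branchInl {f : Prog (.prod c a) d} {g : Prog (.prod c b) d} {w : c.Val} {x : a.Val}
    {z : d.Val} {T : ℕ} (hf : RunsIn f (w, x) z T) :
    RunsIn (.branch f g) (w, Sum.inl x) z (T + 1) :=
  let ⟨t, ht, hf⟩ := hf; ⟨t + 1, by omega, .branchInl hf⟩

theorem branchInr {f : Prog (.prod c a) d} {g : Prog (.prod c b) d} {w : c.Val} {x : b.Val}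
    {z : d.Val} {T : ℕ} (hf : RunsIn g (w, x) z T) :
    RunsIn (.branch f g) (w, Sum.inr x) z (T + 1) :=
  let ⟨t, ht, hf⟩ := hf; ⟨t + 1, by omega, .branchInr hf⟩

theorem loopStop {f : Prog a (.sum a b)} {x : a.Val} {y : b.Val} {T : ℕ}
    (hf : RunsIn f x (Sum.inr y) T) : RunsIn (.loop f) x y (T + 1) :=
  let ⟨t, ht, hf⟩ := hf; ⟨t + 1, by omega, .loopStop hf⟩

theorem loopStep {f : Prog a (.sum a b)} {x x' : a.Val} {y : b.Val} {S T : ℕ}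
    (hf : RunsIn f x (Sum.inl x') S) (hl : RunsIn (.loop f) x' y T) :
    RunsIn (.loop f) x y (S + T + 1) :=
  let ⟨s, hs, hf⟩ := hf; let ⟨t, ht, hl⟩ := hl; ⟨s + t + 1, by omega, .loopStep hf hl⟩

theorem loop {f : Prog a (.sum a b)} {st : ℕ → a.Val} {y : b.Val} {N T : ℕ}
    (hstep : ∀ j < N, RunsIn f (st j) (Sum.inl (st (j + 1))) T)
    (hend : RunsIn f (st N) (Sum.inr y) T) :
    RunsIn (.loop f) (st 0) y ((N + 1) * (T + 1)) := by
  induction N generalizing st with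
  | zero => exact (loopStop hend).mono (by simp)
  | succ N ih =>
    have := ih (st := fun j => st (j + 1)) (fun j hj => hstep (j + 1) (by omega)) hend
    exact (loopStep (hstep 0 (by omega)) this).mono (by ring_nf; omega)

end RunsIn

/-! ### Families of polynomial-time computations

A family of computations is indexed by a type `ι`.  The gauge `g i = (n, k)` of an index consists
of a size and a parameter; the admissible bounds are `(n + 2) ^ h k` for arbitrary `h`. -/

/-- The bound `(n + 2) ^ h k` at the gauge `(n, k)`. -/
def gaugeBound (h : ℕ → ℕ) (x : ℕ × ℕ) : ℕ := (x.1 + 2) ^ h x.2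

/-- A function that is polynomially bounded for every fixed parameter. -/
def PB {ι : Type} (g : ι → ℕ × ℕ) (f : ι → ℕ) : Prop :=
  ∃ h : ℕ → ℕ, ∀ i, f i ≤ gaugeBound h (g i)

theorem one_le_gaugeBound (h : ℕ → ℕ) (x : ℕ × ℕ) : 1 ≤ gaugeBound h x :=
  Nat.one_le_pow _ _ (by omega)

theorem gaugeBound_mul (h k : ℕ → ℕ) (x : ℕ × ℕ) :
    gaugeBound h x * gaugeBound k x = gaugeBound (fun c => h c + k c) x := by
  simp [gaugeBound, pow_add]

namespace PB

variable {ι : Type} {g : ι → ℕ × ℕ} {f f' : ι → ℕ}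

theorem of_le (h : PB g f) (hle : ∀ i, f' i ≤ f i) : PB g f' :=
  let ⟨k, hk⟩ := h; ⟨k, fun i => (hle i).trans (hk i)⟩

/-- The base is at least `2`, so any function of the parameter alone can be absorbed into the
exponent, however fast it grows. -/
theorem of_param (h : ℕ → ℕ) : PB g (fun i => h (g i).2) :=
  ⟨h, fun i => (Nat.lt_pow_self (by omega)).le⟩

theorem const (c : ℕ) : PB g (fun _ => c) := of_param fun _ => c

theorem size : PB g (fun i => (g i).1) := ⟨fun _ => 1, fun i => by simp [gaugeBound]⟩

theorem param : PB g (fun i => (g i).2) := of_param fun x => x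

theorem mul (h : PB g f) (h' : PB g f') : PB g (fun i => f i * f' i) := by
  obtain ⟨k, hk⟩ := h
  obtain ⟨k', hk'⟩ := h'
  exact ⟨fun c => k c + k' c, fun i =>
    (Nat.mul_le_mul (hk i) (hk' i)).trans (gaugeBound_mul _ _ _).le⟩

/-- A sum is at most the product of the successors, and a successor costs one more factor `n + 2`.
-/
theorem add (h : PB g f) (h' : PB g f') : PB g (fun i => f i + f' i) := by
  have h1 : PB g (fun i => f i + 1) := by
    obtain ⟨k, hk⟩ := h
    refine ⟨fun c => k c + 1, fun i => ?_⟩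
    have h2 := one_le_gaugeBound k (g i)
    have h3 : gaugeBound (fun c => k c + 1) (g i) = gaugeBound k (g i) * ((g i).1 + 2) := by
      simp [gaugeBound, pow_succ]
    have := hk i
    rw [h3]
    nlinarith
  have h2 : PB g (fun i => f' i + 1) := by
    obtain ⟨k, hk⟩ := h'
    refine ⟨fun c => k c + 1, fun i => ?_⟩
    have h2 := one_le_gaugeBound k (g i)
    have h3 : gaugeBound (fun c => k c + 1) (g i) = gaugeBound k (g i) * ((g i).1 + 2) := by
      simp [gaugeBound, pow_succ]
    have := hk i
    rw [h3]
    nlinarith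
  exact (h1.mul h2).of_le fun i => by nlinarith

/-- This is the closure property that admits tables of size `n ^ O(1 / ε)`. -/
theorem pow_param (h : PB g f) (k : ℕ → ℕ) : PB g (fun i => f i ^ k (g i).2) := by
  obtain ⟨m, hm⟩ := h
  refine ⟨fun c => m c * k c, fun i => ?_⟩
  calc f i ^ k (g i).2 ≤ gaugeBound m (g i) ^ k (g i).2 := Nat.pow_le_pow_left (hm i) _
    _ = _ := by simp [gaugeBound, pow_mul]

theorem lift {ι' : Type} (h : PB g f) (π : ι' → ι) : PB (fun j => g (π j)) (fun j => f (π j)) :=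
  let ⟨k, hk⟩ := h; ⟨k, fun j => hk (π j)⟩

end PB

/-- One program takes the encoding of `e i` to the encoding of `f i`, for all `i` of the family,
in polynomial time for every fixed parameter. -/
def Calc {ι γ α : Type} [Code γ] [Code α] (g : ι → ℕ × ℕ) (e : ι → γ) (f : ι → α) : Prop :=
  ∃ (p : Prog (ty γ) (ty α)) (h : ℕ → ℕ), ∀ i, RunsIn p (enc (e i)) (enc (f i)) (gaugeBound h (g i))

namespace Calc

variable {ι γ α β δ : Type} [Code γ] [Code α] [Code β] [Code δ] {g : ι → ℕ × ℕ} {e : ι → γ}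

theorem of_prog {f : ι → α} (p : Prog (ty γ) (ty α)) {T : ι → ℕ} (hT : PB g T)
    (h : ∀ i, RunsIn p (enc (e i)) (enc (f i)) (T i)) : Calc g e f :=
  let ⟨k, hk⟩ := hT; ⟨p, k, fun i => (h i).mono (hk i)⟩

theorem self : Calc g e e :=
  of_prog .ident (PB.const 1) fun _ => .of_runs (.ident _)

theorem comp {f : ι → α} {k : ι → β} (hf : Calc g e f) (hk : Calc g f k) : Calc g e k := by
  obtain ⟨p, a, hp⟩ := hf
  obtain ⟨q, b, hq⟩ := hk
  exact of_prog (.comp q p) ((PB.add ⟨a, fun _ => le_rfl⟩ ⟨b, fun _ => le_rfl⟩).add (PB.const 1))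
    fun i => (hp i).comp (hq i)

theorem prim {F : α → β} (p : Prog (ty α) (ty β)) (c : ℕ)
    (hp : ∀ x, RunsIn p (enc x) (enc (F x)) c) {f : ι → α} (hf : Calc g e f) :
    Calc g e (fun i => F (f i)) :=
  hf.comp (of_prog p (PB.const c) fun _ => hp _)

theorem pair {f : ι → α} {k : ι → β} (hf : Calc g e f) (hk : Calc g e k) :
    Calc g e (fun i => (f i, k i)) := by
  obtain ⟨p, a, hp⟩ := hf
  obtain ⟨q, b, hq⟩ := hk
  exact of_prog (α := α × β) (.pair p q)
    ((PB.add ⟨a, fun _ => le_rfl⟩ ⟨b, fun _ => le_rfl⟩).add (PB.const 1))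
    fun i => (hp i).pair (hq i)

theorem fst {f : ι → α × β} (hf : Calc g e f) : Calc g e (fun i => (f i).1) :=
  prim (F := fun x : α × β => x.1) .fst 1 (fun _ => .of_runs (.fst _ _)) hf

theorem snd {f : ι → α × β} (hf : Calc g e f) : Calc g e (fun i => (f i).2) :=
  prim (F := fun x : α × β => x.2) .snd 1 (fun _ => .of_runs (.snd _ _)) hf

theorem reindex {ι' : Type} {f : ι → α} (hf : Calc g e f) (π : ι' → ι) :
    Calc (fun j => g (π j)) (fun j => e (π j)) (fun j => f (π j)) :=
  let ⟨p, h, hp⟩ := hf; ⟨p, h, fun j => hp (π j)⟩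

/-- A computation from the environment remains one after the environment is extended. -/
theorem lift {ι' : Type} {f : ι → α} (hf : Calc g e f) (π : ι' → ι) (a : ι' → β) :
    Calc (fun j => g (π j)) (fun j => (e (π j), a j)) (fun j => f (π j)) :=
  (fst self).comp (hf.reindex π)

theorem var {a : ι → β} : Calc g (fun j => (e j, a j)) a := snd self

/-! #### Constants and arithmetic -/

theorem natZero : Calc g e (fun _ => (0 : ℕ)) :=
  of_prog .natZero (PB.const 1) fun _ => .of_runs (.natZero _)

theorem natOne : Calc g e (fun _ => (1 : ℕ)) :=
  of_prog .natOne (PB.const 1) fun _ => .of_runs (.natOne _)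

theorem realOne : Calc g e (fun _ => (1 : ℝ)) :=
  of_prog .realOne (PB.const 1) fun _ => .of_runs (.realOne _)

theorem natAdd {f k : ι → ℕ} (hf : Calc g e f) (hk : Calc g e k) :
    Calc g e (fun i => f i + k i) :=
  prim (F := fun x : ℕ × ℕ => x.1 + x.2) .natAdd 1 (fun _ => .of_runs (.natAdd _ _)) (hf.pair hk)

theorem natLt {f k : ι → ℕ} (hf : Calc g e f) (hk : Calc g e k) :
    Calc g e (fun i => decide (f i < k i)) :=
  prim (F := fun x : ℕ × ℕ => decide (x.1 < x.2)) .natLt 1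
    (fun x => boolVal_eq_enc (x.1 < x.2) ▸ .of_runs (.natLt _ _)) (hf.pair hk)

theorem realAdd {f k : ι → ℝ} (hf : Calc g e f) (hk : Calc g e k) :
    Calc g e (fun i => f i + k i) :=
  prim (F := fun x : ℝ × ℝ => x.1 + x.2) .realAdd 1 (fun _ => .of_runs (.realAdd _ _)) (hf.pair hk)

theorem realSub {f k : ι → ℝ} (hf : Calc g e f) (hk : Calc g e k) :
    Calc g e (fun i => f i - k i) :=
  prim (F := fun x : ℝ × ℝ => x.1 - x.2) .realSub 1 (fun _ => .of_runs (.realSub _ _)) (hf.pair hk)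

theorem realLt {f k : ι → ℝ} (hf : Calc g e f) (hk : Calc g e k) :
    Calc g e (fun i => decide (f i < k i)) :=
  prim (F := fun x : ℝ × ℝ => decide (x.1 < x.2)) .realLt 1
    (fun x => boolVal_eq_enc (x.1 < x.2) ▸ .of_runs (.realLt _ _)) (hf.pair hk)

theorem realZero : Calc g e (fun _ => (0 : ℝ)) := by
  simpa using realSub (g := g) (e := e) realOne realOne

theorem natConst (c : ℕ) : Calc g e (fun _ => c) := by
  induction c with
  | zero => exact natZero
  | succ c ih => exact ih.natAdd natOne

theorem realNat (c : ℕ) : Calc g e (fun _ => (c : ℝ)) := by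
  induction c with
  | zero => simpa using realZero
  | succ c ih => simpa using ih.realAdd realOne

/-! #### Truth values and options -/

theorem bTrue : Calc g e (fun _ => true) :=
  of_prog (α := Bool) (.comp .inl .triv) (PB.const 3) fun _ =>
    (RunsIn.of_runs (.triv _)).comp (.of_runs (.inl _))

theorem bFalse : Calc g e (fun _ => false) :=
  of_prog (α := Bool) (.comp .inr .triv) (PB.const 3) fun _ =>
    (RunsIn.of_runs (.triv _)).comp (.of_runs (.inr _))

theorem cond {c : ι → Bool} {f k : ι → α} (hc : Calc g e c) (hf : Calc g e f) (hk : Calc g e k) :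
    Calc g e (fun i => if c i = true then f i else k i) := by
  obtain ⟨p, a, hp⟩ := hf
  obtain ⟨q, b, hq⟩ := hk
  refine (self.pair hc).comp (of_prog (γ := γ × Bool) (.branch (.comp p .fst) (.comp q .fst))
    (((PB.add ⟨a, fun _ => le_rfl⟩ ⟨b, fun _ => le_rfl⟩).add (PB.const 3))) fun i => ?_)
  have h1 := (RunsIn.of_runs (.fst (b := .unit) (enc (e i)) ())).comp (hp i)
  have h2 := (RunsIn.of_runs (.fst (b := .unit) (enc (e i)) ())).comp (hq i)
  cases h : c i
  · have := RunsIn.branchInr (f := .comp p (.fst (b := .unit))) h2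
    simp only [Bool.false_eq_true, if_false]
    exact this.mono (by omega)
  · have := RunsIn.branchInl (g := .comp q (.fst (b := .unit))) h1
    simp only [if_true]
    exact this.mono (by omega)

theorem bNot {c : ι → Bool} (hc : Calc g e c) : Calc g e (fun i => !c i) := by
  have := cond hc bFalse bTrue
  convert this using 2 with i
  cases c i <;> rfl

theorem bAnd {c d : ι → Bool} (hc : Calc g e c) (hd : Calc g e d) :
    Calc g e (fun i => c i && d i) := by
  have := cond hc hd bFalse
  convert this using 2 with i
  cases c i <;> rfl

theorem bOr {c d : ι → Bool} (hc : Calc g e c) (hd : Calc g e d) :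
    Calc g e (fun i => c i || d i) := by
  have := cond hc bTrue hd
  convert this using 2 with i
  cases c i <;> rfl

theorem natLe {f k : ι → ℕ} (hf : Calc g e f) (hk : Calc g e k) :
    Calc g e (fun i => decide (f i ≤ k i)) := by
  have := bNot (natLt hk hf)
  convert this using 2 with i
  simp [← decide_not]

theorem natEq {f k : ι → ℕ} (hf : Calc g e f) (hk : Calc g e k) :
    Calc g e (fun i => decide (f i = k i)) := by
  have := bAnd (natLe hf hk) (natLe hk hf)
  convert this using 2 with i
  rw [← Bool.decide_and]
  exact decide_eq_decide.2 (by omega)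

theorem realLe {f k : ι → ℝ} (hf : Calc g e f) (hk : Calc g e k) :
    Calc g e (fun i => decide (f i ≤ k i)) := by
  have := bNot (realLt hk hf)
  convert this using 2 with i
  simp [← decide_not]

theorem natPairEq {f k : ι → ℕ × ℕ} (hf : Calc g e f) (hk : Calc g e k) :
    Calc g e (fun i => decide (f i = k i)) := by
  have := bAnd (natEq hf.fst hk.fst) (natEq hf.snd hk.snd)
  convert this using 2 with i
  rw [← Bool.decide_and]
  exact decide_eq_decide.2 Prod.ext_iff

theorem none : Calc g e (fun _ => (Option.none : Option α)) :=
  of_prog (α := Option α) (.comp .inl .triv) (PB.const 3) fun _ =>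
    (RunsIn.of_runs (.triv _)).comp (.of_runs (.inl _))

theorem some {f : ι → α} (hf : Calc g e f) : Calc g e (fun i => Option.some (f i)) :=
  prim (F := fun x : α => Option.some x) .inr 1 (fun _ => .of_runs (.inr _)) hf

/-- Case distinction on an optional value. -/
theorem option {o : ι → Option α} {f : ι → β} {F : ι → α → β} (ho : Calc g e o) (hf : Calc g e f)
    (hF : ∀ (ι' : Type) (π : ι' → ι) (a : ι' → α), (∀ j, a j ∈ o (π j)) →
      Calc (fun j => g (π j)) (fun j => (e (π j), a j)) (fun j => F (π j) (a j))) :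
    Calc g e (fun i => (o i).elim (f i) (F i)) := by
  obtain ⟨p, a, hp⟩ := hf
  -- The branch is compiled once, for the universal family of all pairs of an index and a value that
  -- really occurs there.
  obtain ⟨q, b, hq⟩ := hF {x : ι × α // x.2 ∈ o x.1} (fun x => x.1.1) (fun x => x.1.2)
    (fun x => x.2)
  refine (self.pair ho).comp (of_prog (γ := γ × Option α) (.branch (.comp p .fst) q)
    (((PB.add ⟨a, fun _ => le_rfl⟩ ⟨b, fun _ => le_rfl⟩).add (PB.const 3))) fun i => ?_)
  have h1 := (RunsIn.of_runs (.fst (b := .unit) (enc (e i)) ())).comp (hp i)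
  rcases h : o i with _ | x
  · exact (RunsIn.branchInl (g := q) h1).mono (by omega)
  · have h2 := hq ⟨(i, x), by simp [h]⟩
    exact (RunsIn.branchInr (f := .comp p (.fst (b := .unit))) h2).mono (by simp only; omega)

/-! #### Lists -/

theorem nil : Calc g e (fun _ => ([] : List α)) :=
  of_prog (α := List α) .nil (PB.const 1) fun _ => .of_runs (.nil _)

theorem cons {f : ι → α} {l : ι → List α} (hf : Calc g e f) (hl : Calc g e l) :
    Calc g e (fun i => f i :: l i) :=
  prim (F := fun x : α × List α => x.1 :: x.2) .cons 1 (fun _ => .of_runs (.cons _ _))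
    (hf.pair hl)

/-- The program for a left fold with the step `p`. -/
def foldProg {a b c : Ty} (p : Prog (.prod c (.prod b a)) b) :
    Prog (.prod c (.prod b (.list a))) b :=
  .loop (.comp
    (.branch (.comp .inr (.comp .fst (.comp .snd .fst)))
      (.comp .inl (.pair (.comp .fst .fst) (.pair
        (.comp p (.pair (.comp .fst .fst)
          (.pair (.comp .fst (.comp .snd .fst)) (.comp .fst .snd))))
        (.comp .snd .snd)))))
    (.pair .ident (.comp .uncons (.comp .snd .snd))))

theorem runsIn_foldProg {p : Prog (ty (γ × (β × α))) (ty β)} {F : β → α → β} {x : γ} {T : ℕ}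
    (l : List α) (s : β)
    (hF : ∀ l₁ a l₂, l = l₁ ++ a :: l₂ →
      RunsIn p (enc (x, (l₁.foldl F s, a))) (enc (F (l₁.foldl F s) a)) T) :
    RunsIn (foldProg p) (enc (x, (s, l))) (enc (l.foldl F s)) ((l.length + 1) * (T + 50)) := by
  induction l generalizing s with
  | nil =>
    have h1 : RunsIn (.pair .ident (.comp .uncons (.comp .snd .snd)))
        (enc (x, (s, ([] : List α)))) (enc (x, (s, ([] : List α))), Sum.inl ()) 8 :=
      ((RunsIn.of_runs (.ident _)).pair (((RunsIn.of_runs (.snd _ _)).comp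
        (.of_runs (.snd _ _))).comp (.of_runs .unconsNil))).mono (by norm_num)
    refine (RunsIn.loopStop (h1.comp (.branchInl ?_))).mono (T := (0 + 1) * (T + 50)) (by
      show 8 + (10 + 1) + 1 + 1 ≤ _
      omega)
    exact (((RunsIn.of_runs (.fst _ _)).comp (.of_runs (.snd _ _))).comp
      (.of_runs (.fst _ _))).comp (.of_runs (.inr _)) |>.mono (by norm_num)
  | cons a l ih =>
    have h1 : RunsIn (.pair .ident (.comp .uncons (.comp .snd .snd)))
        (enc (x, (s, a :: l))) (enc (x, (s, a :: l)), Sum.inr (enc a, enc l)) 8 :=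
      ((RunsIn.of_runs (.ident _)).pair (((RunsIn.of_runs (.snd _ _)).comp
        (.of_runs (.snd _ _))).comp (.of_runs (.unconsCons _ _)))).mono (by norm_num)
    have h2 := ih (F s a) fun l₁ b l₂ h => hF (a :: l₁) b l₂ (by simp [h])
    refine (RunsIn.loopStep (h1.comp (.branchInr (T := T + 37) ?_)) h2).mono ?_
    · have h3 : RunsIn (.pair (.comp .fst .fst)
          (.pair (.comp .fst (.comp .snd .fst)) (.comp .fst .snd)))
          (enc (x, (s, a :: l)), (enc a, enc l)) (enc (x, (s, a))) 13 :=
        (((RunsIn.of_runs (.fst _ _)).comp (.of_runs (.fst _ _))).pair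
          ((((RunsIn.of_runs (.fst _ _)).comp (.of_runs (.snd _ _))).comp
          (.of_runs (.fst _ _))).pair
          ((RunsIn.of_runs (.snd _ _)).comp (.of_runs (.fst _ _))))).mono (by norm_num)
      have h4 := h3.comp (hF [] a l rfl)
      have h5 : RunsIn (.comp .fst (.fst (b := .prod (ty α) (.list (ty α)))))
          (enc (x, (s, a :: l)), (enc a, enc l)) (enc x) 3 :=
        (RunsIn.of_runs (.fst _ _)).comp (.of_runs (.fst _ _))
      have h6 : RunsIn (.comp .snd (.snd (a := .prod (ty γ) (.prod (ty β) (.list (ty α))))))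
          (enc (x, (s, a :: l)), (enc a, enc l)) (enc l) 3 :=
        (RunsIn.of_runs (.snd _ _)).comp (.of_runs (.snd _ _))
      exact ((h5.pair (h4.pair h6)).comp (.of_runs (.inl _))).mono (by omega)
    · simp only [List.length_cons]
      ring_nf
      omega

/-- Left folds; `Inv` holds for the values that occur. -/
theorem foldlPrefix {l : ι → List α} {s : ι → β} {F : ι → β → α → β} (Inv : ι → β → Prop)
    (hl : Calc g e l) (hs : Calc g e s) (hb : PB g (fun i => (l i).length))
    (hInv : ∀ i l₁, l₁ <+: l i → Inv i (l₁.foldl (F i) (s i)))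
    (hF : ∀ (ι' : Type) (π : ι' → ι) (s : ι' → β) (a : ι' → α), (∀ j, a j ∈ l (π j)) →
      (∀ j, Inv (π j) (s j)) →
      Calc (fun j => g (π j)) (fun j => (e (π j), (s j, a j))) (fun j => F (π j) (s j) (a j))) :
    Calc g e (fun i => (l i).foldl (F i) (s i)) := by
  -- The body is compiled for the universal family of all triples (index, state, element) that
  -- satisfy the invariant. This gives one program and one bound valid in every iteration, and lets
  -- the body rely on size bounds that fail for arbitrary states.
  obtain ⟨p, h, hp⟩ := hF {q : ι × (β × α) // q.2.2 ∈ l q.1 ∧ Inv q.1 q.2.1} (fun q => q.1.1)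
    (fun q => q.1.2.1) (fun q => q.1.2.2) (fun q => q.2.1) (fun q => q.2.2)
  refine (self.pair (hs.pair hl)).comp (of_prog (γ := γ × (β × List α)) (foldProg p)
    ((hb.add (PB.const 1)).mul ((PB.add ⟨h, fun _ => le_rfl⟩ (PB.const 50)))) fun i => ?_)
  exact runsIn_foldProg (l i) (s i) fun l₁ a l₂ hl =>
    hp ⟨(i, (l₁.foldl (F i) (s i), a)), by simp [hl], hInv i l₁ ⟨a :: l₂, hl.symm⟩⟩

/-- Left folds; `Inv` is an invariant of the accumulated value. -/
theorem foldl {l : ι → List α} {s : ι → β} {F : ι → β → α → β} (Inv : ι → β → Prop)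
    (hl : Calc g e l) (hs : Calc g e s) (hb : PB g (fun i => (l i).length))
    (hInv₀ : ∀ i, Inv i (s i)) (hInv : ∀ i s, ∀ a ∈ l i, Inv i s → Inv i (F i s a))
    (hF : ∀ (ι' : Type) (π : ι' → ι) (s : ι' → β) (a : ι' → α), (∀ j, a j ∈ l (π j)) →
      (∀ j, Inv (π j) (s j)) →
      Calc (fun j => g (π j)) (fun j => (e (π j), (s j, a j))) (fun j => F (π j) (s j) (a j))) :
    Calc g e (fun i => (l i).foldl (F i) (s i)) := by
  refine foldlPrefix Inv hl hs hb (fun i l₁ h => ?_) hF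
  have : ∀ l' : List α, (∀ a ∈ l', a ∈ l i) → ∀ s, Inv i s → Inv i (l'.foldl (F i) s) := by
    intro l'
    induction l' with
    | nil => exact fun _ s hs => hs
    | cons a l' ih =>
      exact fun h s hs => ih (fun b hb => h b (by simp [hb])) _ (hInv i s a (h a (by simp)) hs)
  exact this l₁ (fun a ha => h.subset ha) _ (hInv₀ i)

/-- Left folds without an invariant. -/
theorem foldl' {l : ι → List α} {s : ι → β} {F : ι → β → α → β}
    (hl : Calc g e l) (hs : Calc g e s) (hb : PB g (fun i => (l i).length))
    (hF : ∀ (ι' : Type) (π : ι' → ι) (s : ι' → β) (a : ι' → α), (∀ j, a j ∈ l (π j)) →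
      Calc (fun j => g (π j)) (fun j => (e (π j), (s j, a j))) (fun j => F (π j) (s j) (a j))) :
    Calc g e (fun i => (l i).foldl (F i) (s i)) :=
  foldl (fun _ _ => True) hl hs hb (fun _ => trivial) (fun _ _ _ _ _ => trivial)
    fun ι' π s a ha _ => hF ι' π s a ha

theorem reverse {l : ι → List α} (hl : Calc g e l) (hb : PB g (fun i => (l i).length)) :
    Calc g e (fun i => (l i).reverse) := by
  have := foldl' (F := fun (_ : ι) (s : List α) (a : α) => a :: s) hl nil hb
    fun ι' π s a _ => var.snd.cons var.fst
  simpa using this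

theorem foldr {l : ι → List α} {s : ι → β} {F : ι → α → β → β} (Inv : ι → β → Prop)
    (hl : Calc g e l) (hs : Calc g e s) (hb : PB g (fun i => (l i).length))
    (hInv₀ : ∀ i, Inv i (s i)) (hInv : ∀ i s, ∀ a ∈ l i, Inv i s → Inv i (F i a s))
    (hF : ∀ (ι' : Type) (π : ι' → ι) (s : ι' → β) (a : ι' → α), (∀ j, a j ∈ l (π j)) →
      (∀ j, Inv (π j) (s j)) →
      Calc (fun j => g (π j)) (fun j => (e (π j), (s j, a j))) (fun j => F (π j) (a j) (s j))) :
    Calc g e (fun i => (l i).foldr (F i) (s i)) := by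
  have := foldl (F := fun i s a => F i a s) Inv (reverse hl hb) hs (by simpa using hb) hInv₀
    (fun i s a ha => hInv i s a (by simpa using ha))
    (fun ι' π s a ha => hF ι' π s a (fun j => by simpa using ha j))
  simpa using this

/-- Right folds; `Inv` holds for the values that occur. -/
theorem foldrSuffix {l : ι → List α} {s : ι → β} {F : ι → α → β → β} (Inv : ι → β → Prop)
    (hl : Calc g e l) (hs : Calc g e s) (hb : PB g (fun i => (l i).length))
    (hInv : ∀ i l₁, l₁ <:+ l i → Inv i (l₁.foldr (F i) (s i)))
    (hF : ∀ (ι' : Type) (π : ι' → ι) (s : ι' → β) (a : ι' → α), (∀ j, a j ∈ l (π j)) →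
      (∀ j, Inv (π j) (s j)) →
      Calc (fun j => g (π j)) (fun j => (e (π j), (s j, a j))) (fun j => F (π j) (a j) (s j))) :
    Calc g e (fun i => (l i).foldr (F i) (s i)) := by
  have := foldlPrefix (F := fun i s a => F i a s) Inv (reverse hl hb) hs (by simpa using hb)
    (fun i l₁ h => by
      have h2 := hInv i l₁.reverse (List.reverse_prefix.1 (by simpa using h))
      simpa using h2)
    (fun ι' π s a ha => hF ι' π s a (fun j => by simpa using ha j))
  simpa using this

theorem append {l₁ l₂ : ι → List α} (h₁ : Calc g e l₁) (h₂ : Calc g e l₂)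
    (hb : PB g (fun i => (l₁ i).length)) : Calc g e (fun i => l₁ i ++ l₂ i) := by
  have := foldr (F := fun (_ : ι) (a : α) (s : List α) => a :: s) (fun _ _ => True) h₁ h₂ hb
    (fun _ => trivial) (fun _ _ _ _ _ => trivial) fun ι' π s a _ _ => var.snd.cons var.fst
  simpa using this

theorem map {l : ι → List α} {F : ι → α → β} (hl : Calc g e l)
    (hb : PB g (fun i => (l i).length))
    (hF : ∀ (ι' : Type) (π : ι' → ι) (a : ι' → α), (∀ j, a j ∈ l (π j)) →
      Calc (fun j => g (π j)) (fun j => (e (π j), a j)) (fun j => F (π j) (a j))) :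
    Calc g e (fun i => (l i).map (F i)) := by
  have := foldr (F := fun i (a : α) (s : List β) => F i a :: s) (fun _ _ => True) hl nil hb
    (fun _ => trivial) (fun _ _ _ _ _ => trivial) fun ι' π s a ha _ =>
      (((fst self).pair (snd (snd self))).comp (hF ι' π a ha)).cons (fst (snd self))
  simpa using this

theorem filter {l : ι → List α} {F : ι → α → Bool} (hl : Calc g e l)
    (hb : PB g (fun i => (l i).length))
    (hF : ∀ (ι' : Type) (π : ι' → ι) (a : ι' → α), (∀ j, a j ∈ l (π j)) →
      Calc (fun j => g (π j)) (fun j => (e (π j), a j)) (fun j => F (π j) (a j))) :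
    Calc g e (fun i => (l i).filter (F i)) := by
  have := foldr (F := fun i (a : α) (s : List α) => if F i a = true then a :: s else s)
    (fun _ _ => True) hl nil hb
    (fun _ => trivial) (fun _ _ _ _ _ => trivial) fun ι' π s a ha _ =>
      cond (((fst self).pair (snd (snd self))).comp (hF ι' π a ha))
        (var.snd.cons var.fst) var.fst
  convert this using 2 with i
  induction l i with
  | nil => rfl
  | cons a l ih => by_cases h : F i a = true <;> simp [h, ih]

theorem any {l : ι → List α} {F : ι → α → Bool} (hl : Calc g e l)
    (hb : PB g (fun i => (l i).length))
    (hF : ∀ (ι' : Type) (π : ι' → ι) (a : ι' → α), (∀ j, a j ∈ l (π j)) →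
      Calc (fun j => g (π j)) (fun j => (e (π j), a j)) (fun j => F (π j) (a j))) :
    Calc g e (fun i => (l i).any (F i)) := by
  have := foldr (F := fun i (a : α) (s : Bool) => F i a || s)
    (fun _ _ => True) hl bFalse hb
    (fun _ => trivial) (fun _ _ _ _ _ => trivial) fun ι' π s a ha _ =>
      bOr (((fst self).pair (snd (snd self))).comp (hF ι' π a ha)) var.fst
  convert this using 2 with i
  induction l i with
  | nil => rfl
  | cons a l ih => simp [ih]

theorem all {l : ι → List α} {F : ι → α → Bool} (hl : Calc g e l)
    (hb : PB g (fun i => (l i).length))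
    (hF : ∀ (ι' : Type) (π : ι' → ι) (a : ι' → α), (∀ j, a j ∈ l (π j)) →
      Calc (fun j => g (π j)) (fun j => (e (π j), a j)) (fun j => F (π j) (a j))) :
    Calc g e (fun i => (l i).all (F i)) := by
  have := bNot (any (F := fun i a => !F i a) hl hb fun ι' π a ha => bNot (hF ι' π a ha))
  convert this using 2 with i
  simp [List.not_any_eq_all_not]

theorem flatMap {l : ι → List α} {F : ι → α → List β} (hl : Calc g e l)
    (hb : PB g (fun i => (l i).length)) {m : ι → ℕ} (hm : PB g m)
    (hlen : ∀ i, ∀ a ∈ l i, (F i a).length ≤ m i)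
    (hF : ∀ (ι' : Type) (π : ι' → ι) (a : ι' → α), (∀ j, a j ∈ l (π j)) →
      Calc (fun j => g (π j)) (fun j => (e (π j), a j)) (fun j => F (π j) (a j))) :
    Calc g e (fun i => (l i).flatMap (F i)) := by
  have := foldr (F := fun i (a : α) (s : List β) => F i a ++ s)
    (fun _ _ => True) hl nil hb
    (fun _ => trivial) (fun _ _ _ _ _ => trivial) fun ι' π s a ha _ =>
      append (((fst self).pair (snd (snd self))).comp (hF ι' π a ha)) var.fst
        ((hm.lift π).of_le fun j => hlen (π j) (a j) (ha j))
  convert this using 2 with i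
  induction l i with
  | nil => rfl
  | cons a l ih => simp [ih]

theorem length {l : ι → List α} (hl : Calc g e l) (hb : PB g (fun i => (l i).length)) :
    Calc g e (fun i => (l i).length) := by
  have := foldr (F := fun _ (_ : α) (s : ℕ) => s + 1)
    (fun _ _ => True) hl natZero hb
    (fun _ => trivial) (fun _ _ _ _ _ => trivial) fun ι' π s a ha _ =>
      natAdd var.fst natOne
  convert this using 2 with i
  induction l i with
  | nil => rfl
  | cons a l ih => rw [List.length_cons, ih]; rfl

/-- The program for `List.range`. -/
def rangeProg : Prog .nat (.list .nat) :=
  .comp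
    (.loop (.comp
      (.branch
        (.comp .inl (.pair (.comp .natSub (.pair (.comp .fst .fst) .natOne))
          (.comp .cons (.pair (.comp .natSub (.pair (.comp .fst .fst) .natOne))
            (.comp .snd .fst)))))
        (.comp .inr (.comp .snd .fst)))
      (.pair .ident (.comp .natLt (.pair .natZero .fst)))))
    (.pair .ident .nil)

theorem runsIn_rangeProg (n : ℕ) :
    RunsIn rangeProg (enc n) (enc (List.range n)) ((n + 1) * 101 + 4) := by
  have htest (m : ℕ) (l : List ℕ) : RunsIn (a := .prod .nat (.list .nat))
      (.pair .ident (.comp .natLt (.pair .natZero .fst))) (m, l) ((m, l), boolVal (0 < m)) 7 :=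
    (RunsIn.of_runs (.ident _)).pair (((RunsIn.of_runs (.natZero _)).pair
      (.of_runs (.fst _ _))).comp (.of_runs (.natLt _ _)))
  have key := RunsIn.loop (a := .prod .nat (.list .nat)) (b := .list .nat) (N := n) (T := 100)
    (f := (.comp
      (.branch
        (.comp .inl (.pair (.comp .natSub (.pair (.comp .fst .fst) .natOne))
          (.comp .cons (.pair (.comp .natSub (.pair (.comp .fst .fst) .natOne))
            (.comp .snd .fst)))))
        (.comp .inr (.comp .snd .fst)))
      (.pair .ident (.comp .natLt (.pair .natZero .fst)))))
    -- The loop counts down and conses, so after `j` rounds it holds the last `j` entries in the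
    -- right order.
    (st := fun j => ((n - j, (List.range n).drop (n - j)) : ℕ × List ℕ))
    (y := (List.range n : List ℕ)) ?_ ?_
  · refine (RunsIn.comp ((RunsIn.of_runs (.ident _)).pair (.of_runs (.nil _))) ?_).mono
      (le_of_eq ?_) (S := 1 + 1 + 1 + (n + 1) * (100 + 1) + 1)
    · have h : (List.map (fun x => x) (List.range n) : List ℕ) = List.range n := by simp
      rw [show (enc (List.range n) : List ℕ) = List.range n from h]
      simp only [Nat.sub_zero, List.drop_of_length_le (List.length_range.le)] at key
      exact key
    · ring
  · intro j hj
    have h1 := htest (n - j) ((List.range n).drop (n - j))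
    have h2 : boolVal (0 < n - j) = Sum.inl () := by simp [boolVal, hj]
    rw [h2] at h1
    refine (h1.comp (.branchInl (T := 50) ?_)).mono (by norm_num)
    have h3 : List.drop (n - (j + 1)) (List.range n)
        = (n - j - 1) :: List.drop (n - j) (List.range n) := by
      rw [show n - (j + 1) = n - j - 1 by omega, List.drop_eq_getElem_cons (by simp; omega)]
      simp
      omega
    simp only [h3]
    have h4 : n - (j + 1) = n - j - 1 := by omega
    rw [h4]
    have h5 : RunsIn (a := .prod (.prod .nat (.list .nat)) .unit)
      (.comp .natSub (.pair (.comp .fst .fst) .natOne))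
      ((n - j, (List.range n).drop (n - j)), ()) (n - j - 1 : ℕ) 7 :=
      (((RunsIn.of_runs (.fst _ _)).comp (.of_runs (.fst _ _))).pair
        (.of_runs (.natOne _))).comp (.of_runs (.natSub _ _))
    exact ((h5.pair ((h5.pair ((RunsIn.of_runs (.fst _ _)).comp (.of_runs (.snd _ _)))).comp
      (.of_runs (.cons _ _)))).comp (.of_runs (.inl _))).mono (by norm_num)
  · have h1 := htest (n - n) ((List.range n).drop (n - n))
    have h2 : boolVal (0 < n - n) = Sum.inr () := by simp [boolVal]
    rw [h2] at h1
    refine (h1.comp (.branchInr (T := 50) ?_)).mono (by norm_num)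
    have h3 := ((RunsIn.of_runs (.fst (a := .prod .nat (.list .nat)) (b := .unit)
      (n - n, (List.range n).drop (n - n)) ())).comp (.of_runs (.snd _ _))).comp
      (.of_runs (.inr (a := .prod .nat (.list .nat)) _))
    simp only [Nat.sub_self, List.drop_zero] at h3 ⊢
    exact h3.mono (by norm_num)

theorem range {f : ι → ℕ} (hf : Calc g e f) (hb : PB g f) :
    Calc g e (fun i => List.range (f i)) :=
  hf.comp (of_prog rangeProg (((hb.add (PB.const 1)).mul (PB.const 101)).add (PB.const 4))
    fun i => runsIn_rangeProg (f i))

theorem listIte {c : ι → Bool} {f : ι → α} (hc : Calc g e c) (hf : Calc g e f) :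
    Calc g e (fun i => if c i = true then [f i] else []) := cond hc (hf.cons nil) nil

end Calc

/-! ### The algorithm -/

/-- A partial solution for the users and facilities below a vertex: the opened facilities, the
ignored users, the assigned pairs, the users (with their distances to the vertex) that are to be
assigned further up, and the places in open facilities (with their distances to the vertex) that
are to be filled further up. -/
structure Wit where
  opened : List ℕ
  ign : List ℕ
  asg : List (ℕ × ℕ)
  pu : List (ℕ × ℕ)
  pf : List (ℕ × ℕ)

namespace Wit

def empty : Wit := ⟨[], [], [], [], []⟩

def size (w : Wit) : ℕ :=
  w.opened.length + w.ign.length + w.asg.length + w.pu.length + w.pf.length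

def add (w w' : Wit) : Wit :=
  ⟨w.opened ++ w'.opened, w.ign ++ w'.ign, w.asg ++ w'.asg, w.pu ++ w'.pu, w.pf ++ w'.pf⟩

/-- The same partial solution seen from a vertex at distance `L` further up. -/
def shift (L : ℕ) (w : Wit) : Wit :=
  ⟨w.opened, w.ign, w.asg, w.pu.map fun x => (x.1, x.2 + L), w.pf.map fun x => (x.1, x.2 + L)⟩

/-- Assign the waiting user `x` to the free place `y`. -/
def matched (w : Wit) (x y : ℕ × ℕ) : Wit :=
  ⟨w.opened, w.ign, (x.1, y.1) :: w.asg, w.pu.erase x, w.pf.erase y⟩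

/-- Distances to the current vertex never decrease under contraction, so a waiting user or free
place beyond `R` is lost and its entry may be dropped. The size bound serves the running time;
entries needed for completeness meet it. -/
def ok (M R : ℕ) (w : Wit) : Bool :=
  decide (w.size ≤ M) && (w.pu.all (fun x => decide (x.2 ≤ R)) &&
    w.pf.all (fun x => decide (x.2 ≤ R)))

end Wit

/-- The number of entries with second component `a`. -/
def countSnd (a : ℕ) (l : List (ℕ × ℕ)) : ℕ := (l.filter fun x => decide (x.2 = a)).length

namespace Wit

/-- Equivalence of partial solutions for all later purposes. -/
def same (R : ℕ) (w w' : Wit) : Bool :=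
  decide (w.opened.length = w'.opened.length) && (decide (w.ign.length = w'.ign.length) &&
    (List.range (R + 1)).all fun a => decide (countSnd a w.pu = countSnd a w'.pu) &&
      decide (countSnd a w.pf = countSnd a w'.pf))

/-- All ways to assign one waiting user to a free place within distance `R`. -/
def matches' (R : ℕ) (w : Wit) : List Wit :=
  w.pu.flatMap fun x => w.pf.flatMap fun y =>
    if decide (x.2 + y.2 ≤ R) = true then [w.matched x y] else []

end Wit

/-- Keep one admissible partial solution of each equivalence class. -/
def normalise (M R : ℕ) (T : List Wit) : List Wit :=
  T.foldl (fun acc w => if (w.ok M R && !(acc.any fun w' => w.same R w')) = true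
    then w :: acc else acc) []

/-- The old entries are kept, so after `n` rounds any number of matches up to `n` has been tried;
normalising each time keeps the table small. -/
def closeStep (M R : ℕ) (T : List Wit) : List Wit :=
  normalise M R (T ++ T.flatMap fun w => w.matches' R)

/-- Close a table under at most `n` assignments of waiting users to free places. -/
def closeTable (M R n : ℕ) (T : List Wit) : List Wit :=
  (List.range n).foldl (fun T _ => closeStep M R T) T

/-- Merge two tables at the same vertex. -/
def merge (M R n : ℕ) (T₁ T₂ : List Wit) : List Wit :=
  closeTable M R n (normalise M R (T₁.flatMap fun w => T₂.map fun w' => w.add w'))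

def userTable (u : ℕ) : List Wit := [⟨[], [u], [], [], []⟩, ⟨[], [], [], [(u, 0)], []⟩]

/-- An open facility fixes in advance the number `s ≥ r` of users it will serve. Since a complete
solution must have no free place left, the lower bound `r` is then automatic. -/
def facTable (r n f : ℕ) : List Wit :=
  Wit.empty :: ((List.range (n + 1)).filter fun s => decide (r ≤ s)).map fun s =>
    ⟨[f], [], [], [], (List.range s).map fun _ => (f, 0)⟩

/-- The table of the users and facilities at the vertex `v`. -/
def vertexTable (M R r : ℕ) (users facs : List ℕ) (v : ℕ) : List Wit :=
  (List.zipIdx facs).foldl (fun T q => if decide (q.1 = v) = true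
      then merge M R users.length T (facTable r users.length q.2) else T)
    ((List.zipIdx users).foldl (fun T q => if decide (q.1 = v) = true
      then merge M R users.length T (userTable q.2) else T) [Wit.empty])

/-- The value of the last entry with key `v`, or `d`. -/
def lookupD {α : Type} (l : List (ℕ × α)) (v : ℕ) (d : α) : α :=
  l.foldl (fun acc q => if decide (q.1 = v) = true then q.2 else acc) d

/-- Contract the leaf `c = e.2.1` into its neighbour `p = e.1` at distance `e.2.2`. -/
def contract (M R n : ℕ) (tabs : List (ℕ × List Wit)) (e : ℕ × ℕ × ℕ) : List (ℕ × List Wit) :=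
  tabs.map fun q => if decide (q.1 = e.1) = true
    then (q.1, merge M R n q.2 ((lookupD tabs e.2.1 []).map fun w => w.shift e.2.2)) else q

/-- The list `ord` has a leaf of the remaining tree at its head. The table of a contracted leaf
stays in the list, but in a well-ordered list its key is not used again. -/
def rootTable (M R r nv : ℕ) (users facs : List ℕ) (ord : List (ℕ × ℕ × ℕ)) : List Wit :=
  lookupD (ord.foldl (contract M R users.length)
    ((List.range nv).map fun v => (v, vertexTable M R r users facs v))) 0 []

/-- A complete solution whose numbers of open facilities and ignored users are in the list `A`. -/
def pick (A : List (ℕ × ℕ)) (T : List Wit) : Option Wit :=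
  T.foldl (fun o w => if (decide (w.pu.length = 0) && (decide (w.pf.length = 0) &&
    A.any fun q => decide (q = (w.opened.length, w.ign.length)))) = true then some w else o) none

/-! #### Preparation of the tree -/

def visited (out : List (ℕ × ℕ × ℝ)) (v : ℕ) : Bool :=
  decide (v = 0) || out.any fun q => decide (q.2.1 = v)

/-- Only an edge with exactly one end reached so far is added, oriented away from the root. As it
goes to the head, its child is a leaf of the tree collected so far. -/
def growStep (out : List (ℕ × ℕ × ℝ)) (e : ℕ × ℕ × ℝ) : List (ℕ × ℕ × ℝ) :=
  if (visited out e.1 && !visited out e.2.1) = true then (e.1, e.2.1, e.2.2) :: out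
  else if (visited out e.2.1 && !visited out e.1) = true then (e.2.1, e.1, e.2.2) :: out
  else out

/-- The edges as triples (parent, child, length) for the root `0`, in an order in which leaves can
be removed. -/
def grow (nv : ℕ) (edges : List (ℕ × ℕ × ℝ)) : List (ℕ × ℕ × ℝ) :=
  (List.range nv).foldl (fun out _ => edges.foldl growStep out) []

/-- Reals cannot be multiplied by a program, but a factor that is bounded polynomially can be
replaced by repeated addition. -/
noncomputable def mulNat (B : ℕ) (x : ℝ) : ℝ := (List.range B).foldl (fun s _ => s + x) 0

open Classical in
/-- Division of `x` by `b` with a quotient of at most `B + 3`. -/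
noncomputable def roundLen (B : ℕ) (b x : ℝ) : ℝ × ℕ :=
  (List.range (B + 3)).foldl
    -- The strict comparison makes `b = 0` work: length `0` gets the quotient `0`, and a positive
    -- length runs into the cap `B + 3`. Remainders may equal `b`.
    (fun s _ => if decide (b < s.1) = true then (s.1 - b, s.2 + 1) else s) (x, 0)

/-- One edge of the rounding: `s` is the quotient and remainder. -/
noncomputable def roundStep (B : ℕ) (e : ℕ × ℕ × ℝ) (acc : List (ℕ × ℕ × ℕ) × List (ℕ × ℝ))
    (s : ℝ × ℕ) : List (ℕ × ℕ × ℕ) × List (ℕ × ℝ) :=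
  -- At the cap the remainder may exceed `b` and is reset to `0`. This is harmless: every distance
  -- across this edge is already above `B + 2`.
  ((e.1, e.2.1, s.2) :: acc.1, (e.2.1, if decide (s.2 < B + 3) = true then s.1 else 0) :: acc.2)

/-- The tree with rounded lengths, and the remainders of the vertices. -/
noncomputable def roundEdges (B : ℕ) (b : ℝ) (ord : List (ℕ × ℕ × ℝ)) :
    List (ℕ × ℕ × ℕ) × List (ℕ × ℝ) :=
  ord.foldr (fun e acc => roundStep B e acc
    -- The right fold treats parents before children, so the parent's remainder is available; the
    -- root has the default `0`.
    (roundLen B b (lookupD acc.2 e.1 0 + mulNat B e.2.2))) ([], [])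

/-- The depths of the vertices. -/
noncomputable def depths (ord : List (ℕ × ℕ × ℝ)) : List (ℕ × ℝ) :=
  ord.foldr (fun e acc => (e.2.1, lookupD acc e.1 0 + e.2.2) :: acc) [(0, 0)]

open Classical in
/-- Nonnegative numbers among which are all distances. -/
noncomputable def candidates (D : List (ℕ × ℝ)) : List ℝ :=
  -- The value for the branching vertex `a` of `x` and `y` is their distance. Trying all `a` avoids
  -- searching for it; superfluous values do no harm as long as they are nonnegative.
  (D.flatMap fun x => D.flatMap fun y => D.map fun a => x.2 + y.2 - a.2 - a.2).filter
    fun b => decide (0 ≤ b)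

/-! #### The approximation scheme -/

/-- A solution whose cost is at most `b` up to rounding. -/
noncomputable def solveFor (B r nv : ℕ) (users facs : List ℕ) (A : List (ℕ × ℕ))
    (ord : List (ℕ × ℕ × ℝ)) (b : ℝ) : Option Wit :=
  -- A user occurs once among the ignored, assigned and waiting ones, a facility is opened at most
  -- once, and at most `n` free places are ever needed: hence the size bound `2 * n + m`. The radius
  -- `B + 2` is `b` in rounded units, with two units for the rounding error.
  pick A (rootTable (users.length + users.length + facs.length) (B + 2) r nv users facs
    (roundEdges B b ord).1)

open Classical in
noncomputable def improve (o : Option (ℝ × Wit)) (b : ℝ) (w : Wit) : Option (ℝ × Wit) :=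
  some (o.elim (b, w) fun q => if decide (b < q.1) = true then (b, w) else q)

/-- The candidates, not the true costs of the solutions, are compared. All candidates are tried, so
no monotonicity of `S` is needed. -/
noncomputable def bestOf (cands : List ℝ) (S : ℝ → Option Wit) : Option (ℝ × Wit) :=
  cands.foldl (fun o b => (S b).elim o (improve o b)) none

/-- The output that describes a complete partial solution. -/
def output (n m : ℕ) (w : Wit) : List Bool × List (Option ℕ) :=
  ((List.range m).map fun f => w.opened.any fun f' => decide (f' = f),
    (List.range n).map fun u =>
      w.asg.foldl (fun o q => if decide (q.1 = u) = true then some q.2 else o) none)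

noncomputable def scheme (B nv : ℕ) (edges : List (ℕ × ℕ × ℝ)) (users facs : List ℕ) (r : ℕ)
    (A : List (ℕ × ℕ)) : Option (List Bool × List (Option ℕ)) :=
  (bestOf (candidates (depths (grow nv edges)))
    (solveFor B r nv users facs A (grow nv edges))).elim none
    fun q => some (output users.length facs.length q.2)

/-! ### The algorithm runs in polynomial time -/

/-- A function that is bounded for every fixed parameter. -/
def BoundedByParam {ι : Type} (g : ι → ℕ × ℕ) (f : ι → ℕ) : Prop :=
  ∃ h : ℕ → ℕ, ∀ i, f i ≤ h (g i).2

theorem BoundedByParam.pb {ι : Type} {g : ι → ℕ × ℕ} {f : ι → ℕ} (h : BoundedByParam g f) :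
    PB g f := let ⟨k, hk⟩ := h; (PB.of_param k).of_le hk

theorem BoundedByParam.lift {ι ι' : Type} {g : ι → ℕ × ℕ} {f : ι → ℕ} (h : BoundedByParam g f)
    (π : ι' → ι) : BoundedByParam (fun j => g (π j)) (fun j => f (π j)) :=
  let ⟨k, hk⟩ := h; ⟨k, fun j => hk (π j)⟩

theorem BoundedByParam.add_const {ι : Type} {g : ι → ℕ × ℕ} {f : ι → ℕ}
    (h : BoundedByParam g f) (c : ℕ) : BoundedByParam g (fun i => f i + c) :=
  let ⟨k, hk⟩ := h; ⟨fun x => k x + c, fun i => Nat.add_le_add_right (hk i) c⟩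

/-- The exponent must be bounded by the parameter alone; a polynomial bound for it would not
suffice. -/
theorem PB.pow {ι : Type} {g : ι → ℕ × ℕ} {f k : ι → ℕ} (hf : PB g f)
    (hk : BoundedByParam g k) : PB g (fun i => f i ^ k i) := by
  obtain ⟨h, hh⟩ := hk
  refine ((hf.add (PB.const 1)).pow_param h).of_le fun i => ?_
  exact (Nat.pow_le_pow_left (Nat.le_succ _) _).trans (Nat.pow_le_pow_right (by omega) (hh i))

/-- Programs traverse lists by folds, so erasing is done with a flag that tells whether the first
occurrence has already been skipped. -/
theorem List.foldl_erase {α : Type} [DecidableEq α] [BEq α] [LawfulBEq α] (x : α) (l : List α) :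
    ((l.foldl (fun (s : Bool × List α) y =>
      if (!s.1 && decide (y = x)) = true then (true, s.2) else (s.1, y :: s.2))
      (false, [])).2).reverse = l.erase x := by
  have h1 : ∀ (l r : List α), (l.foldl (fun (s : Bool × List α) y =>
      if (!s.1 && decide (y = x)) = true then (true, s.2) else (s.1, y :: s.2))
      (true, r)).2.reverse = r.reverse ++ l := by
    intro l
    induction l with
    | nil => simp
    | cons y l ih =>
      intro r
      rw [List.foldl_cons, if_neg (by simp), ih]
      simp
  have h2 : ∀ (l r : List α), (l.foldl (fun (s : Bool × List α) y =>
      if (!s.1 && decide (y = x)) = true then (true, s.2) else (s.1, y :: s.2))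
      (false, r)).2.reverse = r.reverse ++ l.erase x := by
    intro l
    induction l with
    | nil => simp
    | cons y l ih =>
      intro r
      by_cases h : y = x
      · simpa [h] using h1 l r
      · have := ih (y :: r)
        simp only [List.foldl_cons, List.erase_cons, beq_iff_eq]
        simpa [h] using this
  simpa using h2 l []

/-! ### Programs for further list functions -/

namespace Calc

variable {ι γ α β : Type} [Code γ] [Code α] [Code β] {g : ι → ℕ × ℕ} {e : ι → γ}

theorem erase {l : ι → List (ℕ × ℕ)} {x : ι → ℕ × ℕ} (hl : Calc g e l) (hx : Calc g e x)
    (hb : PB g (fun i => (l i).length)) : Calc g e (fun i => (l i).erase (x i)) := by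
  have h := foldlPrefix (F := fun i (s : Bool × List (ℕ × ℕ)) y =>
      if (!s.1 && decide (y = x i)) = true then (true, s.2) else (s.1, y :: s.2))
    (fun i s => s.2.length ≤ (l i).length) hl (bFalse.pair nil) hb
    (fun i l₁ h => by
      have key : ∀ (l₁ : List (ℕ × ℕ)) (s : Bool × List (ℕ × ℕ)), (l₁.foldl
          (fun (s : Bool × List (ℕ × ℕ)) y =>
          if (!s.1 && decide (y = x i)) = true then (true, s.2) else (s.1, y :: s.2)) s).2.length
          ≤ s.2.length + l₁.length := by
        intro l₁
        induction l₁ with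
        | nil => simp
        | cons y l ih =>
          intro s
          refine (ih _).trans ?_
          dsimp only
          split_ifs <;> (simp; try omega)
      exact (key l₁ _).trans (by simpa using h.length_le))
    (fun ι' π s a _ _ => cond (bAnd (bNot var.fst.fst) (natPairEq var.snd (hx.lift π _)))
      (bTrue.pair var.fst.snd) (var.fst.fst.pair (var.snd.cons var.fst.snd)))
  have hb' : PB g (fun i => ((l i).foldl (fun (s : Bool × List (ℕ × ℕ)) y =>
      if (!s.1 && decide (y = x i)) = true then (true, s.2) else (s.1, y :: s.2))
      (false, [])).2.length) := hb.of_le fun i => by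
    rw [← List.length_reverse, List.foldl_erase]
    exact List.length_erase_le
  have h2 := reverse h.snd hb'
  simpa only [List.foldl_erase] using h2

theorem lookupD {l : ι → List (ℕ × α)} {v : ι → ℕ} {d : ι → α} (hl : Calc g e l)
    (hb : PB g (fun i => (l i).length)) (hv : Calc g e v) (hd : Calc g e d) :
    Calc g e (fun i => lookupD (l i) (v i) (d i)) :=
  foldl' (F := fun i (acc : α) (q : ℕ × α) => if decide (q.1 = v i) = true then q.2 else acc)
    hl hd hb
    fun _ π _ _ _ => cond (natEq var.snd.fst (hv.lift π _)) var.snd.snd var.fst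

theorem zipIdx {l : ι → List α} (hl : Calc g e l) (hb : PB g (fun i => (l i).length)) :
    Calc g e (fun i => List.zipIdx (l i)) := by
  have key : ∀ (l : List α) (n : ℕ) (r : List (α × ℕ)), (l.foldl
      (fun (s : ℕ × List (α × ℕ)) a => (s.1 + 1, (a, s.1) :: s.2)) (n, r)).2.reverse
      = r.reverse ++ List.zipIdx l n := by
    intro l
    induction l with
    | nil => simp
    | cons a l ih => intro n r; simp [ih]
  have h := foldl' (F := fun _ (s : ℕ × List (α × ℕ)) a => (s.1 + 1, (a, s.1) :: s.2)) hl
    (natZero.pair nil) hb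
    fun ι' π s a _ => (natAdd var.fst.fst natOne).pair ((var.snd.pair var.fst.fst).cons var.fst.snd)
  have h2 := reverse h.snd (hb.of_le fun i => by
    rw [← List.length_reverse, key]; simp)
  simpa only [key, List.reverse_nil, List.nil_append] using h2

theorem mulNat {B : ι → ℕ} {x : ι → ℝ} (hB : Calc g e B) (hb : PB g B) (hx : Calc g e x) :
    Calc g e (fun i => mulNat (B i) (x i)) :=
  foldl' (F := fun i s _ => s + x i) (range hB hb) realZero (by simpa using hb)
    fun _ π _ _ _ => realAdd var.fst (hx.lift π _)

end Calc

noncomputable instance : Code Wit :=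
  ⟨ty (List ℕ × List ℕ × List (ℕ × ℕ) × List (ℕ × ℕ) × List (ℕ × ℕ)),
    fun w => enc (w.opened, w.ign, w.asg, w.pu, w.pf)⟩

namespace Calc

variable {ι γ α β : Type} [Code γ] [Code α] [Code β] {g : ι → ℕ × ℕ} {e : ι → γ}

/-- A partial solution is encoded as the tuple of its fields, so the same program computes both. -/
theorem witTuple {w : ι → Wit} (h : Calc g e w) :
    Calc g e (fun i => ((w i).opened, (w i).ign, (w i).asg, (w i).pu, (w i).pf)) := h

theorem witMk {a b : ι → List ℕ} {c d f : ι → List (ℕ × ℕ)} (ha : Calc g e a) (hb : Calc g e b)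
    (hc : Calc g e c) (hd : Calc g e d) (hf : Calc g e f) :
    Calc g e (fun i => (⟨a i, b i, c i, d i, f i⟩ : Wit)) :=
  ha.pair (hb.pair (hc.pair (hd.pair hf)))

variable {w w' : ι → Wit}

theorem opened (h : Calc g e w) : Calc g e (fun i => (w i).opened) := h.witTuple.fst
theorem ign (h : Calc g e w) : Calc g e (fun i => (w i).ign) := h.witTuple.snd.fst
theorem asg (h : Calc g e w) : Calc g e (fun i => (w i).asg) := h.witTuple.snd.snd.fst
theorem pu (h : Calc g e w) : Calc g e (fun i => (w i).pu) := h.witTuple.snd.snd.snd.fst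
theorem pf (h : Calc g e w) : Calc g e (fun i => (w i).pf) := h.witTuple.snd.snd.snd.snd

end Calc

section

variable {ι : Type} {g : ι → ℕ × ℕ} {w : ι → Wit}

theorem PB.opened (h : PB g fun i => (w i).size) : PB g fun i => (w i).opened.length :=
  h.of_le fun i => by simp only [Wit.size]; omega
theorem PB.ign (h : PB g fun i => (w i).size) : PB g fun i => (w i).ign.length :=
  h.of_le fun i => by simp only [Wit.size]; omega
theorem PB.asg (h : PB g fun i => (w i).size) : PB g fun i => (w i).asg.length :=
  h.of_le fun i => by simp only [Wit.size]; omega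
theorem PB.pu (h : PB g fun i => (w i).size) : PB g fun i => (w i).pu.length :=
  h.of_le fun i => by simp only [Wit.size]; omega
theorem PB.pf (h : PB g fun i => (w i).size) : PB g fun i => (w i).pf.length :=
  h.of_le fun i => by simp only [Wit.size]; omega

end

/-! ### Sizes of partial solutions and of normalised tables -/

theorem Wit.size_shift (L : ℕ) (w : Wit) : (w.shift L).size = w.size := by
  simp [Wit.shift, Wit.size]

theorem Wit.size_add (w w' : Wit) : (w.add w').size = w.size + w'.size := by
  simp only [Wit.add, Wit.size, List.length_append]; omega

theorem Wit.size_of_mem_matches {R : ℕ} {w v : Wit} (h : v ∈ w.matches' R) :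
    v.size ≤ w.size + 1 := by
  simp only [Wit.matches', List.mem_flatMap] at h
  obtain ⟨x, hx, y, hy, h⟩ := h
  split_ifs at h
  · simp only [List.mem_singleton] at h
    subst h
    have h1 := List.length_erase_le (a := x) (l := w.pu)
    have h2 := List.length_erase_le (a := y) (l := w.pf)
    simp only [Wit.matched, Wit.size, List.length_cons]
    omega
  · simp at h

theorem List.length_flatMap_le {α β : Type} (l : List α) (f : α → List β) (m : ℕ)
    (h : ∀ a ∈ l, (f a).length ≤ m) : (l.flatMap f).length ≤ l.length * m := by
  induction l with
  | nil => simp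
  | cons a l ih =>
    have h1 := ih fun b hb => h b (by simp [hb])
    have h2 := h a (by simp)
    simp only [List.flatMap_cons, List.length_append, List.length_cons]
    nlinarith

theorem Wit.length_matches_le (R : ℕ) (w : Wit) : (w.matches' R).length ≤ w.size * w.size := by
  refine (List.length_flatMap_le _ _ w.size fun x _ => ?_).trans
    (Nat.mul_le_mul_right _ (by simp only [Wit.size]; omega))
  refine (List.length_flatMap_le _ _ 1 fun y _ => ?_).trans (by simp only [Wit.size]; omega)
  split_ifs <;> simp

/-- A bound on the length of normalised tables. -/
def tableBound (M R : ℕ) : ℕ := (M + 1) * ((M + 1) * ((M + 1) ^ (R + 1) * (M + 1) ^ (R + 1)))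

/-- The properties of normalised tables that bound the running time. -/
structure IsSmall (M R : ℕ) (T : List Wit) : Prop where
  length_le : T.length ≤ tableBound M R
  size_le : ∀ w ∈ T, w.size ≤ M

theorem countSnd_le (a : ℕ) (l : List (ℕ × ℕ)) : countSnd a l ≤ l.length :=
  List.length_filter_le _ _

/-- Pairwise inequivalent entries inject into the tuples of two counters and two histograms on `0,
..., R`, all with values at most `M`. This is the place where the running time becomes exponential
in `R`. -/
theorem length_le_tableBound {M R : ℕ} {T : List Wit} (hT : ∀ w ∈ T, w.size ≤ M)
    (hs : T.Pairwise fun w w' => w.same R w' = false) : T.length ≤ tableBound M R := by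
  let key : Wit → Fin (M + 1) × Fin (M + 1) × (Fin (R + 1) → Fin (M + 1)) ×
      (Fin (R + 1) → Fin (M + 1)) := fun w =>
    (Fin.ofNat _ w.opened.length, Fin.ofNat _ w.ign.length,
      fun a => Fin.ofNat _ (countSnd a w.pu), fun a => Fin.ofNat _ (countSnd a w.pf))
  have hnd : (T.map key).Nodup := by
    rw [List.Nodup, List.pairwise_map]
    refine hs.imp_of_mem fun {w w'} hw hw' h hk => ?_
    have h1 := hT w hw
    have h2 := hT w' hw'
    simp only [Wit.size] at h1 h2
    have c1 : ∀ a, countSnd a w.pu ≤ M := fun a => (countSnd_le a _).trans (by omega)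
    have c2 : ∀ a, countSnd a w.pf ≤ M := fun a => (countSnd_le a _).trans (by omega)
    have c3 : ∀ a, countSnd a w'.pu ≤ M := fun a => (countSnd_le a _).trans (by omega)
    have c4 : ∀ a, countSnd a w'.pf ≤ M := fun a => (countSnd_le a _).trans (by omega)
    simp only [key, Prod.mk.injEq, Fin.ofNat, Fin.mk.injEq, funext_iff] at hk
    obtain ⟨k1, k2, k3, k4⟩ := hk
    rw [Nat.mod_eq_of_lt (by omega), Nat.mod_eq_of_lt (by omega)] at k1 k2
    have : w.same R w' = true := by
      simp only [Wit.same, Bool.and_eq_true, decide_eq_true_eq, List.all_eq_true, List.mem_range]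
      refine ⟨k1, k2, fun a ha => ⟨?_, ?_⟩⟩
      · have := k3 ⟨a, ha⟩
        rwa [Nat.mod_eq_of_lt (Nat.lt_succ_of_le (c1 _)),
          Nat.mod_eq_of_lt (Nat.lt_succ_of_le (c3 _))] at this
      · have := k4 ⟨a, ha⟩
        rwa [Nat.mod_eq_of_lt (Nat.lt_succ_of_le (c2 _)),
          Nat.mod_eq_of_lt (Nat.lt_succ_of_le (c4 _))] at this
    simp [this] at h
  have := hnd.length_le_card
  simpa [tableBound] using this

/-- Nothing is needed about the input: oversized entries and duplicates of a class are filtered out.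
-/
theorem normalise_isSmall (M R : ℕ) (T : List Wit) : IsSmall M R (normalise M R T) := by
  have key : ∀ acc : List Wit, ((∀ w ∈ acc, w.size ≤ M) ∧
      acc.Pairwise fun w w' => w.same R w' = false) →
      (∀ w ∈ T.foldl (fun acc w => if (w.ok M R && !(acc.any fun w' => w.same R w')) = true
        then w :: acc else acc) acc, w.size ≤ M) ∧
      (T.foldl (fun acc w => if (w.ok M R && !(acc.any fun w' => w.same R w')) = true
        then w :: acc else acc) acc).Pairwise fun w w' => w.same R w' = false := by
    induction T with
    | nil => exact fun acc h => h
    | cons w T ih =>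
      intro acc h
      refine ih _ ?_
      dsimp only
      split_ifs with hc
      · simp only [Wit.ok, Bool.and_eq_true, Bool.not_eq_true', decide_eq_true_eq,
          List.any_eq_false, Bool.not_eq_true] at hc
        exact ⟨by simpa using ⟨hc.1.1, h.1⟩, List.pairwise_cons.2 ⟨hc.2, h.2⟩⟩
      · exact h
  obtain ⟨h1, h2⟩ := key [] (by simp)
  exact ⟨length_le_tableBound h1 h2, h1⟩

theorem IsSmall.foldl_of_step {M R : ℕ} {α : Type} (l : List α)
    (F : List Wit → α → List Wit) (hF : ∀ T a, IsSmall M R T → IsSmall M R (F T a))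
    (T : List Wit) (hT : IsSmall M R T) : IsSmall M R (l.foldl F T) := by
  induction l generalizing T with
  | nil => exact hT
  | cons a l ih => exact ih _ (hF _ _ hT)

theorem IsSmall.mono_foldl {M R : ℕ} {α : Type} (l : List α) (F : List Wit → α → List Wit)
    (hF : ∀ T a, IsSmall M R (F T a)) (T : List Wit) (hT : IsSmall M R T) :
    IsSmall M R (l.foldl F T) := by
  induction l generalizing T with
  | nil => exact hT
  | cons a l ih => exact ih _ (hF _ _)

theorem closeTable_isSmall {M R n : ℕ} {T : List Wit} (hT : IsSmall M R T) :
    IsSmall M R (closeTable M R n T) :=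
  IsSmall.mono_foldl _ _ (fun _ _ => normalise_isSmall _ _ _) _ hT

theorem merge_isSmall (M R n : ℕ) (T₁ T₂ : List Wit) : IsSmall M R (merge M R n T₁ T₂) :=
  closeTable_isSmall (normalise_isSmall _ _ _)

theorem isSmall_empty (M R : ℕ) : IsSmall M R [Wit.empty] :=
  ⟨by simp [tableBound]; exact Nat.one_le_iff_ne_zero.2 (by positivity), by
    simp [Wit.empty, Wit.size]⟩

theorem vertexTable_isSmall (M R r : ℕ) (users facs : List ℕ) (v : ℕ) :
    IsSmall M R (vertexTable M R r users facs v) := by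
  have key : ∀ (l : List (ℕ × ℕ)) (t : ℕ → List Wit) (T : List Wit), IsSmall M R T →
      IsSmall M R (l.foldl (fun T q => if decide (q.1 = v) = true
        then merge M R users.length T (t q.2) else T) T) := by
    intro l t
    induction l with
    | nil => exact fun T h => h
    | cons q l ih =>
      intro T hT
      refine ih _ ?_
      dsimp only
      split_ifs
      exacts [merge_isSmall _ _ _ _ _, hT]
  exact key _ _ _ (key _ _ _ (isSmall_empty M R))

/-! ### Programs for the operations on tables -/

namespace Calc

variable {ι γ α β : Type} [Code γ] [Code α] [Code β] {g : ι → ℕ × ℕ} {e : ι → γ}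
  {w w' : ι → Wit} {M R n : ι → ℕ} {T T' : ι → List Wit} {m m' : ι → ℕ}

theorem witSize (h : Calc g e w) (hb : PB g fun i => (w i).size) :
    Calc g e (fun i => (w i).size) :=
  natAdd (natAdd (natAdd (natAdd (length h.opened hb.opened) (length h.ign hb.ign))
    (length h.asg hb.asg)) (length h.pu hb.pu)) (length h.pf hb.pf)

theorem witAdd (h : Calc g e w) (hb : PB g fun i => (w i).size) (h' : Calc g e w') :
    Calc g e (fun i => (w i).add (w' i)) :=
  witMk (append h.opened h'.opened hb.opened) (append h.ign h'.ign hb.ign)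
    (append h.asg h'.asg hb.asg) (append h.pu h'.pu hb.pu) (append h.pf h'.pf hb.pf)

theorem witShift {L : ι → ℕ} (hL : Calc g e L) (h : Calc g e w)
    (hb : PB g fun i => (w i).size) : Calc g e (fun i => (w i).shift (L i)) :=
  witMk h.opened h.ign h.asg
    (map (F := fun i (x : ℕ × ℕ) => (x.1, x.2 + L i)) h.pu hb.pu fun _ π _ _ =>
      var.fst.pair (natAdd var.snd (hL.lift π _)))
    (map (F := fun i (x : ℕ × ℕ) => (x.1, x.2 + L i)) h.pf hb.pf fun _ π _ _ =>
      var.fst.pair (natAdd var.snd (hL.lift π _)))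

theorem witMatched {x y : ι → ℕ × ℕ} (h : Calc g e w) (hb : PB g fun i => (w i).size)
    (hx : Calc g e x) (hy : Calc g e y) : Calc g e (fun i => (w i).matched (x i) (y i)) :=
  witMk h.opened h.ign ((hx.fst.pair hy.fst).cons h.asg) (erase h.pu hx hb.pu)
    (erase h.pf hy hb.pf)

theorem witOk (hM : Calc g e M) (hR : Calc g e R) (h : Calc g e w)
    (hb : PB g fun i => (w i).size) : Calc g e (fun i => (w i).ok (M i) (R i)) :=
  bAnd (natLe (witSize h hb) hM) (bAnd
    (all (F := fun i (x : ℕ × ℕ) => decide (x.2 ≤ R i)) h.pu hb.pu fun _ π _ _ =>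
      natLe var.snd (hR.lift π _))
    (all (F := fun i (x : ℕ × ℕ) => decide (x.2 ≤ R i)) h.pf hb.pf fun _ π _ _ =>
      natLe var.snd (hR.lift π _)))

theorem countSnd {a : ι → ℕ} {l : ι → List (ℕ × ℕ)} (ha : Calc g e a) (hl : Calc g e l)
    (hb : PB g fun i => (l i).length) : Calc g e (fun i => countSnd (a i) (l i)) :=
  length (filter (F := fun i (x : ℕ × ℕ) => decide (x.2 = a i)) hl hb fun _ π _ _ =>
    natEq var.snd (ha.lift π _)) (hb.of_le fun _ => List.length_filter_le _ _)

theorem witSame (hR : Calc g e R) (hRb : PB g R) (h : Calc g e w)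
    (hb : PB g fun i => (w i).size) (h' : Calc g e w') (hb' : PB g fun i => (w' i).size) :
    Calc g e (fun i => (w i).same (R i) (w' i)) :=
  bAnd (natEq (length h.opened hb.opened) (length h'.opened hb'.opened))
    (bAnd (natEq (length h.ign hb.ign) (length h'.ign hb'.ign))
    (all (F := fun i a => decide (_root_.countSnd a (w i).pu = _root_.countSnd a (w' i).pu) &&
      decide (_root_.countSnd a (w i).pf = _root_.countSnd a (w' i).pf))
      (range (natAdd hR natOne) (hRb.add (PB.const 1)))
      (by simpa using hRb.add (PB.const 1)) fun _ π a _ =>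
      bAnd (natEq (countSnd var (h.pu.lift π _) (hb.pu.lift π))
        (countSnd var (h'.pu.lift π _) (hb'.pu.lift π)))
      (natEq (countSnd var (h.pf.lift π _) (hb.pf.lift π))
        (countSnd var (h'.pf.lift π _) (hb'.pf.lift π)))))

theorem witMatches (hR : Calc g e R) (h : Calc g e w) (hb : PB g fun i => (w i).size) :
    Calc g e (fun i => (w i).matches' (R i)) := by
  refine flatMap (F := fun i (x : ℕ × ℕ) => (w i).pf.flatMap fun (y : ℕ × ℕ) =>
    if decide (x.2 + y.2 ≤ R i) = true then [(w i).matched x y] else []) h.pu hb.pu hb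
    (fun i x _ => (List.length_flatMap_le _ _ 1 fun y _ => by split_ifs <;> simp).trans
      (by simp only [Wit.size]; omega)) fun ι' π x _ => ?_
  have hx : Calc (fun j => g (π j)) (fun j => (e (π j), x j)) x := var
  exact flatMap (F := fun i (y : ℕ × ℕ) =>
    if decide ((x i).2 + y.2 ≤ R (π i)) = true then [(w (π i)).matched (x i) y] else [])
    (h.pf.lift π _) (hb.pf.lift π) (PB.const 1) (fun i y _ => by split_ifs <;> simp)
    fun _ π' y _ => listIte (natLe (natAdd (hx.snd.lift π' y) var.snd) ((hR.lift π x).lift π' y))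
      (witMatched ((h.lift π x).lift π' y) ((hb.lift π).lift π') (hx.lift π' y) var)

theorem normalise (hM : Calc g e M) (hMb : PB g M) (hR : Calc g e R) (hRb : BoundedByParam g R)
    (hT : Calc g e T) (hTb : PB g fun i => (T i).length) (hm : PB g m)
    (hTm : ∀ i, ∀ w ∈ T i, w.size ≤ m i) : Calc g e (fun i => normalise (M i) (R i) (T i)) := by
  have htb : PB g fun i => tableBound (M i) (R i) := by
    have h1 := hMb.add (PB.const 1)
    have h2 := h1.pow (hRb.add_const 1)
    exact h1.mul (h1.mul (h2.mul h2))
  -- The length bound is not preserved by a single step from an arbitrary small table. It holds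
  -- because the accumulator after a prefix is itself the normalisation of that prefix.
  refine foldlPrefix (F := fun i (acc : List Wit) (w : Wit) => if (w.ok (M i) (R i) &&
      !(acc.any fun w' => w.same (R i) w')) = true then w :: acc else acc)
    (fun i => IsSmall (M i) (R i)) hT nil hTb (fun i l₁ _ => normalise_isSmall (M i) (R i) l₁)
    fun ι' π s a ha hs => ?_
  have hsb : PB (fun j => g (π j)) fun j => (a j).size :=
    (hm.lift π).of_le fun j => hTm _ _ (ha j)
  have hlen : PB (fun j => g (π j)) fun j => (s j).length :=
    (htb.lift π).of_le fun j => (hs j).length_le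
  have hv : Calc (fun j => g (π j)) (fun j => (e (π j), (s j, a j))) (fun j => (s j, a j)) := var
  exact cond (bAnd (witOk (hM.lift π _) (hR.lift π _) hv.snd hsb)
    (bNot (any (F := fun j w' => (a j).same (R (π j)) w') hv.fst hlen
      fun ι'' π' w' hw' => witSame ((hR.lift π fun j => (s j, a j)).lift π' w') ((hRb.pb.lift π).lift π')
        (hv.snd.lift π' w') (hsb.lift π') var
        (((hMb.lift π).lift π').of_le fun j => (hs _).size_le _ (hw' j)))))
    (hv.snd.cons hv.fst) hv.fst

end Calc

namespace Calc

variable {ι γ α β : Type} [Code γ] [Code α] [Code β] {g : ι → ℕ × ℕ} {e : ι → γ}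
  {w w' : ι → Wit} {M R n r nv B : ι → ℕ} {T T' : ι → List Wit} {m m' : ι → ℕ}
  {users facs : ι → List ℕ}

theorem closeStep (hM : Calc g e M) (hMb : PB g M) (hR : Calc g e R) (hRb : BoundedByParam g R)
    (hT : Calc g e T) (hTb : PB g fun i => (T i).length) (hTm : ∀ i, ∀ w ∈ T i, w.size ≤ M i) :
    Calc g e (fun i => closeStep (M i) (R i) (T i)) := by
  have hlen : ∀ i, ∀ w ∈ T i, (w.matches' (R i)).length ≤ M i * M i := fun i w hw =>
    (w.length_matches_le _).trans (Nat.mul_le_mul (hTm i w hw) (hTm i w hw))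
  refine normalise hM hMb hR hRb (m := fun i => M i + 1) (append hT (flatMap
    (F := fun i w => w.matches' (R i)) hT hTb (hMb.mul hMb) hlen
    fun _ π w hw => witMatches (hR.lift π _) var ((hMb.lift π).of_le fun j => hTm _ _ (hw j))) hTb)
    ((hTb.add (hTb.mul (hMb.mul hMb))).of_le fun i => ?_) (hMb.add (PB.const 1)) fun i w hw => ?_
  · rw [List.length_append]
    exact Nat.add_le_add_left (List.length_flatMap_le _ _ _ (hlen i)) _
  · rcases List.mem_append.1 hw with h | h
    · exact (hTm i w h).trans (Nat.le_succ _)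
    · obtain ⟨v, hv, hw⟩ := List.mem_flatMap.1 h
      exact (Wit.size_of_mem_matches hw).trans (Nat.succ_le_succ (hTm i v hv))

theorem PB_tableBound (hMb : PB g M) (hRb : BoundedByParam g R) :
    PB g fun i => tableBound (M i) (R i) := by
  have h1 := hMb.add (PB.const 1)
  have h2 := h1.pow (hRb.add_const 1)
  exact h1.mul (h1.mul (h2.mul h2))

theorem closeTable (hM : Calc g e M) (hMb : PB g M) (hR : Calc g e R)
    (hRb : BoundedByParam g R) (hn : Calc g e n) (hnb : PB g n) (hT : Calc g e T)
    (hTs : ∀ i, IsSmall (M i) (R i) (T i)) :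
    Calc g e (fun i => closeTable (M i) (R i) (n i) (T i)) := by
  refine foldl (F := fun i (T : List Wit) (_ : ℕ) => _root_.closeStep (M i) (R i) T)
    (fun i => IsSmall (M i) (R i)) (range hn hnb) hT (by simpa using hnb) hTs
    (fun i s _ _ _ => normalise_isSmall _ _ _) fun ι' π s a _ hs => ?_
  exact closeStep (hM.lift π _) (hMb.lift π) (hR.lift π _) (hRb.lift π) var.fst
    (((PB_tableBound hMb hRb).lift π).of_le fun j => (hs j).length_le) fun j => (hs j).size_le

theorem merge (hM : Calc g e M) (hMb : PB g M) (hR : Calc g e R)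
    (hRb : BoundedByParam g R) (hn : Calc g e n) (hnb : PB g n) (hT : Calc g e T)
    (hTs : ∀ i, IsSmall (M i) (R i) (T i)) (hT' : Calc g e T')
    (hTb' : PB g fun i => (T' i).length) (hm : PB g m) (hTm' : ∀ i, ∀ w ∈ T' i, w.size ≤ m i) :
    Calc g e (fun i => merge (M i) (R i) (n i) (T i) (T' i)) := by
  have hTb : PB g fun i => (T i).length :=
    (PB_tableBound hMb hRb).of_le fun j => (hTs j).length_le
  refine closeTable hM hMb hR hRb hn hnb (normalise hM hMb hR hRb (m := fun i => M i + m i)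
    (flatMap (F := fun i w => (T' i).map fun w' => w.add w') hT hTb hTb' (fun i w _ => by simp)
      fun ι' π w hw => ?_)
    ((hTb.mul hTb').of_le fun i => List.length_flatMap_le _ _ _ fun w _ => by simp)
    (hMb.add hm) ?_) fun i => normalise_isSmall _ _ _
  · have hv : Calc (fun j => g (π j)) (fun j => (e (π j), w j)) w := var
    exact map (F := fun i w' => (w i).add w') (hT'.lift π _) (hTb'.lift π)
      fun ι'' π' w' _ => witAdd (hv.lift π' _)
        (((hMb.lift π).lift π').of_le fun j => (hTs _).size_le _ (hw (π' j))) var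
  · intro i w hw
    simp only [List.mem_flatMap, List.mem_map] at hw
    obtain ⟨a, ha, b, hb, rfl⟩ := hw
    rw [Wit.size_add]
    exact Nat.add_le_add ((hTs i).size_le a ha) (hTm' i b hb)

theorem userTable {u : ι → ℕ} (hu : Calc g e u) : Calc g e (fun i => userTable (u i)) :=
  (witMk nil (hu.cons nil) nil nil nil).cons
    ((witMk nil nil nil ((hu.pair natZero).cons nil) nil).cons nil)

theorem witEmpty : Calc g e (fun _ => Wit.empty) := witMk nil nil nil nil nil

theorem facTable {f : ι → ℕ} (hr : Calc g e r) (hn : Calc g e n) (hnb : PB g n)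
    (hf : Calc g e f) : Calc g e (fun i => facTable (r i) (n i) (f i)) := by
  have hb : PB g fun i => (List.range (n i + 1)).length := by simpa using hnb.add (PB.const 1)
  refine witEmpty.cons (map (F := fun i (s : ℕ) =>
    (⟨[f i], [], [], [], (List.range s).map fun _ => (f i, 0)⟩ : Wit))
    (filter (F := fun i s => decide (r i ≤ s)) (range (natAdd hn natOne) (hnb.add (PB.const 1))) hb
      fun _ π _ _ => natLe (hr.lift π _) var) (hb.of_le fun i => List.length_filter_le _ _)
    fun ι' π s hs => ?_)
  have hsb : PB (fun j => g (π j)) s := (hnb.lift π).of_le fun j => by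
    have := List.mem_range.1 (List.mem_filter.1 (hs j)).1
    omega
  exact witMk ((hf.lift π _).cons nil) nil nil nil (map (F := fun j (_ : ℕ) => (f (π j), 0))
    (range var hsb) (by simpa using hsb) fun _ π' _ _ =>
    ((hf.lift π s).lift π' _).pair natZero)

theorem size_facTable {r n f : ℕ} {w : Wit} (hw : w ∈ _root_.facTable r n f) : w.size ≤ n + 1 := by
  simp only [_root_.facTable, List.mem_cons, List.mem_map, List.mem_filter, List.mem_range] at hw
  obtain rfl | ⟨s, ⟨hs, -⟩, rfl⟩ := hw
  · simp [Wit.size, Wit.empty]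
  · simp [Wit.size]; omega

theorem length_facTable (r n f : ℕ) : (_root_.facTable r n f).length ≤ n + 2 := by
  have := List.length_filter_le (fun s => decide (r ≤ s)) (List.range (n + 1))
  simp only [List.length_range] at this
  simp only [_root_.facTable, List.length_cons, List.length_map]
  omega

theorem vertexTable {v : ι → ℕ} (hM : Calc g e M) (hMb : PB g M) (hR : Calc g e R)
    (hRb : BoundedByParam g R) (hr : Calc g e r) (hu : Calc g e users)
    (hub : PB g fun i => (users i).length) (hf : Calc g e facs)
    (hfb : PB g fun i => (facs i).length) (hv : Calc g e v) :
    Calc g e (fun i => vertexTable (M i) (R i) (r i) (users i) (facs i) (v i)) := by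
  have hn := length hu hub
  have hs : ∀ i, IsSmall (M i) (R i) [Wit.empty] := fun i => isSmall_empty _ _
  have hstep : ∀ i (T : List Wit) (c : Bool) (T' : List Wit), IsSmall (M i) (R i) T →
      IsSmall (M i) (R i)
        (if c = true then _root_.merge (M i) (R i) (users i).length T T' else T) := by
    intro i T c T' hT
    split_ifs
    exacts [merge_isSmall _ _ _ _ _, hT]
  refine foldl (F := fun i (T : List Wit) (q : ℕ × ℕ) => if decide (q.1 = v i) = true then
      _root_.merge (M i) (R i) (users i).length T
        (_root_.facTable (r i) (users i).length q.2) else T)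
    (fun i => IsSmall (M i) (R i)) (zipIdx hf hfb) (foldl (F := fun i (T : List Wit) (q : ℕ × ℕ) =>
      if decide (q.1 = v i) = true then
      _root_.merge (M i) (R i) (users i).length T (_root_.userTable q.2) else T)
    (fun i => IsSmall (M i) (R i)) (zipIdx hu hub) (witEmpty.cons nil) (by simpa using hub)
    (fun i => hs i) (fun i s a _ h => hstep i s _ _ h) fun ι' π s a _ h => ?_)
    (by simpa using hfb) (fun i => ?_) (fun i s a _ h => hstep i s _ _ h) fun ι' π s a _ h => ?_
  · have hs : Calc (fun j => g (π j)) (fun j => (e (π j), (s j, a j))) (fun j => (s j, a j)) := var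
    exact cond (natEq hs.snd.fst (hv.lift π _)) (merge (m := fun _ => 1) (hM.lift π _) (hMb.lift π)
      (hR.lift π _) (hRb.lift π) (hn.lift π _) (hub.lift π) hs.fst (fun j => h j)
      (userTable hs.snd.snd) (PB.const 2) (PB.const 1) fun j w hw => by
        simp only [_root_.userTable, List.mem_cons, List.not_mem_nil, or_false] at hw
        obtain rfl | rfl := hw <;> simp [Wit.size]) hs.fst
  · exact IsSmall.foldl_of_step _ _ (fun s a h => hstep i s _ _ h) _ (hs i)
  · have hs : Calc (fun j => g (π j)) (fun j => (e (π j), (s j, a j))) (fun j => (s j, a j)) := var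
    exact cond (natEq hs.snd.fst (hv.lift π _)) (merge (hM.lift π _) (hMb.lift π)
      (hR.lift π _) (hRb.lift π) (hn.lift π _) (hub.lift π) hs.fst (fun j => h j)
      (facTable (hr.lift π _) (hn.lift π _) (hub.lift π) hs.snd.snd)
      (((hub.lift π).add (PB.const 2)).of_le fun j => length_facTable _ _ _)
      ((hub.lift π).add (PB.const 1)) fun j w hw => size_facTable hw) hs.fst

theorem lookupD_of {α : Type} {P : α → Prop} (l : List (ℕ × α)) (v : ℕ) (d : α) (hd : P d)
    (hl : ∀ q ∈ l, P q.2) : P (_root_.lookupD l v d) := by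
  unfold _root_.lookupD
  induction l generalizing d with
  | nil => exact hd
  | cons q l ih =>
    refine ih _ ?_ fun q hq => hl q (by simp [hq])
    dsimp only
    split_ifs
    exacts [hl q (by simp), hd]

theorem isSmall_nil (M R : ℕ) : IsSmall M R [] := ⟨by simp, by simp⟩

theorem contract {tabs : ι → List (ℕ × List Wit)} {q : ι → ℕ × ℕ × ℕ} (hM : Calc g e M)
    (hMb : PB g M) (hR : Calc g e R) (hRb : BoundedByParam g R) (hn : Calc g e n) (hnb : PB g n)
    (ht : Calc g e tabs) (htb : PB g fun i => (tabs i).length)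
    (hts : ∀ i, ∀ x ∈ tabs i, IsSmall (M i) (R i) x.2) (hq : Calc g e q) :
    Calc g e (fun i => contract (M i) (R i) (n i) (tabs i) (q i)) := by
  have hT := lookupD ht htb hq.snd.fst (nil (α := Wit))
  have hTs : ∀ i, IsSmall (M i) (R i) (_root_.lookupD (tabs i) (q i).2.1 []) := fun i =>
    lookupD_of _ _ _ (isSmall_nil _ _) (hts i)
  have hTb : PB g fun i => (_root_.lookupD (tabs i) (q i).2.1 []).length :=
    (PB_tableBound hMb hRb).of_le fun i => (hTs i).length_le
  have hS : Calc g e fun i =>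
      (_root_.lookupD (tabs i) (q i).2.1 []).map fun w => w.shift (q i).2.2 :=
    map (F := fun i (w : Wit) => w.shift (q i).2.2) hT hTb fun _ π w hw =>
      witShift (hq.snd.snd.lift π _) var ((hMb.lift π).of_le fun j => (hTs _).size_le _ (hw j))
  refine map (F := fun i (x : ℕ × List Wit) => if decide (x.1 = (q i).1) = true then
    (x.1, _root_.merge (M i) (R i) (n i) x.2
      ((_root_.lookupD (tabs i) (q i).2.1 []).map fun w => w.shift (q i).2.2)) else x) ht htb
      fun ι' π x hx => ?_
  exact cond (natEq var.fst (hq.fst.lift π _)) (var.fst.pair (merge (m := fun j => M (π j))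
    (hM.lift π _) (hMb.lift π) (hR.lift π _) (hRb.lift π) (hn.lift π _) (hnb.lift π) var.snd
    (fun j => hts _ _ (hx j)) (hS.lift π _) (by simpa using hTb.lift π) (hMb.lift π)
    fun j w hw => by
      obtain ⟨v, hv, rfl⟩ := List.mem_map.1 hw
      rw [Wit.size_shift]
      exact (hTs _).size_le v hv)) var

theorem rootTable {ord : ι → List (ℕ × ℕ × ℕ)} (hM : Calc g e M) (hMb : PB g M)
    (hR : Calc g e R) (hRb : BoundedByParam g R) (hr : Calc g e r) (hnv : Calc g e nv)
    (hnvb : PB g nv) (hu : Calc g e users) (hub : PB g fun i => (users i).length)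
    (hf : Calc g e facs) (hfb : PB g fun i => (facs i).length) (ho : Calc g e ord)
    (hob : PB g fun i => (ord i).length) :
    Calc g e (fun i => rootTable (M i) (R i) (r i) (nv i) (users i) (facs i) (ord i)) ∧
    ∀ i, IsSmall (M i) (R i)
      (_root_.rootTable (M i) (R i) (r i) (nv i) (users i) (facs i) (ord i)) := by
  have hn := length hu hub
  let Inv : ι → List (ℕ × List Wit) → Prop := fun i tabs =>
    tabs.length = nv i ∧ ∀ x ∈ tabs, IsSmall (M i) (R i) x.2
  have h0 : ∀ i, Inv i ((List.range (nv i)).map fun v =>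
      (v, _root_.vertexTable (M i) (R i) (r i) (users i) (facs i) v)) := fun i =>
    ⟨by simp, fun x hx => by
      obtain ⟨v, _, rfl⟩ := List.mem_map.1 hx
      exact vertexTable_isSmall _ _ _ _ _ _⟩
  have h1 : ∀ i s (a : ℕ × ℕ × ℕ), Inv i s →
      Inv i (_root_.contract (M i) (R i) (users i).length s a) := by
    intro i s a hs
    refine ⟨by simpa [_root_.contract] using hs.1, fun x hx => ?_⟩
    obtain ⟨v, hv, rfl⟩ := List.mem_map.1 hx
    split_ifs
    exacts [merge_isSmall _ _ _ _ _, hs.2 v hv]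
  have h2 : ∀ i (l : List (ℕ × ℕ × ℕ)) s, Inv i s →
      Inv i (l.foldl (_root_.contract (M i) (R i) (users i).length) s) := by
    intro i l
    induction l with
    | nil => exact fun s h => h
    | cons a l ih => exact fun s h => ih _ (h1 i s a h)
  have hc : Calc g e fun i => (ord i).foldl (_root_.contract (M i) (R i) (users i).length)
      ((List.range (nv i)).map fun v =>
        (v, _root_.vertexTable (M i) (R i) (r i) (users i) (facs i) v)) := by
    refine foldl Inv ho (map (F := fun i (v : ℕ) =>
      (v, _root_.vertexTable (M i) (R i) (r i) (users i) (facs i) v)) (range hnv hnvb)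
      (by simpa using hnvb) fun _ π v _ => ?_) hob h0 (fun i s a _ h => h1 i s a h)
      fun ι' π s a _ hs => ?_
    · exact var.pair (vertexTable (hM.lift π _) (hMb.lift π) (hR.lift π _) (hRb.lift π)
        (hr.lift π _) (hu.lift π _) (hub.lift π) (hf.lift π _) (hfb.lift π) var)
    · exact contract (hM.lift π _) (hMb.lift π) (hR.lift π _) (hRb.lift π)
        (hn.lift π _) (hub.lift π) var.fst ((hnvb.lift π).of_le fun j => (hs j).1.le)
        (fun j => (hs j).2) var.snd
  exact ⟨lookupD hc (hnvb.of_le fun i => (h2 i _ _ (h0 i)).1.le) natZero nil, fun i =>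
    lookupD_of _ _ _ (isSmall_nil _ _) (h2 i _ _ (h0 i)).2⟩

theorem pick {A : ι → List (ℕ × ℕ)} (hA : Calc g e A) (hAb : PB g fun i => (A i).length)
    (hT : Calc g e T) (hTb : PB g fun i => (T i).length) (hm : PB g m)
    (hTm : ∀ i, ∀ w ∈ T i, w.size ≤ m i) : Calc g e (fun i => pick (A i) (T i)) := by
  refine foldl' (F := fun i (o : Option Wit) (w : Wit) => if (decide (w.pu.length = 0) &&
    (decide (w.pf.length = 0) && (A i).any fun q => decide (q = (w.opened.length, w.ign.length))))
      = true then Option.some w else o) hT none hTb fun ι' π s a ha => ?_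
  have hs : Calc (fun j => g (π j)) (fun j => (e (π j), (s j, a j))) (fun j => (s j, a j)) := var
  have hb : PB (fun j => g (π j)) fun j => (a j).size := (hm.lift π).of_le fun j => hTm _ _ (ha j)
  have hw := hs.snd
  exact cond (bAnd (natEq (length hw.pu hb.pu) natZero) (bAnd (natEq (length hw.pf hb.pf) natZero)
    (any (F := fun j (q : ℕ × ℕ) => decide (q = ((a j).opened.length, (a j).ign.length)))
      (hA.lift π _) (hAb.lift π) fun _ π' _ _ => natPairEq var
        (((length hw.opened hb.opened).pair (length hw.ign hb.ign)).lift π' _)))) hw.some hs.fst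

end Calc

theorem length_growStep (out : List (ℕ × ℕ × ℝ)) (e : ℕ × ℕ × ℝ) :
    (growStep out e).length ≤ out.length + 1 := by
  unfold growStep
  split_ifs <;> simp

theorem length_foldl_growStep (l : List (ℕ × ℕ × ℝ)) (out : List (ℕ × ℕ × ℝ)) :
    (l.foldl growStep out).length ≤ out.length + l.length := by
  induction l generalizing out with
  | nil => simp
  | cons e l ih =>
    have := length_growStep out e
    have := ih (growStep out e)
    simp only [List.foldl_cons, List.length_cons]
    omega

theorem length_foldl_foldl_growStep (edges : List (ℕ × ℕ × ℝ)) (l : List ℕ)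
    (out : List (ℕ × ℕ × ℝ)) : (l.foldl (fun out _ => edges.foldl growStep out) out).length
      ≤ out.length + l.length * edges.length := by
  induction l generalizing out with
  | nil => simp
  | cons a l ih =>
    have h1 := length_foldl_growStep edges out
    have h2 := ih (edges.foldl growStep out)
    simp only [List.foldl_cons, List.length_cons]
    nlinarith

theorem length_roundEdges (B : ℕ) (b : ℝ) (ord : List (ℕ × ℕ × ℝ)) :
    (roundEdges B b ord).1.length = ord.length ∧ (roundEdges B b ord).2.length = ord.length := by
  induction ord with
  | nil => simp [roundEdges]
  | cons e l ih =>
    simp only [roundEdges, List.foldr_cons, roundStep, List.length_cons] at ih ⊢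
    omega

theorem length_depths (ord : List (ℕ × ℕ × ℝ)) : (depths ord).length = ord.length + 1 := by
  induction ord with
  | nil => simp [depths]
  | cons e l ih =>
    simp only [depths, List.foldr_cons, List.length_cons] at ih ⊢
    omega

/-! ### Programs for the tree, the rounding and the scheme -/

namespace Calc

variable {ι γ α β : Type} [Code γ] [Code α] [Code β] {g : ι → ℕ × ℕ} {e : ι → γ}
  {r nv B : ι → ℕ} {users facs : ι → List ℕ} {ord edges : ι → List (ℕ × ℕ × ℝ)} {b x : ι → ℝ}

theorem visited {v : ι → ℕ} (ho : Calc g e ord) (hob : PB g fun i => (ord i).length)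
    (hv : Calc g e v) : Calc g e (fun i => visited (ord i) (v i)) :=
  bOr (natEq hv natZero) (any (F := fun i (q : ℕ × ℕ × ℝ) => decide (q.2.1 = v i)) ho hob
    fun _ π _ _ => natEq var.snd.fst (hv.lift π _))

theorem growStep {q : ι → ℕ × ℕ × ℝ} (ho : Calc g e ord) (hob : PB g fun i => (ord i).length)
    (hq : Calc g e q) : Calc g e (fun i => growStep (ord i) (q i)) := by
  have h1 := visited ho hob hq.fst
  have h2 := visited ho hob hq.snd.fst
  exact cond (bAnd h1 (bNot h2)) ((hq.fst.pair (hq.snd.fst.pair hq.snd.snd)).cons ho)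
    (cond (bAnd h2 (bNot h1)) ((hq.snd.fst.pair (hq.fst.pair hq.snd.snd)).cons ho) ho)

theorem grow (hn : Calc g e nv) (hnb : PB g nv) (he : Calc g e edges)
    (heb : PB g fun i => (edges i).length) : Calc g e (fun i => grow (nv i) (edges i)) ∧
    PB g fun i => (_root_.grow (nv i) (edges i)).length := by
  have hb : PB g fun i => nv i * (edges i).length := hnb.mul heb
  constructor
  -- Each processed edge adds at most one entry, so the number of rounds times the number of edges
  -- bounds the length; no use is made of the tree structure.
  · refine foldlPrefix (F := fun i (out : List (ℕ × ℕ × ℝ)) (_ : ℕ) =>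
      (edges i).foldl _root_.growStep out) (fun i out => out.length ≤ nv i * (edges i).length)
      (range hn hnb) nil (by simpa using hnb) (fun i l₁ h => ?_) fun ι' π s a _ hs => ?_
    · refine (length_foldl_foldl_growStep _ _ _).trans ?_
      have := h.length_le
      simp only [List.length_range, List.length_nil, zero_add] at this ⊢
      exact Nat.mul_le_mul_right _ this
    · refine foldlPrefix (F := fun i (out : List (ℕ × ℕ × ℝ)) q => _root_.growStep out q)
        (fun j out => out.length ≤ nv (π j) * (edges (π j)).length + (edges (π j)).length)
        (he.lift π _) var.fst (heb.lift π) (fun i l₁ h => ?_) fun ι'' π' s' q _ hs' => ?_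
      · refine (length_foldl_growStep _ _).trans ?_
        have := h.length_le
        have := hs i
        omega
      · exact growStep var.fst (((hb.add heb).lift π).lift π' |>.of_le hs') var.snd
  · refine hb.of_le fun i => ?_
    have h := length_foldl_foldl_growStep (edges i) (List.range (nv i)) []
    simp only [List.length_nil, List.length_range, zero_add] at h
    exact h

theorem roundLen (hB : Calc g e B) (hBb : PB g B) (hb : Calc g e b) (hx : Calc g e x) :
    Calc g e (fun i => roundLen (B i) (b i) (x i)) := by
  refine foldl' (F := fun i (s : ℝ × ℕ) (_ : ℕ) =>
    if decide (b i < s.1) = true then (s.1 - b i, s.2 + 1) else s)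
    (range (natAdd hB (natConst 3)) (hBb.add (PB.const 3))) (hx.pair natZero)
    (by simpa using hBb.add (PB.const 3)) fun ι' π s a _ => ?_
  have hs : Calc (fun j => g (π j)) (fun j => (e (π j), (s j, a j))) s := var.fst
  have hb' := hb.lift π fun j => (s j, a j)
  exact cond (realLt hb' hs.fst) ((realSub hs.fst hb').pair (natAdd hs.snd natOne)) hs

theorem roundStep {q : ι → ℕ × ℕ × ℝ} {acc : ι → List (ℕ × ℕ × ℕ) × List (ℕ × ℝ)}
    {s : ι → ℝ × ℕ} (hB : Calc g e B) (hq : Calc g e q) (ha : Calc g e acc) (hs : Calc g e s) :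
    Calc g e (fun i => roundStep (B i) (q i) (acc i) (s i)) :=
  ((hq.fst.pair (hq.snd.fst.pair hs.snd)).cons ha.fst).pair
    ((hq.snd.fst.pair (cond (natLt hs.snd (natAdd hB (natConst 3))) hs.fst realZero)).cons ha.snd)

theorem roundEdges (hB : Calc g e B) (hBb : PB g B) (hb : Calc g e b) (ho : Calc g e ord)
    (hob : PB g fun i => (ord i).length) :
    Calc g e (fun i => roundEdges (B i) (b i) (ord i)) := by
  refine foldrSuffix (F := fun i (q : ℕ × ℕ × ℝ) acc => _root_.roundStep (B i) q acc
    (_root_.roundLen (B i) (b i) (_root_.lookupD acc.2 q.1 0 + _root_.mulNat (B i) q.2.2)))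
    (fun i acc => acc.2.length ≤ (ord i).length) ho (nil.pair nil) hob
    (fun i l₁ h => ((length_roundEdges (B i) (b i) l₁).2.trans_le h.length_le))
    fun ι' π s a _ hs => ?_
  have hs' : Calc (fun j => g (π j)) (fun j => (e (π j), (s j, a j))) s := var.fst
  have ha' : Calc (fun j => g (π j)) (fun j => (e (π j), (s j, a j))) a := var.snd
  have hB' := hB.lift π fun j => (s j, a j)
  exact roundStep hB' ha' hs' (roundLen hB' (hBb.lift π) (hb.lift π _)
    (realAdd (lookupD hs'.snd ((hob.lift π).of_le hs) ha'.fst realZero)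
      (mulNat hB' (hBb.lift π) ha'.snd.snd)))

theorem depths (ho : Calc g e ord) (hob : PB g fun i => (ord i).length) :
    Calc g e (fun i => depths (ord i)) := by
  refine foldrSuffix (F := fun i (q : ℕ × ℕ × ℝ) acc =>
    (q.2.1, _root_.lookupD acc q.1 0 + q.2.2) :: acc)
    (fun i acc => acc.length ≤ (ord i).length + 1) ho ((natZero.pair realZero).cons nil) hob
    (fun i l₁ h => ((length_depths l₁).trans_le (Nat.succ_le_succ h.length_le)))
    fun ι' π s a _ hs => ?_
  have hs' : Calc (fun j => g (π j)) (fun j => (e (π j), (s j, a j))) s := var.fst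
  have ha' : Calc (fun j => g (π j)) (fun j => (e (π j), (s j, a j))) a := var.snd
  exact (ha'.snd.fst.pair (realAdd (lookupD hs' (((hob.lift π).add (PB.const 1)).of_le hs)
    ha'.fst realZero) ha'.snd.snd)).cons hs'

theorem candidates {D : ι → List (ℕ × ℝ)} (hD : Calc g e D) (hb : PB g fun i => (D i).length) :
    Calc g e (fun i => candidates (D i)) ∧ PB g fun i => (_root_.candidates (D i)).length := by
  have hl1 : ∀ i (x : ℕ × ℝ), ((D i).flatMap fun y => (D i).map fun a =>
      x.2 + y.2 - a.2 - a.2).length ≤ (D i).length * (D i).length := fun i x =>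
    List.length_flatMap_le _ _ _ fun _ _ => by simp
  have hl2 : ∀ i, ((D i).flatMap fun x => (D i).flatMap fun y => (D i).map fun a =>
      x.2 + y.2 - a.2 - a.2).length ≤ (D i).length * ((D i).length * (D i).length) := fun i =>
    List.length_flatMap_le _ _ _ fun _ _ => hl1 i _
  have hflat : Calc g e fun i => (D i).flatMap fun x => (D i).flatMap fun y => (D i).map fun a =>
      x.2 + y.2 - a.2 - a.2 := by
    refine flatMap (F := fun i (x : ℕ × ℝ) => (D i).flatMap fun y => (D i).map fun a =>
      x.2 + y.2 - a.2 - a.2) hD hb (hb.mul hb) (fun i x _ => hl1 i x) fun ι' π x _ => ?_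
    have hx : Calc (fun j => g (π j)) (fun j => (e (π j), x j)) x := var
    refine flatMap (F := fun i (y : ℕ × ℝ) => (D (π i)).map fun a => (x i).2 + y.2 - a.2 - a.2)
      (hD.lift π x) (hb.lift π) (hb.lift π) (fun i y _ => by simp) fun ι'' π' y _ => ?_
    have hy : Calc (fun j => g (π (π' j))) (fun j => ((e (π (π' j)), x (π' j)), y j)) y := var
    have hxy := realAdd (hx.snd.lift π' y) hy.snd
    refine map (F := fun i (a : ℕ × ℝ) => (x (π' i)).2 + (y i).2 - a.2 - a.2)
      ((hD.lift π x).lift π' y) ((hb.lift π).lift π') fun ι₃ π₃ a _ => ?_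
    have ha : Calc (fun j => g (π (π' (π₃ j))))
      (fun j => (((e (π (π' (π₃ j))), x (π' (π₃ j))), y (π₃ j)), a j)) a := var
    exact realSub (realSub (hxy.lift π₃ a) ha.snd) ha.snd
  exact ⟨filter (F := fun i (b : ℝ) => decide (0 ≤ b)) hflat
    ((hb.mul (hb.mul hb)).of_le hl2) fun ι' π b _ => by
      have hv : Calc (fun j => g (π j)) (fun j => (e (π j), b j)) b := var
      exact realLe realZero hv,
    (hb.mul (hb.mul hb)).of_le fun i => (List.length_filter_le _ _).trans (hl2 i)⟩

theorem size_pick {A : List (ℕ × ℕ)} {T : List Wit} {w : Wit} (h : _root_.pick A T = Option.some w) :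
    w ∈ T := by
  have key : ∀ (l : List Wit) (o : Option Wit), (∀ w ∈ o, w ∈ T) → l ⊆ T →
      ∀ w ∈ l.foldl (fun o w => if (decide (w.pu.length = 0) && (decide (w.pf.length = 0) &&
        A.any fun q => decide (q = (w.opened.length, w.ign.length)))) = true
        then Option.some w else o) o, w ∈ T := by
    intro l
    induction l with
    | nil => exact fun o h _ => h
    | cons a l ih =>
      intro o h hl
      refine ih _ ?_ fun x hx => hl (by simp [hx])
      dsimp only
      split_ifs
      · simpa using hl (by simp)
      · exact h
  exact key T Option.none (by simp) (fun x h => h) w h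

theorem solveFor {A : ι → List (ℕ × ℕ)} (hB : Calc g e B) (hBb : BoundedByParam g B)
    (hr : Calc g e r) (hnv : Calc g e nv) (hnvb : PB g nv)
    (hu : Calc g e users) (hub : PB g fun i => (users i).length)
    (hf : Calc g e facs) (hfb : PB g fun i => (facs i).length) (hA : Calc g e A)
    (hAb : PB g fun i => (A i).length) (ho : Calc g e ord)
    (hob : PB g fun i => (ord i).length) (hb : Calc g e b) :
    Calc g e (fun i => solveFor (B i) (r i) (nv i) (users i) (facs i) (A i) (ord i) (b i)) ∧
    ∀ i, ∀ w ∈ _root_.solveFor (B i) (r i) (nv i) (users i) (facs i) (A i) (ord i) (b i),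
      w.size ≤ (users i).length + (users i).length + (facs i).length := by
  have hn := length hu hub
  have hM := natAdd (natAdd hn hn) (length hf hfb)
  have hMb := (hub.add hub).add hfb
  have hR := natAdd hB (natConst 2)
  have hRb := hBb.add_const 2
  obtain ⟨h1, h2⟩ := rootTable hM hMb hR hRb hr hnv hnvb hu hub hf hfb
    (roundEdges hB hBb.pb hb ho hob).fst (hob.of_le fun i => (length_roundEdges _ _ _).1.le)
  exact ⟨pick hA hAb h1 ((PB_tableBound hMb hRb).of_le fun i => (h2 i).length_le) hMb
    fun i => (h2 i).size_le, fun i w hw => (h2 i).size_le w (size_pick hw)⟩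

theorem improve {o : ι → Option (ℝ × Wit)} {w : ι → Wit} (ho : Calc g e o) (hb : Calc g e b)
    (hw : Calc g e w) : Calc g e (fun i => improve (o i) (b i) (w i)) :=
  some (option (F := fun i (q : ℝ × Wit) => if decide (b i < q.1) = true then (b i, w i) else q)
    ho (hb.pair hw) fun _ π _ _ => cond (realLt (hb.lift π _) var.fst)
      ((hb.pair hw).lift π _) var)

theorem mem_improve {o : Option (ℝ × Wit)} {b : ℝ} {w : Wit} {P : Wit → Prop}
    (ho : ∀ q ∈ o, P q.2) (hw : P w) : ∀ q ∈ _root_.improve o b w, P q.2 := by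
  intro q hq
  rcases o with _ | q'
  · simp only [_root_.improve, Option.elim, Option.mem_def, Option.some.injEq] at hq
    subst hq
    exact hw
  · simp only [_root_.improve, Option.elim, Option.mem_def, Option.some.injEq] at hq
    split_ifs at hq <;> subst hq
    exacts [hw, ho _ rfl]

theorem bestOf_of {P : Wit → Prop} (l : List ℝ) (S : ℝ → Option Wit)
    (hS : ∀ b, ∀ w ∈ S b, P w) : ∀ q ∈ bestOf l S, P q.2 := by
  have key : ∀ (l : List ℝ) (o : Option (ℝ × Wit)), (∀ q ∈ o, P q.2) →
      ∀ q ∈ l.foldl (fun o b => (S b).elim o (_root_.improve o b)) o, P q.2 := by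
    intro l
    induction l with
    | nil => exact fun o h => h
    | cons b l ih =>
      refine fun o h => ih _ ?_
      dsimp only
      rcases hb : S b with _ | w
      · exact h
      · exact mem_improve h (hS b w hb)
  exact key l Option.none (by simp)

theorem output {n m : ι → ℕ} {w : ι → Wit} (hn : Calc g e n) (hnb : PB g n) (hm : Calc g e m)
    (hmb : PB g m) (hw : Calc g e w) (hwb : PB g fun i => (w i).size) :
    Calc g e (fun i => output (n i) (m i) (w i)) := by
  refine (map (F := fun i (f : ℕ) => (w i).opened.any fun f' => decide (f' = f)) (range hm hmb)
    (by simpa using hmb) fun ι' π f _ => ?_).pair (map (F := fun i (u : ℕ) => (w i).asg.foldl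
    (fun o (q : ℕ × ℕ) => if decide (q.1 = u) = true then Option.some q.2 else o) Option.none)
    (range hn hnb) (by simpa using hnb) fun ι' π u _ => ?_)
  · have hv : Calc (fun j => g (π j)) (fun j => (e (π j), f j)) f := var
    exact any (F := fun i (f' : ℕ) => decide (f' = f i))
      (hw.opened.lift π _) (hwb.opened.lift π) fun _ π' _ _ => natEq var (hv.lift π' _)
  · have hv : Calc (fun j => g (π j)) (fun j => (e (π j), u j)) u := var
    exact foldl' (F := fun i (o : Option ℕ) (q : ℕ × ℕ) =>
      if decide (q.1 = u i) = true then Option.some q.2 else o)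
      (hw.asg.lift π _) none (hwb.asg.lift π) fun _ π' s a _ =>
        cond (natEq var.snd.fst (hv.lift π' _)) (some var.snd.snd) var.fst

theorem scheme {A : ι → List (ℕ × ℕ)} (hB : Calc g e B) (hBb : BoundedByParam g B)
    (hnv : Calc g e nv) (hnvb : PB g nv) (he : Calc g e edges)
    (heb : PB g fun i => (edges i).length)
    (hu : Calc g e users) (hub : PB g fun i => (users i).length)
    (hf : Calc g e facs) (hfb : PB g fun i => (facs i).length) (hr : Calc g e r)
    (hA : Calc g e A) (hAb : PB g fun i => (A i).length) :
    Calc g e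
      (fun i => scheme (B i) (nv i) (edges i) (users i) (facs i) (r i) (A i)) := by
  obtain ⟨ho, hob⟩ := grow hnv hnvb he heb
  obtain ⟨hc, hcb⟩ := candidates (depths ho hob)
    ((hob.add (PB.const 1)).of_le fun i => (length_depths _).le)
  have hsz := (hub.add hub).add hfb
  have hsize : ∀ i (b : ℝ), ∀ w ∈ _root_.solveFor (B i) (r i) (nv i) (users i) (facs i) (A i)
      (_root_.grow (nv i) (edges i)) b,
      w.size ≤ (users i).length + (users i).length + (facs i).length := fun i b =>
    -- The size bound is wanted for every real `b`, so the lemma is applied to the family enlarged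
    -- by `b` as an additional input.
    (solveFor (b := fun i : ι × ℝ => i.2) (hB.lift Prod.fst Prod.snd) (hBb.lift Prod.fst)
      (hr.lift Prod.fst Prod.snd) (hnv.lift Prod.fst Prod.snd) (hnvb.lift Prod.fst)
      (hu.lift Prod.fst Prod.snd) (hub.lift Prod.fst) (hf.lift Prod.fst Prod.snd)
      (hfb.lift Prod.fst) (hA.lift Prod.fst Prod.snd) (hAb.lift Prod.fst)
      (ho.lift Prod.fst Prod.snd) (hob.lift Prod.fst) var).2 (i, b)
  refine option (F := fun i (q : ℝ × Wit) =>
    Option.some (_root_.output (users i).length (facs i).length q.2)) ?_ none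
    fun ι' π q hq => some (output ((length hu hub).lift π _) (hub.lift π)
      ((length hf hfb).lift π _) (hfb.lift π) var.snd ((hsz.lift π).of_le fun j =>
        bestOf_of _ _ (hsize (π j)) (q j) (hq j)))
  refine foldl' (F := fun i (o : Option (ℝ × Wit)) (b : ℝ) => (_root_.solveFor (B i) (r i) (nv i)
      (users i) (facs i) (A i) (_root_.grow (nv i) (edges i)) b).elim o (_root_.improve o b))
    hc none hcb fun ι' π o b _ => ?_
  have hv : Calc (fun j => g (π j)) (fun j => (e (π j), (o j, b j))) (fun j => (o j, b j)) := var
  have hS := (solveFor (hB.lift π fun j => (o j, b j)) (hBb.lift π)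
      (hr.lift π _) (hnv.lift π _) (hnvb.lift π)
      (hu.lift π _) (hub.lift π) (hf.lift π _) (hfb.lift π) (hA.lift π _) (hAb.lift π)
      (ho.lift π _) (hob.lift π) hv.snd).1
  exact option (F := fun i w => _root_.improve (o i) (b i) w) hS hv.fst fun _ π' w _ =>
    improve (hv.fst.lift π' _) (hv.snd.lift π' _) var

end Calc

/-! ### Correctness of the dynamic program: single tables -/

/-- `w` is a valid partial solution for the users `U` and facilities `F`, where `δ` is the distance
and `α`, `β` are the distances to the current vertex. -/
structure Wit.Sound (δ : ℕ → ℕ → ℕ) (R r : ℕ) (α β : ℕ → ℕ) (U F : Finset ℕ) (w : Wit) : Prop where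
  users : ((w.ign ++ w.asg.map Prod.fst ++ w.pu.map Prod.fst : List ℕ) : Multiset ℕ) = U.val
  opened : (w.opened : Multiset ℕ) ≤ F.val
  full : ∀ f ∈ w.opened, r ≤ (w.asg.map Prod.snd).count f + (w.pf.map Prod.fst).count f
  asg : ∀ x ∈ w.asg, x.2 ∈ w.opened ∧ δ x.1 x.2 ≤ R
  pu : ∀ x ∈ w.pu, x.2 = α x.1
  pf : ∀ x ∈ w.pf, x.1 ∈ w.opened ∧ x.2 = β x.1

/-- What matters of a partial solution for its extensions. -/
abbrev Profile := ℕ × ℕ × Multiset ℕ × Multiset ℕ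

def Wit.profile (w : Wit) : Profile :=
  (w.opened.length, w.ign.length, ↑(w.pu.map Prod.snd), ↑(w.pf.map Prod.snd))

/-- The distances in a profile are at most `R`, and there are at most `n` free places. -/
def Profile.Fits (R n : ℕ) (σ : Profile) : Prop :=
  (∀ a ∈ σ.2.2.1, a ≤ R) ∧ (∀ a ∈ σ.2.2.2, a ≤ R) ∧ Multiset.card σ.2.2.2 ≤ n

/-- Normalisation may replace a partial solution by an equivalent one with other users and
facilities, so completeness can only be claimed up to profiles. -/
def HasProfile (T : List Wit) (σ : Profile) : Prop := ∃ w ∈ T, w.profile = σ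

section

variable {δ : ℕ → ℕ → ℕ} {R r n m L M : ℕ} {α β : ℕ → ℕ} {U F U' F' : Finset ℕ} {w w' : Wit}
  {T T' : List Wit}

theorem Wit.sound_empty : Wit.empty.Sound δ R r α β ∅ ∅ where
  users := rfl
  opened := by simp [Wit.empty]
  full := by simp [Wit.empty]
  asg := by simp [Wit.empty]
  pu := by simp [Wit.empty]
  pf := by simp [Wit.empty]

theorem Wit.Sound.mem_opened (h : w.Sound δ R r α β U F) {f : ℕ} (hf : f ∈ w.opened) : f ∈ F :=
  Multiset.mem_of_le h.opened hf

theorem Wit.Sound.mem_pu (h : w.Sound δ R r α β U F) {x : ℕ × ℕ} (hx : x ∈ w.pu) : x.1 ∈ U := by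
  rw [← Finset.mem_val, ← h.users]
  simp only [Multiset.mem_coe, List.mem_append, List.mem_map]
  exact Or.inr ⟨x, hx, rfl⟩

theorem Wit.Sound.card_opened (h : w.Sound δ R r α β U F) : w.opened.length ≤ F.card := by
  simpa using Multiset.card_le_card h.opened

theorem Wit.Sound.card_users (h : w.Sound δ R r α β U F) :
    w.ign.length + w.asg.length + w.pu.length = U.card := by
  have := congrArg Multiset.card h.users
  simpa [add_assoc] using this

theorem Wit.Sound.add (h : w.Sound δ R r α β U F) (h' : w'.Sound δ R r α β U' F')
    (hU : Disjoint U U') (hF : Disjoint F F') :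
    (w.add w').Sound δ R r α β (U ∪ U') (F ∪ F') where
  users := by
    rw [Finset.union_val, ← Multiset.add_eq_union_iff_disjoint.2 (Finset.disjoint_val.2 hU),
      ← h.users, ← h'.users, Multiset.coe_add, Multiset.coe_eq_coe, ← Multiset.coe_eq_coe]
    simp only [Wit.add, List.map_append, ← Multiset.coe_add]
    abel
  opened := by
    rw [Finset.union_val, ← Multiset.add_eq_union_iff_disjoint.2 (Finset.disjoint_val.2 hF)]
    simp only [Wit.add, ← Multiset.coe_add]
    exact add_le_add h.opened h'.opened
  full f hf := by
    simp only [Wit.add, List.map_append, List.count_append, List.mem_append] at hf ⊢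
    rcases hf with hf | hf
    · have := h.full f hf; omega
    · have := h'.full f hf; omega
  asg x hx := by
    simp only [Wit.add, List.mem_append] at hx ⊢
    rcases hx with hx | hx
    · exact ⟨Or.inl (h.asg x hx).1, (h.asg x hx).2⟩
    · exact ⟨Or.inr (h'.asg x hx).1, (h'.asg x hx).2⟩
  pu x hx := by
    simp only [Wit.add, List.mem_append] at hx
    exact hx.elim (h.pu x) (h'.pu x)
  pf x hx := by
    simp only [Wit.add, List.mem_append] at hx ⊢
    rcases hx with hx | hx
    · exact ⟨Or.inl (h.pf x hx).1, (h.pf x hx).2⟩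
    · exact ⟨Or.inr (h'.pf x hx).1, (h'.pf x hx).2⟩

theorem Wit.Sound.shift {α' β' : ℕ → ℕ} (h : w.Sound δ R r α β U F)
    (hα : ∀ u ∈ U, α' u = α u + L) (hβ : ∀ f ∈ F, β' f = β f + L) :
    (w.shift L).Sound δ R r α' β' U F where
  users := by
    simpa [Wit.shift, Function.comp_def] using h.users
  opened := h.opened
  full f hf := by
    simpa [Wit.shift, Function.comp_def] using h.full f hf
  asg := h.asg
  pu x hx := by
    obtain ⟨y, hy, rfl⟩ := List.mem_map.1 hx
    simp only
    rw [hα _ (h.mem_pu hy), h.pu y hy]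
  pf x hx := by
    obtain ⟨y, hy, rfl⟩ := List.mem_map.1 hx
    refine ⟨(h.pf y hy).1, ?_⟩
    simp only
    rw [hβ _ (h.mem_opened (h.pf y hy).1), (h.pf y hy).2]

/-- By the triangle inequality the new pair has distance at most `R`, even if both partners come
from the same part. The number of users served or expected at a facility is unchanged, since one
free place turns into one assignment. -/
theorem Wit.Sound.matched (h : w.Sound δ R r α β U F)
    (hδ : ∀ u ∈ U, ∀ f ∈ F, δ u f ≤ α u + β f) {x y : ℕ × ℕ} (hx : x ∈ w.pu) (hy : y ∈ w.pf)
    (hxy : x.2 + y.2 ≤ R) : (w.matched x y).Sound δ R r α β U F where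
  users := by
    rw [← h.users, Multiset.coe_eq_coe]
    have h1 : (w.pu.map Prod.fst).Perm (x.1 :: (w.pu.erase x).map Prod.fst) :=
      (List.perm_cons_erase hx).map Prod.fst
    simp only [Wit.matched, List.map_cons, List.append_assoc, List.cons_append]
    refine List.Perm.append_left _ ?_
    refine List.Perm.trans ?_ (List.Perm.append_left _ h1.symm)
    exact List.perm_middle.symm
  opened := h.opened
  full f hf := by
    have h1 : (w.pf.map Prod.fst).Perm (y.1 :: (w.pf.erase y).map Prod.fst) :=
      (List.perm_cons_erase hy).map Prod.fst
    have h2 := h.full f hf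
    rw [h1.count_eq] at h2
    simp only [Wit.matched, List.map_cons, List.count_cons] at h2 ⊢
    omega
  asg z hz := by
    simp only [Wit.matched, List.mem_cons] at hz ⊢
    rcases hz with rfl | hz
    · refine ⟨(h.pf y hy).1, (hδ _ (h.mem_pu hx) _ (h.mem_opened (h.pf y hy).1)).trans ?_⟩
      rwa [← h.pu x hx, ← (h.pf y hy).2]
    · exact h.asg z hz
  pu z hz := h.pu z (List.mem_of_mem_erase hz)
  pf z hz := h.pf z (List.mem_of_mem_erase hz)

/-! ### Profiles and normalisation -/

theorem Wit.profile_add : (w.add w').profile = w.profile + w'.profile := by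
  simp [Wit.profile, Wit.add]

theorem Wit.profile_shift : (w.shift L).profile = (w.profile.1, w.profile.2.1,
    w.profile.2.2.1.map (· + L), w.profile.2.2.2.map (· + L)) := by
  simp [Wit.profile, Wit.shift, Function.comp_def]

theorem countSnd_eq_count (a : ℕ) (l : List (ℕ × ℕ)) :
    countSnd a l = Multiset.count a (↑(l.map Prod.snd) : Multiset ℕ) := by
  rw [Multiset.coe_count, List.count_eq_countP, List.countP_map, List.countP_eq_length_filter]
  rfl

theorem Multiset.eq_of_count_le {s t : Multiset ℕ} (hs : ∀ a ∈ s, a ≤ R) (ht : ∀ a ∈ t, a ≤ R)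
    (h : ∀ a ≤ R, s.count a = t.count a) : s = t := by
  ext a
  by_cases ha : a ≤ R
  · exact h a ha
  · rw [Multiset.count_eq_zero.2 fun h => ha (hs a h), Multiset.count_eq_zero.2 fun h => ha (ht a h)]

/-- Equivalence compares multiplicities only up to `R`; admissible entries have no larger distances.
-/
theorem Wit.profile_eq_of_same (hs : w.same R w' = true) (hw : w.ok M R = true)
    (hw' : w'.ok M R = true) : w.profile = w'.profile := by
  simp only [Wit.ok, Bool.and_eq_true, decide_eq_true_eq, List.all_eq_true] at hw hw'
  simp only [Wit.same, Bool.and_eq_true, decide_eq_true_eq, List.all_eq_true, List.mem_range,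
    countSnd_eq_count] at hs
  simp only [Wit.profile, Prod.mk.injEq]
  refine ⟨hs.1, hs.2.1, Multiset.eq_of_count_le (R := R) ?_ ?_
    fun a ha => (hs.2.2 a (Nat.lt_succ_of_le ha)).1, Multiset.eq_of_count_le (R := R) ?_ ?_
    fun a ha => (hs.2.2 a (Nat.lt_succ_of_le ha)).2⟩ <;>
  intro a ha <;> simp only [Multiset.mem_coe, List.mem_map] at ha <;> obtain ⟨x, hx, rfl⟩ := ha
  exacts [hw.2.1 x hx, hw'.2.1 x hx, hw.2.2 x hx, hw'.2.2 x hx]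

/-- An admissible entry is rejected only if an equivalent one has been accepted before, and accepted
entries are never removed. -/
theorem normalise_spec (M R : ℕ) (T acc : List Wit) (hacc : ∀ w ∈ acc, w.ok M R = true) :
    (∀ w ∈ T.foldl (fun acc w => if (w.ok M R && !(acc.any fun w' => w.same R w')) = true
      then w :: acc else acc) acc, w ∈ T ∨ w ∈ acc) ∧
    (∀ w, w.ok M R = true → w ∈ T ∨ HasProfile acc w.profile →
      HasProfile (T.foldl (fun acc w => if (w.ok M R && !(acc.any fun w' => w.same R w')) = true
      then w :: acc else acc) acc) w.profile) := by
  induction T generalizing acc with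
  | nil => exact ⟨fun w h => Or.inr h, fun w _ h => h.elim (by simp) id⟩
  | cons v T ih =>
    rw [List.foldl_cons]
    by_cases hc : (v.ok M R && !(acc.any fun w' => v.same R w')) = true
    · rw [if_pos hc]
      simp only [Bool.and_eq_true, Bool.not_eq_true'] at hc
      obtain ⟨h1, h2⟩ := ih (v :: acc) (by simpa using ⟨hc.1, hacc⟩)
      constructor
      · intro w hw
        have := h1 w hw
        simp only [List.mem_cons] at this ⊢
        tauto
      · rintro w hok (hw | ⟨w', hw', he⟩)
        · rcases List.mem_cons.1 hw with rfl | hw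
          · exact h2 w hok (Or.inr ⟨w, by simp, rfl⟩)
          · exact h2 w hok (Or.inl hw)
        · exact h2 w hok (Or.inr ⟨w', by simp [hw'], he⟩)
    · rw [if_neg hc]
      obtain ⟨h1, h2⟩ := ih acc hacc
      constructor
      · intro w hw
        have := h1 w hw
        simp only [List.mem_cons] at this ⊢
        tauto
      · rintro w hok (hw | hw)
        · rcases List.mem_cons.1 hw with rfl | hw
          · simp only [hok, Bool.true_and, Bool.not_eq_true', Bool.not_eq_false,
              List.any_eq_true] at hc
            obtain ⟨w', hw', hs⟩ := hc
            exact h2 w hok (Or.inr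
              ⟨w', hw', (Wit.profile_eq_of_same hs hok (hacc w' hw')).symm⟩)
          · exact h2 w hok (Or.inl hw)
        · exact h2 w hok (Or.inr hw)

theorem normalise_subset : ∀ w ∈ normalise M R T, w ∈ T := fun w hw =>
  ((normalise_spec M R T [] (by simp)).1 w hw).elim id (by simp)

theorem hasProfile_normalise (hw : w ∈ T) (hok : w.ok M R = true) :
    HasProfile (normalise M R T) w.profile :=
  (normalise_spec M R T [] (by simp)).2 w hok (Or.inl hw)

/-- All entries of a table are sound. -/
def TableSound (δ : ℕ → ℕ → ℕ) (R r : ℕ) (α β : ℕ → ℕ) (U F : Finset ℕ) (T : List Wit) : Prop :=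
  ∀ w ∈ T, w.Sound δ R r α β U F

/-- At most `m` facilities are open, the ignored, assigned and waiting users together are at most
`n`, and the free places are at most `n` because the profile fits. -/
theorem Wit.Sound.ok (h : w.Sound δ R r α β U F) (hU : U.card ≤ n) (hF : F.card ≤ m)
    (hfit : Profile.Fits R n w.profile) : w.ok (n + n + m) R = true := by
  have h1 := h.card_opened
  have h2 := h.card_users
  obtain ⟨h3, h4, h5⟩ := hfit
  simp only [Wit.profile, Multiset.mem_coe, List.mem_map, Multiset.coe_card, List.length_map] at *
  simp only [Wit.ok, Wit.size, Bool.and_eq_true, decide_eq_true_eq, List.all_eq_true]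
  exact ⟨decide_eq_true (by omega), fun x hx => h3 _ ⟨x, hx, rfl⟩, fun x hx => h4 _ ⟨x, hx, rfl⟩⟩

/-! ### Soundness of the operations on tables -/

theorem TableSound.normalise (h : TableSound δ R r α β U F T) :
    TableSound δ R r α β U F (normalise M R T) := fun w hw => h w (normalise_subset w hw)

theorem TableSound.closeStep (h : TableSound δ R r α β U F T)
    (hδ : ∀ u ∈ U, ∀ f ∈ F, δ u f ≤ α u + β f) :
    TableSound δ R r α β U F (closeStep M R T) := by
  refine TableSound.normalise fun w hw => ?_
  rcases List.mem_append.1 hw with hw | hw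
  · exact h w hw
  · obtain ⟨v, hv, hw⟩ := List.mem_flatMap.1 hw
    simp only [Wit.matches', List.mem_flatMap] at hw
    obtain ⟨x, hx, y, hy, hw⟩ := hw
    split_ifs at hw with hc
    · rw [List.mem_singleton.1 hw]
      exact (h v hv).matched hδ hx hy (by simpa using hc)
    · simp at hw

theorem TableSound.closeTable (h : TableSound δ R r α β U F T)
    (hδ : ∀ u ∈ U, ∀ f ∈ F, δ u f ≤ α u + β f) :
    TableSound δ R r α β U F (closeTable M R n T) := by
  unfold _root_.closeTable
  induction List.range n generalizing T with
  | nil => exact h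
  | cons a l ih => exact ih (h.closeStep hδ)

theorem TableSound.products (h : TableSound δ R r α β U F T) (h' : TableSound δ R r α β U' F' T')
    (hU : Disjoint U U') (hF : Disjoint F F') :
    TableSound δ R r α β (U ∪ U') (F ∪ F') (T.flatMap fun w => T'.map fun w' => w.add w') := by
  intro w hw
  simp only [List.mem_flatMap, List.mem_map] at hw
  obtain ⟨a, ha, b, hb, rfl⟩ := hw
  exact (h a ha).add (h' b hb) hU hF

theorem TableSound.merge (h : TableSound δ R r α β U F T) (h' : TableSound δ R r α β U' F' T')
    (hU : Disjoint U U') (hF : Disjoint F F')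
    (hδ : ∀ u ∈ U ∪ U', ∀ f ∈ F ∪ F', δ u f ≤ α u + β f) :
    TableSound δ R r α β (U ∪ U') (F ∪ F') (merge M R n T T') :=
  (h.products h' hU hF).normalise.closeTable hδ

/-! ### Completeness of closing and merging -/

theorem closeStep_keep (h : TableSound δ R r α β U F T) (hU : U.card ≤ n) (hF : F.card ≤ m)
    {σ : Profile} (hσ : HasProfile T σ) (hfit : σ.Fits R n) :
    HasProfile (closeStep (n + n + m) R T) σ := by
  obtain ⟨w, hw, rfl⟩ := hσ
  exact hasProfile_normalise (List.mem_append_left _ hw) ((h w hw).ok hU hF hfit)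

/-- Users waiting at the same distance are interchangeable, and so are free places: any pair with
the distances `a` and `b` may be matched, and the resulting profile is the same. -/
theorem closeStep_match (h : TableSound δ R r α β U F T)
    (hδ : ∀ u ∈ U, ∀ f ∈ F, δ u f ≤ α u + β f) (hU : U.card ≤ n) (hF : F.card ≤ m)
    {k i a b : ℕ} {P Q : Multiset ℕ} (hσ : HasProfile T (k, i, a ::ₘ P, b ::ₘ Q))
    (hab : a + b ≤ R) (hfit : Profile.Fits R n (k, i, P, Q)) :
    HasProfile (closeStep (n + n + m) R T) (k, i, P, Q) := by
  obtain ⟨w, hw, he⟩ := hσ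
  simp only [Wit.profile, Prod.mk.injEq] at he
  obtain ⟨h1, h2, h3, h4⟩ := he
  have hx : a ∈ w.pu.map Prod.snd := by
    rw [← Multiset.mem_coe, h3]; exact Multiset.mem_cons_self _ _
  have hy : b ∈ w.pf.map Prod.snd := by
    rw [← Multiset.mem_coe, h4]; exact Multiset.mem_cons_self _ _
  obtain ⟨x, hxw, rfl⟩ := List.mem_map.1 hx
  obtain ⟨y, hyw, rfl⟩ := List.mem_map.1 hy
  have hp : (w.matched x y).profile = (k, i, P, Q) := by
    have e1 : ((w.pu.map Prod.snd : List ℕ) : Multiset ℕ)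
        = x.2 ::ₘ ((w.pu.erase x).map Prod.snd : List ℕ) := by
      rw [Multiset.cons_coe, Multiset.coe_eq_coe]
      exact (List.perm_cons_erase hxw).map Prod.snd
    have e2 : ((w.pf.map Prod.snd : List ℕ) : Multiset ℕ)
        = y.2 ::ₘ ((w.pf.erase y).map Prod.snd : List ℕ) := by
      rw [Multiset.cons_coe, Multiset.coe_eq_coe]
      exact (List.perm_cons_erase hyw).map Prod.snd
    rw [e1, Multiset.cons_inj_right] at h3
    rw [e2, Multiset.cons_inj_right] at h4
    simp [Wit.profile, Wit.matched, h1, h2, h3, h4]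
  rw [← hp]
  refine hasProfile_normalise (List.mem_append_right _ (List.mem_flatMap.2 ⟨w, hw, ?_⟩))
    (((h w hw).matched hδ hxw hyw hab).ok hU hF (hp ▸ hfit))
  simp only [Wit.matches', List.mem_flatMap]
  exact ⟨x, hxw, y, hyw, by simp [hab]⟩

/-- The multiset `X` lists the pairs of distances that are to be matched. Each round removes one of
them. -/
theorem hasProfile_closeTable (h : TableSound δ R r α β U F T)
    (hδ : ∀ u ∈ U, ∀ f ∈ F, δ u f ≤ α u + β f) (hU : U.card ≤ n) (hF : F.card ≤ m)
    {k i : ℕ} {P Q : Multiset ℕ} {X : Multiset (ℕ × ℕ)}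
    (hσ : HasProfile T (k, i, P + X.map Prod.fst, Q + X.map Prod.snd))
    (hX : ∀ x ∈ X, x.1 + x.2 ≤ R) (hcard : Multiset.card X ≤ n)
    (hfit : Profile.Fits R n (k, i, P + X.map Prod.fst, Q + X.map Prod.snd)) :
    HasProfile (closeTable (n + n + m) R n T) (k, i, P, Q) := by
  unfold closeTable
  replace hcard : Multiset.card X ≤ (List.range n).length := by simpa using hcard
  generalize List.range n = l at hcard
  induction l generalizing T X with
  | nil =>
    have : X = 0 := by simpa using hcard
    subst this
    simpa using hσ
  | cons c l ih =>
    rw [List.foldl_cons]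
    rcases X.empty_or_exists_mem with rfl | ⟨x, hx⟩
    -- All pairs have been matched; the remaining rounds keep the profile.
    · exact ih (X := 0) (h.closeStep hδ) (closeStep_keep h hU hF hσ hfit) (by simp) hfit (by simp)
    · obtain ⟨X, rfl⟩ := Multiset.exists_cons_of_mem hx
      have hfit' : Profile.Fits R n (k, i, P + X.map Prod.fst, Q + X.map Prod.snd) := by
        obtain ⟨f1, f2, f3⟩ := hfit
        simp only [Multiset.map_cons, Multiset.add_cons, Multiset.mem_cons,
          Multiset.card_cons] at f1 f2 f3
        exact ⟨fun a ha => f1 a (Or.inr ha), fun a ha => f2 a (Or.inr ha), by simp only; omega⟩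
      refine ih (h.closeStep hδ) (closeStep_match h hδ hU hF ?_ (hX x (by simp)) hfit')
        (fun y hy => hX y (Multiset.mem_cons_of_mem hy)) hfit' (by simpa using hcard)
      simpa using hσ

theorem hasProfile_merge (h : TableSound δ R r α β U F T) (h' : TableSound δ R r α β U' F' T')
    (hU : Disjoint U U') (hF : Disjoint F F')
    (hδ : ∀ u ∈ U ∪ U', ∀ f ∈ F ∪ F', δ u f ≤ α u + β f)
    (hUn : (U ∪ U').card ≤ n) (hFm : (F ∪ F').card ≤ m) {σ σ' : Profile} (hσ : HasProfile T σ)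
    (hσ' : HasProfile T' σ') {k i : ℕ} {P Q : Multiset ℕ} {X : Multiset (ℕ × ℕ)}
    (he : σ + σ' = (k, i, P + X.map Prod.fst, Q + X.map Prod.snd))
    (hX : ∀ x ∈ X, x.1 + x.2 ≤ R) (hcard : Multiset.card X ≤ n)
    (hfit : Profile.Fits R n (σ + σ')) :
    HasProfile (merge (n + n + m) R n T T') (k, i, P, Q) := by
  obtain ⟨w, hw, rfl⟩ := hσ
  obtain ⟨w', hw', rfl⟩ := hσ'
  have hs := h.products h' hU hF
  have hmem : w.add w' ∈ T.flatMap fun w => T'.map fun w' => w.add w' :=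
    List.mem_flatMap.2 ⟨w, hw, List.mem_map.2 ⟨w', hw', rfl⟩⟩
  rw [← Wit.profile_add] at he hfit
  refine hasProfile_closeTable (X := X) hs.normalise hδ hUn hFm ?_ hX hcard (he ▸ hfit)
  rw [← he]
  exact hasProfile_normalise hmem ((hs _ hmem).ok hUn hFm hfit)

end

/-! ### Correctness of the dynamic program: a target solution -/

section

open Classical

variable (tgt : ℕ → Option ℕ) (S : Finset ℕ) (n : ℕ) (α β : ℕ → ℕ) (U F : Finset ℕ)

/-- The users in `U` that the target assigns outside of `F`. -/
noncomputable def leaving : Finset ℕ := U.filter fun u => ∃ f, tgt u = some f ∧ f ∉ F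

/-- The users outside of `U` that the target assigns to `F`. -/
noncomputable def arriving : Finset ℕ :=
  (Finset.range n).filter fun u => u ∉ U ∧ ∃ f ∈ F, tgt u = some f

/-- The profile of the restriction of the target to the users `U` and the facilities `F`. -/
noncomputable def targetProfile : Profile :=
  ((F ∩ S).card, (U.filter fun u => tgt u = none).card, (leaving tgt U F).val.map α,
    -- The default `0` never matters, since arriving users are assigned.
    (arriving tgt n U F).val.map fun u => β ((tgt u).getD 0))

end

section

variable {tgt : ℕ → Option ℕ} {S : Finset ℕ} {δ : ℕ → ℕ → ℕ} {R r n m L M : ℕ} {α β : ℕ → ℕ}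
  {U F U' F' : Finset ℕ} {w w' : Wit} {T T' : List Wit}

theorem Finset.card_filter_union_of_disjoint (p : ℕ → Prop) [DecidablePred p]
    (h : Disjoint U U') : ((U ∪ U').filter p).card = (U.filter p).card + (U'.filter p).card := by
  rw [Finset.filter_union, Finset.card_union_of_disjoint (Finset.disjoint_filter_filter h)]

/-- The users that the target assigns across the two parts. -/
noncomputable def crossing (tgt : ℕ → Option ℕ) (n : ℕ) (U F U' F' : Finset ℕ) : Finset ℕ :=
  (leaving tgt U F ∩ arriving tgt n U' F') ∪ (leaving tgt U' F' ∩ arriving tgt n U F)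

/-- A user who leaves one part either leaves the union or goes to the other part, in which case it
is a crossing user. The counterpart for arriving users has the same crossing term, and this is why
crossing users can be matched in pairs. -/
theorem leaving_add (hU : Disjoint U U') (hF : Disjoint F F') (hn : U ∪ U' ⊆ Finset.range n) :
    (leaving tgt U F).val + (leaving tgt U' F').val
      = (leaving tgt (U ∪ U') (F ∪ F')).val + (crossing tgt n U F U' F').val := by
  ext u
  simp only [Multiset.count_add, Multiset.count_eq_of_nodup (Finset.nodup _), Finset.mem_val]
  have hu1 : u ∈ U → u ∉ U' := fun h => Finset.disjoint_left.1 hU h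
  have hn1 : u ∈ U → u < n := fun h => Finset.mem_range.1 (hn (Finset.mem_union_left _ h))
  have hn2 : u ∈ U' → u < n := fun h => Finset.mem_range.1 (hn (Finset.mem_union_right _ h))
  rcases h : tgt u with _ | f
  · simp [leaving, arriving, crossing, h]
  · have hf1 : f ∈ F → f ∉ F' := fun h => Finset.disjoint_left.1 hF h
    by_cases h1 : u ∈ U <;> by_cases h2 : u ∈ U' <;> by_cases h3 : f ∈ F <;>
      by_cases h4 : f ∈ F' <;> simp_all [leaving, arriving, crossing]

theorem arriving_add (hU : Disjoint U U') (hF : Disjoint F F') (hn : U ∪ U' ⊆ Finset.range n) :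
    (arriving tgt n U F).val + (arriving tgt n U' F').val
      = (arriving tgt n (U ∪ U') (F ∪ F')).val + (crossing tgt n U F U' F').val := by
  ext u
  simp only [Multiset.count_add, Multiset.count_eq_of_nodup (Finset.nodup _), Finset.mem_val]
  have hu1 : u ∈ U → u ∉ U' := fun h => Finset.disjoint_left.1 hU h
  have hn1 : u ∈ U → u < n := fun h => Finset.mem_range.1 (hn (Finset.mem_union_left _ h))
  have hn2 : u ∈ U' → u < n := fun h => Finset.mem_range.1 (hn (Finset.mem_union_right _ h))
  rcases h : tgt u with _ | f
  · simp [leaving, arriving, crossing, h]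
  · have hf1 : f ∈ F → f ∉ F' := fun h => Finset.disjoint_left.1 hF h
    by_cases h0 : u < n <;> by_cases h1 : u ∈ U <;> by_cases h2 : u ∈ U' <;>
      by_cases h3 : f ∈ F <;>
      by_cases h4 : f ∈ F' <;> simp_all [leaving, arriving, crossing]

/-- The two profiles of the target add up to that of the union plus the distances of the crossing
users and of their facilities. These pairs are the `X` of `hasProfile_merge`. -/
theorem targetProfile_add (hU : Disjoint U U') (hF : Disjoint F F')
    (hn : U ∪ U' ⊆ Finset.range n) :
    targetProfile tgt S n α β U F + targetProfile tgt S n α β U' F' =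
      ((targetProfile tgt S n α β (U ∪ U') (F ∪ F')).1,
        (targetProfile tgt S n α β (U ∪ U') (F ∪ F')).2.1,
        (targetProfile tgt S n α β (U ∪ U') (F ∪ F')).2.2.1 +
          ((crossing tgt n U F U' F').val.map fun u => (α u, β ((tgt u).getD 0))).map Prod.fst,
        (targetProfile tgt S n α β (U ∪ U') (F ∪ F')).2.2.2 +
          ((crossing tgt n U F U' F').val.map fun u => (α u, β ((tgt u).getD 0))).map Prod.snd) := by
  simp only [targetProfile, Prod.mk_add_mk, Multiset.map_map, Function.comp_def,
    ← Multiset.map_add, leaving_add hU hF hn, arriving_add hU hF hn,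
    Finset.card_filter_union_of_disjoint _ hU, Finset.union_inter_distrib_right]
  rw [Finset.card_union_of_disjoint
    (hF.mono Finset.inter_subset_left Finset.inter_subset_left)]

/-- The table has an entry with the profile of the target. -/
def TableComplete (tgt : ℕ → Option ℕ) (S : Finset ℕ) (n : ℕ) (α β : ℕ → ℕ) (U F : Finset ℕ)
    (T : List Wit) : Prop := HasProfile T (targetProfile tgt S n α β U F)

/-- The conditions on `α` and `β` concern only pairs that the target does not treat within one of
the parts. The separate bounds make the unmatched sum of profiles admissible, and the bound for `α u
+ β f` allows the crossing pairs to be matched. -/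
theorem TableComplete.merge (h : TableSound δ R r α β U F T) (h' : TableSound δ R r α β U' F' T')
    (hU : Disjoint U U') (hF : Disjoint F F')
    (hδ : ∀ u ∈ U ∪ U', ∀ f ∈ F ∪ F', δ u f ≤ α u + β f)
    (hn : U ∪ U' ⊆ Finset.range n) (hm : F ∪ F' ⊆ Finset.range m)
    (hα : ∀ u ∈ U ∪ U', ∀ f, tgt u = some f → ¬ (u ∈ U ∧ f ∈ F) → ¬ (u ∈ U' ∧ f ∈ F') → α u ≤ R)
    (hβ : ∀ u < n, ∀ f ∈ F ∪ F', tgt u = some f → ¬ (u ∈ U ∧ f ∈ F) → ¬ (u ∈ U' ∧ f ∈ F') →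
      β f ≤ R)
    (hαβ : ∀ u ∈ U ∪ U', ∀ f ∈ F ∪ F', tgt u = some f → ¬ (u ∈ U ∧ f ∈ F) →
      ¬ (u ∈ U' ∧ f ∈ F') → α u + β f ≤ R)
    (hσ : TableComplete tgt S n α β U F T) (hσ' : TableComplete tgt S n α β U' F' T') :
    TableComplete tgt S n α β (U ∪ U') (F ∪ F') (merge (n + n + m) R n T T') := by
  have hUd : ∀ u, u ∈ U → u ∉ U' := fun u h => Finset.disjoint_left.1 hU h
  have hFd : ∀ u, u ∈ F → u ∉ F' := fun u h => Finset.disjoint_left.1 hF h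
  refine hasProfile_merge h h' hU hF hδ (by simpa using Finset.card_le_card hn)
    (by simpa using Finset.card_le_card hm) hσ hσ' (targetProfile_add hU hF hn) ?_ ?_ ?_
  · intro x hx
    obtain ⟨u, hu, rfl⟩ := Multiset.mem_map.1 hx
    simp only [crossing, leaving, arriving, Finset.mem_val, Finset.mem_union, Finset.mem_inter,
      Finset.mem_filter, Finset.mem_range] at hu
    obtain ⟨⟨h1, f, h2, h3⟩, -, -, f', h4, h5⟩ | ⟨⟨h1, f, h2, h3⟩, -, -, f', h4, h5⟩ := hu
    · obtain rfl : f = f' := Option.some.inj (h2.symm.trans h5)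
      simp only [h2, Option.getD_some]
      exact hαβ u (Finset.mem_union_left _ h1) f (Finset.mem_union_right _ h4) h2
        (fun h => h3 h.2) fun h => hUd u h1 h.1
    · obtain rfl : f = f' := Option.some.inj (h2.symm.trans h5)
      simp only [h2, Option.getD_some]
      exact hαβ u (Finset.mem_union_right _ h1) f (Finset.mem_union_left _ h4) h2
        (fun h => hUd u h.1 h1) fun h => h3 h.2
  · rw [Multiset.card_map]
    have : crossing tgt n U F U' F' ⊆ Finset.range n := by
      intro u hu
      simp only [crossing, leaving, arriving, Finset.mem_union, Finset.mem_inter,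
        Finset.mem_filter] at hu
      tauto
    simpa using Finset.card_le_card this
  · refine ⟨?_, ?_, ?_⟩
    · intro a ha
      simp only [targetProfile, Prod.mk_add_mk, Multiset.mem_add, Multiset.mem_map, leaving,
        Finset.mem_val, Finset.mem_filter] at ha
      obtain ⟨u, ⟨h1, f, h2, h3⟩, rfl⟩ | ⟨u, ⟨h1, f, h2, h3⟩, rfl⟩ := ha
      · exact hα u (Finset.mem_union_left _ h1) f h2 (fun h => h3 h.2) fun h => hUd u h1 h.1
      · exact hα u (Finset.mem_union_right _ h1) f h2 (fun h => hUd u h.1 h1) fun h => h3 h.2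
    · intro a ha
      simp only [targetProfile, Prod.mk_add_mk, Multiset.mem_add, Multiset.mem_map, arriving,
        Finset.mem_val, Finset.mem_filter, Finset.mem_range] at ha
      obtain ⟨u, ⟨h0, h1, f, h2, h3⟩, rfl⟩ | ⟨u, ⟨h0, h1, f, h2, h3⟩, rfl⟩ := ha
      · simp only [h3, Option.getD_some]
        exact hβ u h0 f (Finset.mem_union_left _ h2) h3 (fun h => h1 h.1) fun h => hFd f h2 h.2
      · simp only [h3, Option.getD_some]
        exact hβ u h0 f (Finset.mem_union_right _ h2) h3 (fun h => hFd f h.2 h2) fun h => h1 h.1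
    -- A user arrives in at most one of the two disjoint sets of facilities, so there are at most
    -- `n` free places in total.
    · simp only [targetProfile, Prod.mk_add_mk, Multiset.card_add, Multiset.card_map]
      have hd : Disjoint (arriving tgt n U F) (arriving tgt n U' F') := by
        rw [Finset.disjoint_left]
        intro u hu hu'
        simp only [arriving, Finset.mem_filter] at hu hu'
        obtain ⟨-, -, f, h2, h3⟩ := hu
        obtain ⟨-, -, f', h2', h3'⟩ := hu'
        obtain rfl : f = f' := Option.some.inj (h3.symm.trans h3')
        exact hFd f h2 h2'
      have : arriving tgt n U F ∪ arriving tgt n U' F' ⊆ Finset.range n :=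
        Finset.union_subset (Finset.filter_subset _ _) (Finset.filter_subset _ _)
      have h3 := Finset.card_le_card this
      rw [Finset.card_union_of_disjoint hd, Finset.card_range] at h3
      exact h3

theorem targetProfile_shift {α' β' : ℕ → ℕ} (hα : ∀ u ∈ U, α' u = α u + L)
    (hβ : ∀ f ∈ F, β' f = β f + L) :
    targetProfile tgt S n α' β' U F = ((targetProfile tgt S n α β U F).1,
      (targetProfile tgt S n α β U F).2.1, (targetProfile tgt S n α β U F).2.2.1.map (· + L),
      (targetProfile tgt S n α β U F).2.2.2.map (· + L)) := by
  simp only [targetProfile, Multiset.map_map, Function.comp_def, Prod.mk.injEq, true_and]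
  constructor <;> refine Multiset.map_congr rfl fun u hu => ?_
  · exact hα u (Finset.mem_filter.1 hu).1
  · have hu : u ∈ arriving tgt n U F := hu
    obtain ⟨-, -, f, h2, h3⟩ := Finset.mem_filter.1 hu
    simp only [h3, Option.getD_some]
    exact hβ f h2

theorem TableComplete.shift {α' β' : ℕ → ℕ} (h : TableComplete tgt S n α β U F T)
    (hα : ∀ u ∈ U, α' u = α u + L) (hβ : ∀ f ∈ F, β' f = β f + L) :
    TableComplete tgt S n α' β' U F (T.map fun w => w.shift L) := by
  obtain ⟨w, hw, he⟩ := h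
  exact ⟨w.shift L, List.mem_map_of_mem hw, by
    rw [Wit.profile_shift, he, targetProfile_shift hα hβ]⟩

theorem TableSound.shift {α' β' : ℕ → ℕ} (h : TableSound δ R r α β U F T)
    (hα : ∀ u ∈ U, α' u = α u + L) (hβ : ∀ f ∈ F, β' f = β f + L) :
    TableSound δ R r α' β' U F (T.map fun w => w.shift L) := by
  intro w hw
  obtain ⟨v, hv, rfl⟩ := List.mem_map.1 hw
  exact (h v hv).shift hα hβ

/-! #### Single users and facilities -/

theorem userTable_sound {u : ℕ} (hα : α u = 0) : TableSound δ R r α β {u} ∅ (userTable u) := by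
  intro w hw
  simp only [userTable, List.mem_cons, List.not_mem_nil, or_false] at hw
  obtain rfl | rfl := hw
  · exact ⟨rfl, by simp, by simp, by simp, by simp, by simp⟩
  · exact ⟨rfl, by simp, by simp, by simp, by simp [hα], by simp⟩

theorem userTable_complete {u : ℕ} (hα : α u = 0) :
    TableComplete tgt S n α β {u} ∅ (userTable u) := by
  have ha : arriving tgt n {u} ∅ = ∅ := by simp [arriving]
  rcases h : tgt u with _ | f
  · refine ⟨_, List.mem_cons_self, ?_⟩
    have hl : leaving tgt {u} ∅ = ∅ := by simp [leaving, h, Finset.filter_singleton]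
    simp [targetProfile, ha, hl, Wit.profile, Finset.filter_singleton, h]
  · refine ⟨_, List.mem_cons_of_mem _ List.mem_cons_self, ?_⟩
    have hl : leaving tgt {u} ∅ = {u} := by simp [leaving, h, Finset.filter_singleton]
    simp [targetProfile, ha, hl, Wit.profile, Finset.filter_singleton, h, hα]

theorem facTable_sound {f : ℕ} (hβ : β f = 0) :
    TableSound δ R r α β ∅ {f} (facTable r n f) := by
  intro w hw
  simp only [facTable, List.mem_cons, List.mem_map, List.mem_filter, List.mem_range] at hw
  obtain rfl | ⟨s, ⟨hs, hr⟩, rfl⟩ := hw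
  · exact ⟨rfl, by simp [Wit.empty], by simp [Wit.empty], by simp [Wit.empty],
      by simp [Wit.empty], by simp [Wit.empty]⟩
  · refine ⟨rfl, by simp, ?_, by simp, by simp, ?_⟩
    · simpa [Function.comp_def, List.map_const'] using hr
    · intro x hx
      obtain ⟨_, _, rfl⟩ := List.mem_map.1 hx
      simp [hβ]

theorem facTable_complete {f : ℕ} (hβ : β f = 0) (htS : ∀ u < n, tgt u = some f → f ∈ S)
    (hfull : f ∈ S → r ≤ ((Finset.range n).filter fun u => tgt u = some f).card) :
    TableComplete tgt S n α β ∅ {f} (facTable r n f) := by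
  have hl : leaving tgt ∅ {f} = ∅ := by simp [leaving]
  have ha : arriving tgt n ∅ {f} = (Finset.range n).filter fun u => tgt u = some f := by
    ext u; simp [arriving]
  by_cases hf : f ∈ S
  -- The entry to choose is the one whose number of places is the number of users that the target
  -- assigns to `f`.
  · refine ⟨_, List.mem_cons_of_mem _ (List.mem_map_of_mem (List.mem_filter.2
      ⟨List.mem_range.2 (Nat.lt_succ_of_le ?_), by simpa using hfull hf⟩)), ?_⟩
    · simpa using Finset.card_filter_le (Finset.range n) fun u => tgt u = some f
    · simp only [targetProfile, ha, hl, Wit.profile]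
      have : Multiset.map (fun u => β ((tgt u).getD 0))
          (Finset.filter (fun u => tgt u = some f) (Finset.range n)).val
          = Multiset.map (fun _ => 0)
            (Finset.filter (fun u => tgt u = some f) (Finset.range n)).val :=
        Multiset.map_congr rfl fun u hu => by
          have hu : u ∈ (Finset.range n).filter fun u => tgt u = some f := hu
          simp [(Finset.mem_filter.1 hu).2, hβ]
      rw [this]
      simp only [hf, List.map_const', List.length_range, List.length_singleton,
        List.length_nil, List.map_nil, List.map_replicate, Multiset.coe_nil, Multiset.coe_replicate,
        Multiset.map_const', Finset.card_val, Finset.filter_empty, Finset.card_empty,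
        Finset.empty_val, Multiset.map_zero, Finset.singleton_inter_of_mem,
        Finset.card_singleton]
  · refine ⟨_, List.mem_cons_self, ?_⟩
    have : (Finset.range n).filter (fun u => tgt u = some f) = ∅ :=
      Finset.filter_eq_empty_iff.2 fun u hu h => hf (htS u (Finset.mem_range.1 hu) h)
    simp [targetProfile, ha, hl, Wit.profile, Wit.empty, this, hf]

/-! #### The items at one vertex -/

/-- Folding in items, each of which is placed at this vertex if `q.1 = v`. -/
theorem foldl_merge_items {v : ℕ} (tab : ℕ → List Wit) (su sf : ℕ → Finset ℕ)
    -- `P` is the invariant of the table and `Z` says that an item may still be added; it must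
    -- survive the addition of other items.
    (P : Finset ℕ → Finset ℕ → List Wit → Prop) (Z : Finset ℕ → Finset ℕ → ℕ → Prop)
    (hP : ∀ U F T i, P U F T → Z U F i → P (U ∪ su i) (F ∪ sf i) (merge M R n T (tab i)))
    (hZ : ∀ U F i j, i ≠ j → Z U F i → Z (U ∪ su j) (F ∪ sf j) i)
    (l : List (ℕ × ℕ)) (hl : (l.map Prod.snd).Nodup) (U F : Finset ℕ) (T : List Wit)
    (hT : P U F T) (hlZ : ∀ q ∈ l, q.1 = v → Z U F q.2) :
    P (U ∪ (l.filter fun q => decide (q.1 = v)).toFinset.biUnion fun q => su q.2)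
      (F ∪ (l.filter fun q => decide (q.1 = v)).toFinset.biUnion fun q => sf q.2)
      (l.foldl (fun T q => if decide (q.1 = v) = true then merge M R n T (tab q.2) else T) T) := by
  induction l generalizing U F T with
  | nil => simpa using hT
  | cons q l ih =>
    rw [List.map_cons, List.nodup_cons] at hl
    rw [List.foldl_cons]
    by_cases h : q.1 = v
    · have h1 := ih hl.2 (U ∪ su q.2) (F ∪ sf q.2) _ (hP U F T q.2 hT (hlZ q (by simp) h))
        fun q' hq' hv => hZ U F q'.2 q.2 (fun he => hl.1 (he ▸ List.mem_map_of_mem hq'))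
          (hlZ q' (by simp [hq']) hv)
      simpa [h, Finset.union_assoc] using h1
    · have h1 := ih hl.2 U F T hT fun q' hq' hv => hlZ q' (by simp [hq']) hv
      simpa [h] using h1

end

/-! ### Correctness of the dynamic program: the tree -/

/-- The distances in the tree that is built up by attaching the leaf `c` to `p` with an edge of
length `l`, for the triples `(p, c, l)` of the list from its end to its head. -/
def treeDist {A : Type} [AddCommMonoid A] : List (ℕ × ℕ × A) → ℕ → ℕ → A
  | [], _, _ => 0
  | e :: t, x, y => if x = e.2.1 then (if y = e.2.1 then 0 else e.2.2 + treeDist t e.1 y)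
      else if y = e.2.1 then e.2.2 + treeDist t x e.1 else treeDist t x y

/-- The vertices of the tree given by a list. -/
def IsVert {A : Type} (t : List (ℕ × ℕ × A)) (v : ℕ) : Prop := v = 0 ∨ ∃ e ∈ t, e.2.1 = v

/-- Each triple attaches a new vertex to an old one. -/
def WellOrdered {A : Type} : List (ℕ × ℕ × A) → Prop
  | [] => True
  | e :: t => IsVert t e.1 ∧ ¬ IsVert t e.2.1 ∧ WellOrdered t

theorem isVert_cons {A : Type} (t : List (ℕ × ℕ × A)) {e : ℕ × ℕ × A} {v : ℕ} : IsVert (e :: t) v ↔ v = e.2.1 ∨ IsVert t v := by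
  simp only [IsVert, List.mem_cons, exists_eq_or_imp]
  rw [or_left_comm, eq_comm (a := v) (b := e.2.1)]

section

variable {A : Type} [AddCommMonoid A] (t : List (ℕ × ℕ × A))

theorem treeDist_self (x : ℕ) : treeDist t x x = 0 := by
  induction t generalizing x with
  | nil => rfl
  | cons e t ih => by_cases h : x = e.2.1 <;> simp [treeDist, h, ih]

theorem treeDist_comm (x y : ℕ) : treeDist t x y = treeDist t y x := by
  induction t generalizing x y with
  | nil => rfl
  | cons e t ih =>
    by_cases h : x = e.2.1 <;> by_cases h' : y = e.2.1 <;> simp [treeDist, h, h', ih]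

end

theorem treeDist_triangle (t : List (ℕ × ℕ × ℕ)) (x y z : ℕ) :
    treeDist t x z ≤ treeDist t x y + treeDist t y z := by
  induction t generalizing x y z with
  | nil => simp [treeDist]
  | cons e t ih =>
    have h1 := ih e.1 y z
    have h2 := ih x e.1 z
    have h3 := ih x y e.1
    have h4 := ih x y z
    have h5 := ih e.1 y e.1
    by_cases hx : x = e.2.1 <;> by_cases hy : y = e.2.1 <;> by_cases hz : z = e.2.1 <;>
      simp [treeDist, hx, hy, hz] <;> omega

theorem lookupD_map_range {α : Type} (f : ℕ → α) (nv v : ℕ) (d : α) (hv : v < nv) :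
    lookupD ((List.range nv).map fun v => (v, f v)) v d = f v := by
  have key : ∀ (l : List ℕ) (d : α), (v ∈ l ∨ d = f v) →
      lookupD (l.map fun v => (v, f v)) v d = f v := by
    intro l
    induction l with
    | nil => intro d h; simpa [lookupD] using h
    | cons a l ih =>
      intro d h
      refine ih _ ?_
      by_cases ha : a = v
      · right; simp [ha]
      · simp only [List.mem_cons] at h
        rcases h with (h | h) | h
        · exact absurd h.symm ha
        · exact Or.inl h
        · right; simp [ha, h]
  exact key _ d (Or.inl (by simpa using hv))

/-- The target is a solution that respects the distance bound `R`. -/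
structure IsTarget (δ : ℕ → ℕ → ℕ) (R r n m : ℕ) (tgt : ℕ → Option ℕ) (S : Finset ℕ) : Prop where
  assigned : ∀ u < n, ∀ f, tgt u = some f → f ∈ S ∧ δ u f ≤ R
  subset : S ⊆ Finset.range m
  full : ∀ f ∈ S, r ≤ ((Finset.range n).filter fun u => tgt u = some f).card

/-- The table is sound, and it is complete with respect to the target if that is a solution. -/
def TableGood (δ : ℕ → ℕ → ℕ) (R r n m : ℕ) (tgt : ℕ → Option ℕ) (S : Finset ℕ) (α β : ℕ → ℕ)
    (U F : Finset ℕ) (T : List Wit) : Prop :=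
  TableSound δ R r α β U F T ∧ (IsTarget δ R r n m tgt S → TableComplete tgt S n α β U F T)

section

variable {tgt : ℕ → Option ℕ} {S : Finset ℕ} {δ : ℕ → ℕ → ℕ} {R r n m L M : ℕ} {α β : ℕ → ℕ}
  {U F U' F' : Finset ℕ} {T T' : List Wit}

theorem TableGood.merge (h : TableGood δ R r n m tgt S α β U F T)
    (h' : TableGood δ R r n m tgt S α β U' F' T')
    (hU : Disjoint U U') (hF : Disjoint F F')
    (hδ : ∀ u ∈ U ∪ U', ∀ f ∈ F ∪ F', δ u f ≤ α u + β f)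
    (hn : U ∪ U' ⊆ Finset.range n) (hm : F ∪ F' ⊆ Finset.range m)
    (hα : ∀ u ∈ U ∪ U', ∀ f < m, δ u f ≤ R → ¬ (u ∈ U ∧ f ∈ F) → ¬ (u ∈ U' ∧ f ∈ F') → α u ≤ R)
    (hβ : ∀ u < n, ∀ f ∈ F ∪ F', δ u f ≤ R → ¬ (u ∈ U ∧ f ∈ F) → ¬ (u ∈ U' ∧ f ∈ F') →
      β f ≤ R)
    (hαβ : ∀ u ∈ U ∪ U', ∀ f ∈ F ∪ F', δ u f ≤ R → ¬ (u ∈ U ∧ f ∈ F) →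
      ¬ (u ∈ U' ∧ f ∈ F') → α u + β f ≤ R) :
    TableGood δ R r n m tgt S α β (U ∪ U') (F ∪ F') (merge (n + n + m) R n T T') := by
  refine ⟨h.1.merge h'.1 hU hF hδ, fun ht => TableComplete.merge h.1 h'.1 hU hF hδ hn hm
    (fun u hu f htf => hα u hu f (Finset.mem_range.1 (ht.subset (ht.assigned u ?_ f htf).1))
      (ht.assigned u ?_ f htf).2)
    (fun u hu f hf htf => hβ u hu f hf (ht.assigned u hu f htf).2)
    (fun u hu f hf htf => hαβ u hu f hf (ht.assigned u ?_ f htf).2) (h.2 ht) (h'.2 ht)⟩ <;>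
  exact Finset.mem_range.1 (hn hu)

/-- For items located at the current vertex all distances vanish, so the metric conditions of
merging hold trivially. -/
theorem TableGood.merge_zero {U₀ F₀ : Finset ℕ} (h : TableGood δ R r n m tgt S α β U F T)
    (h' : TableGood δ R r n m tgt S α β U' F' T')
    (hU : Disjoint U U') (hF : Disjoint F F') (hU₀ : U ∪ U' ⊆ U₀) (hF₀ : F ∪ F' ⊆ F₀)
    (hn : U₀ ⊆ Finset.range n) (hm : F₀ ⊆ Finset.range m) (hα : ∀ u ∈ U₀, α u = 0)
    (hβ : ∀ f ∈ F₀, β f = 0) (hδ : ∀ u ∈ U₀, ∀ f ∈ F₀, δ u f = 0) :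
    TableGood δ R r n m tgt S α β (U ∪ U') (F ∪ F') (_root_.merge (n + n + m) R n T T') := by
  refine h.merge h' hU hF (fun u hu f hf => (hδ u (hU₀ hu) f (hF₀ hf)).trans_le (Nat.zero_le _))
    (hU₀.trans hn) (hF₀.trans hm) ?_ ?_ ?_
  · intro u hu f _ _ _ _
    rw [hα u (hU₀ hu)]; exact Nat.zero_le _
  · intro u _ f hf _ _ _
    rw [hβ f (hF₀ hf)]; exact Nat.zero_le _
  · intro u hu f hf _ _ _
    rw [hα u (hU₀ hu), hβ f (hF₀ hf)]; exact Nat.zero_le _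

theorem nodup_zipIdx_snd (l : List ℕ) : ((List.zipIdx l).map Prod.snd).Nodup := by
  have : (List.zipIdx l).map Prod.snd = List.range' 0 l.length := by
    simp
  rw [this]
  exact List.nodup_range'

theorem biUnion_zipIdx (l : List ℕ) (v : ℕ) :
    (((List.zipIdx l).filter fun q => decide (q.1 = v)).toFinset.biUnion fun q => {q.2})
      = (Finset.range l.length).filter fun i => l.getD i 0 = v := by
  ext i
  simp only [Finset.mem_biUnion, List.mem_toFinset, List.mem_filter, decide_eq_true_eq,
    Finset.mem_singleton, Finset.mem_filter, Finset.mem_range, Prod.exists,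
    List.mk_mem_zipIdx_iff_getElem?]
  constructor
  · rintro ⟨a, b, ⟨h1, rfl⟩, rfl⟩
    obtain ⟨h2, h3⟩ := List.getElem?_eq_some_iff.1 h1
    exact ⟨h2, by simp [h1]⟩
  · rintro ⟨h1, h2⟩
    refine ⟨v, i, ⟨?_, rfl⟩, rfl⟩
    rw [List.getElem?_eq_getElem h1]
    simpa [h1] using h2

theorem TableGood.foldl_users {U₀ F₀ : Finset ℕ} {v : ℕ} (hn : U₀ ⊆ Finset.range n)
    (hm : F₀ ⊆ Finset.range m) (hα : ∀ u ∈ U₀, α u = 0)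
    (hβ : ∀ f ∈ F₀, β f = 0) (hδ : ∀ u ∈ U₀, ∀ f ∈ F₀, δ u f = 0) (l : List (ℕ × ℕ))
    (hl : (l.map Prod.snd).Nodup) (hlU : ∀ q ∈ l, q.1 = v → q.2 ∈ U₀ ∧ q.2 ∉ U)
    (hU : U ⊆ U₀) (hF : F ⊆ F₀) (h : TableGood δ R r n m tgt S α β U F T) :
    TableGood δ R r n m tgt S α β
      (U ∪ (l.filter fun q => decide (q.1 = v)).toFinset.biUnion fun q => {q.2}) F
      (l.foldl (fun T q => if decide (q.1 = v) = true
        then _root_.merge (n + n + m) R n T (userTable q.2) else T) T) := by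
  have := foldl_merge_items (M := n + n + m) (R := R) (n := n) (v := v) userTable
    (fun i => {i}) (fun _ => ∅) (fun U F T => U ⊆ U₀ ∧ F ⊆ F₀ ∧ TableGood δ R r n m tgt S α β U F T)
    (fun U F i => i ∈ U₀ ∧ i ∉ U) ?_ ?_ l hl U F T ⟨hU, hF, h⟩ hlU
  · have hemp : ∀ s : Finset (ℕ × ℕ), (s.biUnion fun _ => (∅ : Finset ℕ)) = ∅ := fun s => by
      ext; simp
    simpa only [hemp, Finset.union_empty] using this.2.2
  · rintro U F T i ⟨h1, h2, h3⟩ ⟨h4, h5⟩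
    have hs : U ∪ {i} ⊆ U₀ := Finset.union_subset h1 (by simpa using h4)
    refine ⟨hs, by simpa using h2, h3.merge_zero
      ⟨userTable_sound (hα i h4), fun _ => userTable_complete (hα i h4)⟩ (by simpa using h5)
      (by simp) hs (by simpa using h2) hn hm hα hβ hδ⟩
  · rintro U F i j hij ⟨h1, h2⟩
    exact ⟨h1, by simp [h2, hij]⟩

theorem TableGood.foldl_facs {U₀ F₀ : Finset ℕ} {v : ℕ} (hn : U₀ ⊆ Finset.range n)
    (hm : F₀ ⊆ Finset.range m) (hα : ∀ u ∈ U₀, α u = 0)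
    (hβ : ∀ f ∈ F₀, β f = 0) (hδ : ∀ u ∈ U₀, ∀ f ∈ F₀, δ u f = 0) (l : List (ℕ × ℕ))
    (hl : (l.map Prod.snd).Nodup) (hlU : ∀ q ∈ l, q.1 = v → q.2 ∈ F₀ ∧ q.2 ∉ F)
    (hU : U ⊆ U₀) (hF : F ⊆ F₀) (h : TableGood δ R r n m tgt S α β U F T) :
    TableGood δ R r n m tgt S α β U
      (F ∪ (l.filter fun q => decide (q.1 = v)).toFinset.biUnion fun q => {q.2})
      (l.foldl (fun T q => if decide (q.1 = v) = true
        then _root_.merge (n + n + m) R n T (facTable r n q.2) else T) T) := by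
  have := foldl_merge_items (M := n + n + m) (R := R) (n := n) (v := v) (facTable r n)
    (fun _ => ∅) (fun i => {i}) (fun U F T => U ⊆ U₀ ∧ F ⊆ F₀ ∧ TableGood δ R r n m tgt S α β U F T)
    (fun U F i => i ∈ F₀ ∧ i ∉ F) ?_ ?_ l hl U F T ⟨hU, hF, h⟩ hlU
  · have hemp : ∀ s : Finset (ℕ × ℕ), (s.biUnion fun _ => (∅ : Finset ℕ)) = ∅ := fun s => by
      ext; simp
    simpa only [hemp, Finset.union_empty] using this.2.2
  · rintro U F T i ⟨h1, h2, h3⟩ ⟨h4, h5⟩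
    have hs : F ∪ {i} ⊆ F₀ := Finset.union_subset h2 (by simpa using h4)
    refine ⟨by simpa using h1, hs, h3.merge_zero
      ⟨facTable_sound (hβ i h4), fun ht => facTable_complete (hβ i h4)
        (fun u hu htf => (ht.assigned u hu i htf).1) (ht.full i)⟩ (by simp) (by simpa using h5)
      (by simpa using h1) hs hn hm hα hβ hδ⟩
  · rintro U F i j hij ⟨h1, h2⟩
    exact ⟨h1, by simp [h2, hij]⟩

theorem tableGood_empty : TableGood δ R r n m tgt S α β ∅ ∅ [Wit.empty] := by
  constructor
  · intro w hw
    rw [List.mem_singleton.1 hw]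
    exact Wit.sound_empty
  · refine fun _ => ⟨_, List.mem_singleton_self _, ?_⟩
    simp [Wit.profile, Wit.empty, targetProfile, leaving, arriving]

theorem vertexTable_good {users facs : List ℕ} {v : ℕ} {D : ℕ → ℕ → ℕ} (hD : ∀ x, D x x = 0) :
    TableGood (fun u f => D (users.getD u 0) (facs.getD f 0)) R r users.length facs.length tgt S
      (fun u => D (users.getD u 0) v) (fun f => D v (facs.getD f 0))
      ((Finset.range users.length).filter fun u => users.getD u 0 = v)
      ((Finset.range facs.length).filter fun f => facs.getD f 0 = v)
      (vertexTable (users.length + users.length + facs.length) R r users facs v) := by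
  have hα : ∀ u ∈ (Finset.range users.length).filter fun u => users.getD u 0 = v,
      D (users.getD u 0) v = 0 := fun u hu => by
    rw [(Finset.mem_filter.1 hu).2, hD]
  have hβ : ∀ f ∈ (Finset.range facs.length).filter fun f => facs.getD f 0 = v,
      D v (facs.getD f 0) = 0 := fun u hu => by
    rw [(Finset.mem_filter.1 hu).2, hD]
  have hδ : ∀ u ∈ (Finset.range users.length).filter fun u => users.getD u 0 = v,
      ∀ f ∈ (Finset.range facs.length).filter fun f => facs.getD f 0 = v,
      D (users.getD u 0) (facs.getD f 0) = 0 := fun u hu f hf => by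
    rw [(Finset.mem_filter.1 hu).2, (Finset.mem_filter.1 hf).2, hD]
  have hmem : ∀ (l : List ℕ) (q : ℕ × ℕ), q ∈ List.zipIdx l → q.1 = v →
      q.2 ∈ (Finset.range l.length).filter fun i => l.getD i 0 = v := by
    intro l q hq hv
    rw [← biUnion_zipIdx, Finset.mem_biUnion]
    exact ⟨q, by simp [hq, hv], by simp⟩
  have h1 := TableGood.foldl_users (R := R) (r := r) (tgt := tgt) (S := S)
    (Finset.filter_subset _ _) (Finset.filter_subset _ _) hα hβ hδ
    (List.zipIdx users) (nodup_zipIdx_snd _) (U := ∅) (F := ∅)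
    (fun q hq hv => ⟨hmem _ q hq hv, by simp⟩) (by simp) (by simp) tableGood_empty
  rw [biUnion_zipIdx, Finset.empty_union] at h1
  have h2 := TableGood.foldl_facs (R := R) (r := r) (tgt := tgt) (S := S)
    (Finset.filter_subset _ _) (Finset.filter_subset _ _) hα hβ hδ
    (List.zipIdx facs) (nodup_zipIdx_snd _)
    (fun q hq hv => ⟨hmem _ q hq hv, by simp⟩) subset_rfl (by simp) h1
  rw [biUnion_zipIdx, Finset.empty_union] at h2
  exact h2

end

section

variable {tgt : ℕ → Option ℕ} {S : Finset ℕ} {R r nv : ℕ} {users facs : List ℕ}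
  {D : ℕ → ℕ → ℕ}

/-- The situation when the tree has been contracted to the tree given by `t`: each vertex `x` has
been contracted to `top x`, and `τ v` is the table of the items contracted to `v`. -/
structure Contracted (D : ℕ → ℕ → ℕ) (R r nv : ℕ) (users facs : List ℕ) (tgt : ℕ → Option ℕ)
    (S : Finset ℕ) (t : List (ℕ × ℕ × ℕ)) (top : ℕ → ℕ) (τ : ℕ → List Wit) : Prop where
  isVert : ∀ x < nv, IsVert t (top x)
  lt : ∀ v, IsVert t v → v < nv
  gate : ∀ x < nv, ∀ w, IsVert t w → D x w = D x (top x) + D (top x) w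
  sep : ∀ x < nv, ∀ y < nv, top x ≠ top y →
    D x y = D x (top x) + D (top x) (top y) + D (top y) y
  eq : ∀ x y, IsVert t x → IsVert t y → D x y = treeDist t x y
  good : ∀ v, IsVert t v →
    TableGood (fun u f => D (users.getD u 0) (facs.getD f 0)) R r users.length facs.length tgt S
      (fun u => D (users.getD u 0) v) (fun f => D v (facs.getD f 0))
      ((Finset.range users.length).filter fun u => top (users.getD u 0) = v)
      ((Finset.range facs.length).filter fun f => top (facs.getD f 0) = v) (τ v)

/-- The leaf `c` is joined to the remaining tree by its edge to `p` only, so `p` becomes the gate of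
everything contracted to `c`. Hence distances to `p` grow by exactly `L`. A path between the two
blocks, or from one of them to a third block, passes through `p`: a crossing pair has distance `α u
+ β f`, and a pair within `R` has both of its relevant distances to `p` at most `R`. -/
theorem Contracted.step {e : ℕ × ℕ × ℕ} {t : List (ℕ × ℕ × ℕ)} {top : ℕ → ℕ} {τ : ℕ → List Wit}
    (hD : ∀ x, D x x = 0) (hDc : ∀ x y, D x y = D y x) (hDt : ∀ x y z, D x z ≤ D x y + D y z)
    (hu : ∀ u < users.length, users.getD u 0 < nv) (hf : ∀ f < facs.length, facs.getD f 0 < nv)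
    (hw : WellOrdered (e :: t)) (h : Contracted D R r nv users facs tgt S (e :: t) top τ) :
    Contracted D R r nv users facs tgt S t (fun x => if top x = e.2.1 then e.1 else top x)
      (fun v => if v = e.1 then merge (users.length + users.length + facs.length) R users.length
        (τ v) ((τ e.2.1).map fun w => w.shift e.2.2) else τ v) := by
  obtain ⟨p, c, L⟩ := e
  obtain ⟨hp, hc, hw⟩ := hw
  simp only at *
  have hcV : IsVert ((p, c, L) :: t) c := (isVert_cons t).2 (Or.inl rfl)
  have hV : ∀ {v}, IsVert t v → IsVert ((p, c, L) :: t) v := fun h => (isVert_cons t).2 (Or.inr h)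
  have hVt : ∀ {v}, IsVert ((p, c, L) :: t) v → v ≠ c → IsVert t v := fun h hne =>
    ((isVert_cons t).1 h).resolve_left hne
  have hne : ∀ {v}, IsVert t v → v ≠ c := fun hv he => hc (he ▸ hv)
  have heq : ∀ x y, IsVert t x → IsVert t y → D x y = treeDist t x y := fun x y hx hy => by
    rw [h.eq x y (hV hx) (hV hy)]
    simp [treeDist, hne hx, hne hy]
  have hcD : ∀ w, IsVert t w → D c w = L + D p w := fun w hw => by
    rw [h.eq c w hcV (hV hw), heq p w hp hw]
    simp [treeDist, hne hw]
  have hcp : D c p = L := by rw [hcD p hp, hD]; rfl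
  have hgc : ∀ x < nv, top x = c → D x p = D x c + L := fun x hx htop => by
    rw [h.gate x hx p (hV hp), htop, hcp]
  refine ⟨?_, fun v hv => h.lt v (hV hv), ?_, ?_, heq, ?_⟩
  · intro x hx
    split_ifs with htop
    exacts [hp, hVt (h.isVert x hx) htop]
  · intro x hx w hw
    split_ifs with htop
    · rw [h.gate x hx w (hV hw), htop, hcD w hw, hgc x hx htop, add_assoc]
    · exact h.gate x hx w (hV hw)
  · intro x hx y hy htt
    split_ifs at htt ⊢ with h1 h2 h2
    · exact absurd rfl htt
    · have hty := hVt (h.isVert y hy) h2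
      rw [h.sep x hx y hy (by rw [h1]; exact Ne.symm h2), h1, hcD _ hty, hgc x hx h1]
      omega
    · have htx := hVt (h.isVert x hx) h1
      have h3 := hcD _ htx
      have h4 := hgc y hy h2
      rw [h.sep x hx y hy (by rw [h2]; exact h1), h2, hDc (top x) c, hDc c y, hDc (top x) p,
        hDc p y]
      omega
    · exact h.sep x hx y hy htt
  · intro v hv
    have hvc := hne hv
    by_cases hvp : v = p
    · subst hvp
      rw [if_pos rfl]
      have hset : ∀ (l : List ℕ), ((Finset.range l.length).filter fun i =>
          (if top (l.getD i 0) = c then v else top (l.getD i 0)) = v)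
          = ((Finset.range l.length).filter fun i => top (l.getD i 0) = v) ∪
            ((Finset.range l.length).filter fun i => top (l.getD i 0) = c) := by
        intro l
        ext i
        simp only [Finset.mem_filter, Finset.mem_union]
        split_ifs with h1
        · simp only [h1, and_true]; tauto
        · simp only [h1, and_false, or_false]
      have hdisj : ∀ (l : List ℕ), Disjoint
          ((Finset.range l.length).filter fun i => top (l.getD i 0) = v)
          ((Finset.range l.length).filter fun i => top (l.getD i 0) = c) := by
        intro l
        rw [Finset.disjoint_left]
        intro i hi hi'
        exact hvc ((Finset.mem_filter.1 hi).2.symm.trans (Finset.mem_filter.1 hi').2)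
      have hshift : TableGood (fun u f => D (users.getD u 0) (facs.getD f 0)) R r users.length
          facs.length tgt S (fun u => D (users.getD u 0) v) (fun f => D v (facs.getD f 0))
          ((Finset.range users.length).filter fun u => top (users.getD u 0) = c)
          ((Finset.range facs.length).filter fun f => top (facs.getD f 0) = c)
          ((τ c).map fun w => w.shift L) := by
        have h1 := h.good c hcV
        have hα : ∀ u ∈ (Finset.range users.length).filter fun u => top (users.getD u 0) = c,
            D (users.getD u 0) v = D (users.getD u 0) c + L := fun u hu' => by
          obtain ⟨h2, h3⟩ := Finset.mem_filter.1 hu'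
          exact hgc _ (hu u (Finset.mem_range.1 h2)) h3
        have hβ : ∀ f ∈ (Finset.range facs.length).filter fun f => top (facs.getD f 0) = c,
            D v (facs.getD f 0) = D c (facs.getD f 0) + L := fun f hf' => by
          obtain ⟨h2, h3⟩ := Finset.mem_filter.1 hf'
          rw [hDc v, hDc c]
          exact hgc _ (hf f (Finset.mem_range.1 h2)) h3
        exact ⟨h1.1.shift hα hβ, fun ht => (h1.2 ht).shift hα hβ⟩
      rw [hset, hset]
      have hsub : ∀ (l : List ℕ), ((Finset.range l.length).filter fun i => top (l.getD i 0) = v) ∪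
            ((Finset.range l.length).filter fun i => top (l.getD i 0) = c)
            ⊆ Finset.range l.length := fun l =>
        Finset.union_subset (Finset.filter_subset _ _) (Finset.filter_subset _ _)
      have hmem : ∀ (l : List ℕ) (hl : ∀ i < l.length, l.getD i 0 < nv) i,
          i ∈ ((Finset.range l.length).filter fun i => top (l.getD i 0) = v) ∪
            ((Finset.range l.length).filter fun i => top (l.getD i 0) = c) →
          i < l.length ∧ l.getD i 0 < nv ∧ (top (l.getD i 0) = v ∨ top (l.getD i 0) = c) := by
        intro l hl i hi
        have h1 := Finset.mem_range.1 (hsub l hi)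
        refine ⟨h1, hl i h1, ?_⟩
        simp only [Finset.mem_union, Finset.mem_filter] at hi
        tauto
      -- The path from `x` in one of the two blocks to another block contains `v`, so its initial
      -- segment is no longer than the whole; if `y` lies in the other of the two blocks, both
      -- segments together are no longer.
      have hsepv : ∀ x < nv, ∀ y < nv, top x ≠ top y → (top x = v ∨ top x = c) →
          D x v ≤ D x y ∧ ((top y = v ∨ top y = c) → D x v + D v y ≤ D x y) := by
        intro x hx y hy hxy htx
        have h1 := h.sep x hx y hy hxy
        rcases htx with htx | htx
        · rw [htx] at h1 hxy
          refine ⟨by omega, ?_⟩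
          rintro (hty | hty)
          · exact absurd hty.symm hxy
          · have h2 := hgc y hy hty
            rw [hty, hDc v c, hcp, hDc c y] at h1
            rw [hDc v y]
            omega
        · have h2 := hgc x hx htx
          rw [htx] at h1 hxy
          have hty := hVt (h.isVert y hy) (Ne.symm hxy)
          rw [hcD _ hty] at h1
          refine ⟨by omega, ?_⟩
          rintro (hty | hty)
          · rw [hty] at h1
            have := hD v
            omega
          · exact absurd hty.symm hxy
      -- A pair that involves one of the two blocks and is not contained in either has its ends in
      -- different blocks.
      have hcross : ∀ u < users.length, ∀ f < facs.length,
          ¬ (u ∈ ((Finset.range users.length).filter fun u => top (users.getD u 0) = v) ∧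
            f ∈ ((Finset.range facs.length).filter fun f => top (facs.getD f 0) = v)) →
          ¬ (u ∈ ((Finset.range users.length).filter fun u => top (users.getD u 0) = c) ∧
            f ∈ ((Finset.range facs.length).filter fun f => top (facs.getD f 0) = c)) →
          ((top (users.getD u 0) = v ∨ top (users.getD u 0) = c) ∨
            (top (facs.getD f 0) = v ∨ top (facs.getD f 0) = c)) →
          top (users.getD u 0) ≠ top (facs.getD f 0) := by
        intro u hu f hf h1 h2 h3 h4
        simp only [Finset.mem_filter, Finset.mem_range, hu, hf, true_and, ← h4, and_self,
          or_self] at h1 h2 h3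
        tauto
      refine (h.good v (hV hv)).merge hshift (hdisj users) (hdisj facs) (fun u _ f _ => hDt _ _ _)
        (hsub users) (hsub facs) ?_ ?_ ?_
      · intro u hu' f hf' hR h1 h2
        obtain ⟨h3, h4, h5⟩ := hmem users hu u hu'
        exact (hsepv _ h4 _ (hf f hf') (hcross u h3 f hf' h1 h2 (Or.inl h5)) h5).1.trans hR
      · intro u hu' f hf' hR h1 h2
        obtain ⟨h3, h4, h5⟩ := hmem facs hf f hf'
        rw [hDc] at hR ⊢
        exact (hsepv _ h4 _ (hu u hu')
          (hcross u hu' f h3 h1 h2 (Or.inr h5)).symm h5).1.trans hR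
      · intro u hu' f hf' hR h1 h2
        obtain ⟨h3, h4, h5⟩ := hmem users hu u hu'
        obtain ⟨h6, h7, h8⟩ := hmem facs hf f hf'
        exact ((hsepv _ h4 _ h7 (hcross u h3 f h6 h1 h2 (Or.inl h5)) h5).2 h8).trans hR
    · rw [if_neg hvp]
      have hset : ∀ (l : List ℕ), ((Finset.range l.length).filter fun i =>
          (if top (l.getD i 0) = c then p else top (l.getD i 0)) = v)
          = ((Finset.range l.length).filter fun i => top (l.getD i 0) = v) := by
        intro l
        refine Finset.filter_congr fun i _ => ?_
        split_ifs with h1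
        · rw [h1]
          exact ⟨fun h => absurd h.symm hvp, fun h => absurd h.symm hvc⟩
        · rfl
      rw [hset, hset]
      exact h.good v (hV hv)

theorem contract_map_range {M n : ℕ} {e : ℕ × ℕ × ℕ} {τ : ℕ → List Wit} (hc : e.2.1 < nv) :
    contract M R n ((List.range nv).map fun v => (v, τ v)) e = (List.range nv).map fun v =>
      (v, if v = e.1 then merge M R n (τ v) ((τ e.2.1).map fun w => w.shift e.2.2) else τ v) := by
  unfold contract
  rw [lookupD_map_range _ _ _ _ hc, List.map_map]
  refine List.map_congr_left fun v _ => ?_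
  simp only [Function.comp_apply, decide_eq_true_eq]
  split_ifs <;> rfl

theorem Contracted.foldl {t : List (ℕ × ℕ × ℕ)} {top : ℕ → ℕ} {τ : ℕ → List Wit}
    (hD : ∀ x, D x x = 0) (hDc : ∀ x y, D x y = D y x) (hDt : ∀ x y z, D x z ≤ D x y + D y z)
    (hu : ∀ u < users.length, users.getD u 0 < nv) (hf : ∀ f < facs.length, facs.getD f 0 < nv)
    (hw : WellOrdered t) (h : Contracted D R r nv users facs tgt S t top τ) :
    ∃ top' τ', Contracted D R r nv users facs tgt S [] top' τ' ∧
      t.foldl (contract (users.length + users.length + facs.length) R users.length)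
        ((List.range nv).map fun v => (v, τ v)) = (List.range nv).map fun v => (v, τ' v) := by
  induction t generalizing top τ with
  | nil => exact ⟨top, τ, h, rfl⟩
  | cons e t ih =>
    have h1 := h.step hD hDc hDt hu hf hw
    obtain ⟨top', τ', h2, h3⟩ := ih hw.2.2 h1
    refine ⟨top', τ', h2, ?_⟩
    rw [List.foldl_cons, contract_map_range (h.lt _ ((isVert_cons t).2 (Or.inl rfl)))]
    exact h3

/-- The table at the root is sound and complete for all users and facilities. -/
theorem rootTable_good {ord : List (ℕ × ℕ × ℕ)} (hw : WellOrdered ord)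
    (hv : ∀ v, IsVert ord v ↔ v < nv)
    (hu : ∀ u < users.length, users.getD u 0 < nv) (hf : ∀ f < facs.length, facs.getD f 0 < nv) :
    TableGood (fun u f => treeDist ord (users.getD u 0) (facs.getD f 0)) R r users.length
      facs.length tgt S (fun u => treeDist ord (users.getD u 0) 0)
      (fun f => treeDist ord 0 (facs.getD f 0)) (Finset.range users.length)
      (Finset.range facs.length)
      (rootTable (users.length + users.length + facs.length) R r nv users facs ord) := by
  -- Before any contraction every vertex is its own block, and the gate conditions are trivial.
  have h0 : Contracted (treeDist ord) R r nv users facs tgt S ord id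
      (vertexTable (users.length + users.length + facs.length) R r users facs) := by
    refine ⟨fun x hx => (hv x).2 hx, fun v => (hv v).1, ?_, ?_, fun _ _ _ _ => rfl, ?_⟩
    · intro x _ w _
      simp [treeDist_self]
    · intro x _ y _ _
      simp [treeDist_self]
    · intro v _
      exact vertexTable_good (D := treeDist ord) (treeDist_self ord)
  obtain ⟨top, τ, h1, h2⟩ := h0.foldl (treeDist_self ord) (treeDist_comm ord)
    (treeDist_triangle ord) hu hf hw
  have hV0 : IsVert ([] : List (ℕ × ℕ × ℕ)) 0 := Or.inl rfl
  have h3 := h1.good 0 hV0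
  have htop : ∀ x < nv, top x = 0 := fun x hx => by
    simpa [IsVert] using h1.isVert x hx
  rw [Finset.filter_true_of_mem fun u h => htop _ (hu u (Finset.mem_range.1 h)),
    Finset.filter_true_of_mem fun u h => htop _ (hf u (Finset.mem_range.1 h))] at h3
  unfold rootTable
  rw [h2, lookupD_map_range _ _ _ _ (h1.lt 0 hV0)]
  exact h3

end

/-! ### Rounding of the edge lengths -/

theorem lookupD_cons {α : Type} (q : ℕ × α) (l : List (ℕ × α)) (v : ℕ) (d : α) :
    lookupD (q :: l) v d = lookupD l v (if q.1 = v then q.2 else d) := by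
  simp [lookupD]

theorem lookupD_of_not_mem {α : Type} (l : List (ℕ × α)) (v : ℕ) (d : α)
    (h : ∀ q ∈ l, q.1 ≠ v) : lookupD l v d = d := by
  induction l generalizing d with
  | nil => rfl
  | cons q l ih =>
    rw [lookupD_cons, if_neg (h q (by simp))]
    exact ih d fun q hq => h q (by simp [hq])

theorem mulNat_eq (B : ℕ) (x : ℝ) : mulNat B x = B * x := by
  induction B with
  | zero => simp [mulNat]
  | succ B ih =>
    rw [mulNat] at ih ⊢
    rw [List.range_succ, List.foldl_append, ih]
    simp only [List.foldl_cons, List.foldl_nil]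
    push_cast
    ring

/-- Once a subtraction is refused, all later ones are. So a quotient below the number of rounds
means that the division has come to an end, with a remainder of at most `b`. -/
theorem roundLen_aux (k : ℕ) {b x : ℝ} (hb : 0 ≤ b) (hx : 0 ≤ x) (s : ℝ × ℕ)
    (hs : s = (List.range k).foldl
      (fun s _ => if decide (b < s.1) = true then (s.1 - b, s.2 + 1) else s) (x, 0)) :
    s.2 ≤ k ∧ x = s.1 + s.2 * b ∧ 0 ≤ s.1 ∧ (s.2 < k → s.1 ≤ b) ∧
      (0 < s.2 → s.2 * b < x + b) ∧ (b = 0 → 0 < s.2 → 0 < s.1) := by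
  induction k generalizing s with
  | zero => subst hs; simp [hx]
  | succ k ih =>
    obtain ⟨h1, h2, h3, h4, h5, h6⟩ := ih _ rfl
    rw [List.range_succ, List.foldl_append] at hs
    simp only [List.foldl_cons, List.foldl_nil, decide_eq_true_eq] at hs h1 h2 h3 h4 h5 h6
    generalize List.foldl (fun (s : ℝ × ℕ) (_ : ℕ) => if b < s.1 then (s.1 - b, s.2 + 1) else s)
      (x, 0) (List.range k) = s' at hs h1 h2 h3 h4 h5 h6
    split_ifs at hs with hc
    · subst hs
      have h7 : s'.2 = k := by
        by_contra h
        exact absurd hc (not_lt.2 (h4 (by omega)))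
      refine ⟨by simp only; omega, by simp only; push_cast; linarith, by simp only; linarith,
        fun h => by simp only at h; omega, fun _ => ?_, fun h0 _ => by simp only; linarith⟩
      simp only
      push_cast
      linarith
    · subst hs
      exact ⟨by omega, h2, h3, fun _ => not_lt.1 hc, h5, h6⟩

theorem roundLen_spec (B : ℕ) {b x : ℝ} (hb : 0 ≤ b) (hx : 0 ≤ x) :
    x = (roundLen B b x).1 + (roundLen B b x).2 * b ∧ 0 ≤ (roundLen B b x).1 ∧
    ((roundLen B b x).2 < B + 3 → (roundLen B b x).1 ≤ b ∧ (b = 0 → (roundLen B b x).2 = 0)) ∧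
    (¬ (roundLen B b x).2 < B + 3 → (roundLen B b x).2 = B + 3 ∧ (B + 2) * b < x) := by
  obtain ⟨h1, h2, h3, h4, h5, h6⟩ := roundLen_aux (B + 3) hb hx (roundLen B b x) rfl
  refine ⟨h2, h3, fun h => ⟨h4 h, fun h0 => ?_⟩, fun h => ⟨by omega, ?_⟩⟩
  · by_contra hne
    have := h6 h0 (by omega)
    have := h4 h
    linarith
  · have h7 : (roundLen B b x).2 = B + 3 := by omega
    rw [h7] at h5
    have := h5 (by omega)
    push_cast at this
    linarith

theorem roundEdges_cons (B : ℕ) (b : ℝ) (e : ℕ × ℕ × ℝ) (t : List (ℕ × ℕ × ℝ)) :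
    roundEdges B b (e :: t) = roundStep B e (roundEdges B b t)
      (roundLen B b (lookupD (roundEdges B b t).2 e.1 0 + mulNat B e.2.2)) := rfl

theorem isVert_roundEdges (B : ℕ) (b : ℝ) (t : List (ℕ × ℕ × ℝ)) (v : ℕ) :
    IsVert (roundEdges B b t).1 v ↔ IsVert t v := by
  induction t with
  | nil => simp [roundEdges, IsVert]
  | cons e t ih =>
    rw [roundEdges_cons, roundStep, isVert_cons, isVert_cons, ih]

theorem wellOrdered_roundEdges (B : ℕ) (b : ℝ) (t : List (ℕ × ℕ × ℝ)) (h : WellOrdered t) :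
    WellOrdered (roundEdges B b t).1 := by
  induction t with
  | nil => trivial
  | cons e t ih =>
    exact ⟨(isVert_roundEdges B b t _).2 h.1, fun h' => h.2.1 ((isVert_roundEdges B b t _).1 h'),
      ih h.2.2⟩

theorem isVert_of_mem_roundEdges (B : ℕ) (b : ℝ) (t : List (ℕ × ℕ × ℝ)) :
    ∀ q ∈ (roundEdges B b t).2, IsVert t q.1 := by
  induction t with
  | nil => simp [roundEdges]
  | cons e t ih =>
    intro q hq
    rw [roundEdges_cons, roundStep] at hq
    rcases List.mem_cons.1 hq with rfl | hq
    · exact (isVert_cons t).2 (Or.inl rfl)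
    · exact (isVert_cons t).2 (Or.inr (ih q hq))

theorem treeDist_nonneg (t : List (ℕ × ℕ × ℝ)) (h : ∀ e ∈ t, 0 ≤ e.2.2) (x y : ℕ) :
    0 ≤ treeDist t x y := by
  induction t generalizing x y with
  | nil => exact le_rfl
  | cons e t ih =>
    have h1 := h e (by simp)
    have h2 := ih (fun e he => h e (by simp [he]))
    have h3 := h2 e.1 y
    have h4 := h2 x e.1
    have h5 := h2 x y
    unfold treeDist
    split_ifs <;> linarith

/-- The rounded distance `D` and the distance `d` of two vertices with the remainders `ρ`, `ρ'`
are both large or close to each other. -/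
def RoundsTo (B : ℕ) (b : ℝ) (D : ℕ) (d ρ ρ' : ℝ) : Prop :=
  (B + 2 < D ∧ b < d) ∨
    -- Here `s` is the remainder at the vertex where the paths from the two vertices to the root
    -- meet: along each branch the edge identities telescope to the difference of its end
    -- remainders. The last clause covers `b = 0`, where the identity says nothing about `D`.
    ∃ s, 0 ≤ s ∧ s ≤ b ∧ b * D + ρ + ρ' = 2 * s + B * d ∧ (b = 0 → D = 0)

theorem RoundsTo.symm {B : ℕ} {b : ℝ} {D : ℕ} {d ρ ρ' : ℝ} (h : RoundsTo B b D d ρ ρ') :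
    RoundsTo B b D d ρ' ρ := by
  rcases h with h | ⟨s, h1, h2, h3, h4⟩
  · exact Or.inl h
  · exact Or.inr ⟨s, h1, h2, by linarith, h4⟩

/-- Division gives `ρ + B * l = ρ₁ + q * b`. Adding `q` to `D` and `l` to `d` while replacing `ρ` by
`ρ₁` therefore preserves the identity, with the same `s`. A capped quotient puts the new pair into
the first alternative, which persists because lengths are nonnegative. -/
theorem RoundsTo.step {B : ℕ} {b l : ℝ} {D : ℕ} {d ρ ρ' : ℝ} (h : RoundsTo B b D d ρ ρ')
    (hB : 0 < B) (hb : 0 ≤ b) (hl : 0 ≤ l) (hd : 0 ≤ d) (hρ : 0 ≤ ρ) (hρb : ρ ≤ b) :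
    RoundsTo B b ((roundLen B b (ρ + mulNat B l)).2 + D) (l + d)
      (if decide ((roundLen B b (ρ + mulNat B l)).2 < B + 3) = true
        then (roundLen B b (ρ + mulNat B l)).1 else 0) ρ' := by
  have hBr : (0 : ℝ) < B := by exact_mod_cast hB
  rw [mulNat_eq]
  obtain ⟨h1, h2, h3, h4⟩ := roundLen_spec B hb (x := ρ + B * l) (by positivity)
  generalize roundLen B b (ρ + B * l) = s at h1 h2 h3 h4
  rcases h with ⟨h5, h6⟩ | ⟨a, h5, h6, h7, h8⟩
  · exact Or.inl ⟨by omega, by linarith⟩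
  · by_cases hs : s.2 < B + 3
    · rw [if_pos (by simpa using hs)]
      refine Or.inr ⟨a, h5, h6, ?_, fun h0 => by rw [(h3 hs).2 h0, h8 h0]⟩
      push_cast
      linarith
    · obtain ⟨h9, h10⟩ := h4 hs
      refine Or.inl ⟨by omega, ?_⟩
      -- The cap gives `(B + 2) * b < ρ + B * l`, and `ρ ≤ b`.
      have : (B : ℝ) * b < B * l := by linarith
      have := lt_of_mul_lt_mul_left this hBr.le
      linarith

theorem round_spec {B : ℕ} (hB : 0 < B) {b : ℝ} (hb : 0 ≤ b) (t : List (ℕ × ℕ × ℝ))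
    (hw : WellOrdered t) (hl : ∀ e ∈ t, 0 ≤ e.2.2) :
    (∀ x, IsVert t x → 0 ≤ lookupD (roundEdges B b t).2 x 0 ∧
      lookupD (roundEdges B b t).2 x 0 ≤ b) ∧
    ∀ x y, IsVert t x → IsVert t y → RoundsTo B b (treeDist (roundEdges B b t).1 x y)
      (treeDist t x y) (lookupD (roundEdges B b t).2 x 0) (lookupD (roundEdges B b t).2 y 0) := by
  induction t with
  | nil => exact ⟨fun x _ => by simp [lookupD, roundEdges, hb], fun x y _ _ =>
      Or.inr ⟨0, le_rfl, hb, by simp [lookupD, roundEdges, treeDist], fun _ => rfl⟩⟩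
  | cons e t ih =>
    obtain ⟨hp, hc, hw⟩ := hw
    obtain ⟨ih1, ih2⟩ := ih hw fun e he => hl e (by simp [he])
    have hnn := treeDist_nonneg t fun e he => hl e (by simp [he])
    have hl0 : 0 ≤ e.2.2 := hl e (by simp)
    have hne : ∀ {v}, IsVert t v → v ≠ e.2.1 := fun hv he => hc (he ▸ hv)
    rw [roundEdges_cons, roundStep]
    have hρp := ih1 _ hp
    have hlc : ∀ z : ℝ, lookupD ((e.2.1, z) :: (roundEdges B b t).2) e.2.1 0 = z := fun z => by
      rw [lookupD_cons, if_pos rfl]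
      exact lookupD_of_not_mem _ _ _ fun q hq =>
        hne (isVert_of_mem_roundEdges B b t q hq)
    have hlv : ∀ (z : ℝ) v, IsVert t v → lookupD ((e.2.1, z) :: (roundEdges B b t).2) v 0
        = lookupD (roundEdges B b t).2 v 0 := fun z v hv => by
      rw [lookupD_cons, if_neg (Ne.symm (hne hv))]
    have hrc : 0 ≤ (if decide ((roundLen B b (lookupD (roundEdges B b t).2 e.1 0 +
        mulNat B e.2.2)).2 < B + 3) = true then (roundLen B b (lookupD (roundEdges B b t).2 e.1 0 +
        mulNat B e.2.2)).1 else 0) ∧ (if decide ((roundLen B b (lookupD (roundEdges B b t).2 e.1 0 +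
        mulNat B e.2.2)).2 < B + 3) = true then (roundLen B b (lookupD (roundEdges B b t).2 e.1 0 +
        mulNat B e.2.2)).1 else 0) ≤ b := by
      have h0 : 0 ≤ lookupD (roundEdges B b t).2 e.1 0 + mulNat B e.2.2 := by
        rw [mulNat_eq]
        have := hρp.1
        positivity
      obtain ⟨-, h2, h3, -⟩ := roundLen_spec B hb h0
      split_ifs with hs
      · exact ⟨h2, (h3 (by simpa using hs)).1⟩
      · exact ⟨le_rfl, hb⟩
    constructor
    · intro x hx
      rcases (isVert_cons t).1 hx with rfl | hx
      · simp only [hlc]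
        exact hrc
      · simp only [hlv _ x hx]
        exact ih1 x hx
    · intro x y hx hy
      rcases (isVert_cons t).1 hx with rfl | hx <;> rcases (isVert_cons t).1 hy with rfl | hy
      · simp only [hlc, treeDist, if_true]
        -- For equal vertices the branching vertex is the vertex itself, so `s` is its remainder.
        exact Or.inr ⟨_, hrc.1, hrc.2, by push_cast; ring, fun _ => rfl⟩
      · simp only [hlc, hlv _ y hy, treeDist, if_true, if_neg (hne hy)]
        exact (ih2 _ _ hp hy).step hB hb hl0 (hnn _ _) hρp.1 hρp.2
      · simp only [hlc, hlv _ x hx, treeDist, if_true, if_neg (hne hx)]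
        have := (ih2 _ _ hx hp).symm.step hB hb hl0 (hnn _ _) hρp.1 hρp.2
        exact this.symm
      · simp only [hlv _ x hx, hlv _ y hy, treeDist, if_neg (hne hx), if_neg (hne hy)]
        exact ih2 x y hx hy

/-- Dropping the end remainders gives `b * D ≤ 2 * s + B * d ≤ (B + 2) * b`. For `b = 0` one cannot
divide, and the separate clause for this case applies. -/
theorem RoundsTo.le_of_le {B : ℕ} {b : ℝ} {D : ℕ} {d ρ ρ' : ℝ} (h : RoundsTo B b D d ρ ρ')
    (hb : 0 ≤ b) (hρ : 0 ≤ ρ) (hρ' : 0 ≤ ρ') (hd : d ≤ b) : D ≤ B + 2 := by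
  rcases h with h | ⟨s, h1, h2, h3, h4⟩
  · linarith [h.2]
  · rcases hb.eq_or_lt with h0 | h0
    · rw [h4 h0.symm]; omega
    · have hBr : (0 : ℝ) ≤ B := Nat.cast_nonneg B
      have : b * D ≤ b * (B + 2) := by nlinarith
      have := le_of_mul_le_mul_left this h0
      exact_mod_cast this

/-- Dropping `s` gives `B * d ≤ b * D + ρ + ρ' ≤ (B + 2) * b + 2 * b`. -/
theorem RoundsTo.dist_le {B : ℕ} {b : ℝ} {D : ℕ} {d ρ ρ' : ℝ} (h : RoundsTo B b D d ρ ρ')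
    (hb : 0 ≤ b) (hρ : ρ ≤ b) (hρ' : ρ' ≤ b) (hD : D ≤ B + 2) : B * d ≤ (B + 4) * b := by
  rcases h with h | ⟨s, h1, h2, h3, h4⟩
  · omega
  · have : (D : ℝ) ≤ B + 2 := by exact_mod_cast hD
    nlinarith

/-! #### The candidates -/

theorem depths_cons (e : ℕ × ℕ × ℝ) (t : List (ℕ × ℕ × ℝ)) :
    depths (e :: t) = (e.2.1, lookupD (depths t) e.1 0 + e.2.2) :: depths t := rfl

theorem isVert_of_mem_depths (t : List (ℕ × ℕ × ℝ)) : ∀ q ∈ depths t, IsVert t q.1 := by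
  induction t with
  | nil => intro q hq; left; simp only [depths, List.foldr_nil, List.mem_singleton] at hq; rw [hq]
  | cons e t ih =>
    intro q hq
    rw [depths_cons] at hq
    rcases List.mem_cons.1 hq with rfl | hq
    · exact (isVert_cons t).2 (Or.inl rfl)
    · exact (isVert_cons t).2 (Or.inr (ih q hq))

/-- The vertex `a` is the branching vertex. A new leaf inherits the one of its parent, since its
depth and its distance to every old vertex both grow by the length of the edge. -/
theorem depths_spec (t : List (ℕ × ℕ × ℝ)) (hw : WellOrdered t) :
    (∀ x, IsVert t x → (x, lookupD (depths t) x 0) ∈ depths t) ∧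
    ∀ x y, IsVert t x → IsVert t y → ∃ a, IsVert t a ∧ treeDist t x y =
      lookupD (depths t) x 0 + lookupD (depths t) y 0 - lookupD (depths t) a 0
        - lookupD (depths t) a 0 := by
  induction t with
  | nil =>
    have h : ∀ x, IsVert ([] : List (ℕ × ℕ × ℝ)) x → x = 0 := fun x hx => by
      simpa [IsVert] using hx
    refine ⟨fun x hx => ?_, fun x y hx hy => ⟨0, Or.inl rfl, ?_⟩⟩
    · rw [h x hx]; simp [depths, lookupD]
    · rw [h x hx, h y hy]; simp [treeDist]
  | cons e t ih =>
    obtain ⟨hp, hc, hw⟩ := hw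
    obtain ⟨ih1, ih2⟩ := ih hw
    have hne : ∀ {v}, IsVert t v → v ≠ e.2.1 := fun hv he => hc (he ▸ hv)
    have hV : ∀ {v}, IsVert t v → IsVert (e :: t) v := fun h => (isVert_cons t).2 (Or.inr h)
    have hlc : lookupD (depths (e :: t)) e.2.1 0 = lookupD (depths t) e.1 0 + e.2.2 := by
      rw [depths_cons, lookupD_cons, if_pos rfl]
      exact lookupD_of_not_mem _ _ _ fun q hq => hne (isVert_of_mem_depths t q hq)
    have hlv : ∀ v, IsVert t v → lookupD (depths (e :: t)) v 0
        = lookupD (depths t) v 0 := fun v hv => by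
      rw [depths_cons, lookupD_cons, if_neg (Ne.symm (hne hv))]
    constructor
    · intro x hx
      rcases (isVert_cons t).1 hx with rfl | hx
      · rw [hlc, depths_cons]; exact List.mem_cons_self
      · rw [hlv x hx, depths_cons]; exact List.mem_cons_of_mem _ (ih1 x hx)
    · intro x y hx hy
      rcases (isVert_cons t).1 hx with rfl | hx' <;> rcases (isVert_cons t).1 hy with rfl | hy'
      -- For two equal ends `a` is the vertex itself.
      · exact ⟨_, hx, by simp [treeDist]⟩
      · obtain ⟨a, ha, h⟩ := ih2 _ _ hp hy'
        refine ⟨a, hV ha, ?_⟩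
        rw [hlc, hlv y hy', hlv a ha]
        simp only [treeDist, if_true, if_neg (hne hy'), h]
        ring
      · obtain ⟨a, ha, h⟩ := ih2 _ _ hx' hp
        refine ⟨a, hV ha, ?_⟩
        rw [hlc, hlv x hx', hlv a ha]
        simp only [treeDist, if_true, if_neg (hne hx'), h]
        ring
      · obtain ⟨a, ha, h⟩ := ih2 _ _ hx' hy'
        refine ⟨a, hV ha, ?_⟩
        rw [hlv x hx', hlv y hy', hlv a ha]
        simp only [treeDist, if_neg (hne hx'), if_neg (hne hy'), h]

theorem treeDist_mem_candidates (t : List (ℕ × ℕ × ℝ)) (hw : WellOrdered t)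
    (hl : ∀ e ∈ t, 0 ≤ e.2.2) {x y : ℕ} (hx : IsVert t x) (hy : IsVert t y) :
    treeDist t x y ∈ candidates (depths t) := by
  obtain ⟨h1, h2⟩ := depths_spec t hw
  obtain ⟨a, ha, h⟩ := h2 x y hx hy
  simp only [candidates, List.mem_filter, List.mem_flatMap, List.mem_map, decide_eq_true_eq]
  exact ⟨⟨_, h1 x hx, _, h1 y hy, _, h1 a ha, h.symm⟩, treeDist_nonneg t hl x y⟩

theorem nonneg_of_mem_candidates {D : List (ℕ × ℝ)} {b : ℝ} (h : b ∈ candidates D) : 0 ≤ b := by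
  simpa using (List.mem_filter.1 h).2

/-! ### The given tree as a list -/

theorem visited_eq_true {out : List (ℕ × ℕ × ℝ)} {v : ℕ} :
    visited out v = true ↔ IsVert out v := by
  simp [visited, IsVert]

open Classical in
theorem growStep_eq (out : List (ℕ × ℕ × ℝ)) (e : ℕ × ℕ × ℝ) :
    growStep out e = if IsVert out e.1 ∧ ¬ IsVert out e.2.1 then e :: out
      else if IsVert out e.2.1 ∧ ¬ IsVert out e.1 then (e.2.1, e.1, e.2.2) :: out else out := by
  have h : ∀ v w, (visited out v && !visited out w) = true ↔ IsVert out v ∧ ¬ IsVert out w := by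
    intro v w
    rw [Bool.and_eq_true, ← visited_eq_true, ← visited_eq_true, Bool.not_eq_true,
      Bool.not_eq_true']
  unfold growStep
  exact if_congr (h _ _) rfl (if_congr (h _ _) rfl rfl)

theorem IsVert.growStep {out : List (ℕ × ℕ × ℝ)} {v : ℕ} (h : IsVert out v) (e : ℕ × ℕ × ℝ) :
    IsVert (growStep out e) v := by
  rw [growStep_eq]
  split
  · exact (isVert_cons out).2 (Or.inr h)
  split
  · exact (isVert_cons out).2 (Or.inr h)
  · exact h

theorem isVert_growStep_ends {out : List (ℕ × ℕ × ℝ)} {e : ℕ × ℕ × ℝ}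
    (h : IsVert out e.1 ∨ IsVert out e.2.1) :
    IsVert (growStep out e) e.1 ∧ IsVert (growStep out e) e.2.1 := by
  rw [growStep_eq]
  by_cases h1 : IsVert out e.1 <;> by_cases h2 : IsVert out e.2.1 <;>
    simp_all [isVert_cons]

theorem IsVert.foldl_growStep {out : List (ℕ × ℕ × ℝ)} {v : ℕ} (h : IsVert out v)
    (edges : List (ℕ × ℕ × ℝ)) : IsVert (edges.foldl _root_.growStep out) v := by
  induction edges generalizing out with
  | nil => exact h
  | cons e edges ih => exact ih (h.growStep e)

theorem isVert_foldl_growStep_ends {edges : List (ℕ × ℕ × ℝ)} {out : List (ℕ × ℕ × ℝ)}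
    {e : ℕ × ℕ × ℝ} (he : e ∈ edges) (h : IsVert out e.1 ∨ IsVert out e.2.1) :
    IsVert (edges.foldl growStep out) e.1 ∧ IsVert (edges.foldl growStep out) e.2.1 := by
  induction edges generalizing out with
  | nil => cases he
  | cons e' edges ih =>
    rcases List.mem_cons.1 he with rfl | he
    · have := isVert_growStep_ends h
      exact ⟨this.1.foldl_growStep _, this.2.foldl_growStep _⟩
    · exact ih he (h.imp (·.growStep e') (·.growStep e'))

/-- An edge may be added in either orientation, so `Q` is required for both. -/
theorem growStep_spec {Q : ℕ × ℕ × ℝ → Prop} {out : List (ℕ × ℕ × ℝ)} {e : ℕ × ℕ × ℝ}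
    (hw : WellOrdered out) (hQ : ∀ q ∈ out, Q q) (h1 : Q e) (h2 : Q (e.2.1, e.1, e.2.2)) :
    WellOrdered (growStep out e) ∧ ∀ q ∈ growStep out e, Q q := by
  rw [growStep_eq]
  split_ifs with h h'
  · exact ⟨⟨h.1, h.2, hw⟩, by simpa using ⟨h1, fun a b c hq => hQ (a, b, c) hq⟩⟩
  · exact ⟨⟨h'.1, h'.2, hw⟩, by simpa using ⟨h2, fun a b c hq => hQ (a, b, c) hq⟩⟩
  · exact ⟨hw, hQ⟩

theorem grow_spec {Q : ℕ × ℕ × ℝ → Prop} (nv : ℕ) {edges : List (ℕ × ℕ × ℝ)}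
    (h : ∀ e ∈ edges, Q e ∧ Q (e.2.1, e.1, e.2.2)) :
    WellOrdered (grow nv edges) ∧ ∀ q ∈ grow nv edges, Q q := by
  have scan : ∀ (l : List (ℕ × ℕ × ℝ)) (out : List (ℕ × ℕ × ℝ)),
      (∀ e ∈ l, Q e ∧ Q (e.2.1, e.1, e.2.2)) → (WellOrdered out ∧ ∀ q ∈ out, Q q) →
      WellOrdered (l.foldl growStep out) ∧ ∀ q ∈ l.foldl growStep out, Q q := by
    intro l
    induction l with
    | nil => exact fun out _ h => h
    | cons e l ih =>
      intro out hl ho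
      have he := hl e List.mem_cons_self
      exact ih _ (fun e' he' => hl e' (List.mem_cons_of_mem _ he'))
        (growStep_spec ho.1 ho.2 he.1 he.2)
  unfold grow
  induction nv with
  | zero => exact ⟨trivial, by simp⟩
  | succ k ih =>
    rw [List.range_succ, List.foldl_append]
    exact scan _ _ h ih

section

variable {n : ℕ} {G : SimpleGraph (Fin n)} {edges : List (ℕ × ℕ × ℝ)}

/-- Each pass over the edges advances by at least one step: `k` passes reach every vertex with a
walk of length at most `k` to the root. -/
theorem isVert_grow_of_walk
    (hE : ∀ a b, G.Adj a b → ∃ e ∈ edges, (e.1 = a ∧ e.2.1 = b) ∨ (e.1 = b ∧ e.2.1 = a))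
    {z : Fin n} (hz : z.val = 0) (k : ℕ) {v : Fin n} (p : G.Walk v z) (hp : p.length ≤ k) :
    IsVert (grow k edges) v := by
  induction k generalizing v with
  | zero =>
    left
    rw [SimpleGraph.Walk.eq_of_length_eq_zero (Nat.le_zero.1 hp), hz]
  | succ k ih =>
    have hs : grow (k + 1) edges = edges.foldl growStep (grow k edges) := by
      simp only [grow, List.range_succ, List.foldl_append, List.foldl_cons, List.foldl_nil]
    rw [hs]
    cases p with
    | nil => exact Or.inl hz
    | @cons _ w _ h p =>
      have hw := ih p (by simpa using hp)
      obtain ⟨e, he, ⟨h1, h2⟩ | ⟨h1, h2⟩⟩ := hE _ _ h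
      · rw [← h1]
        exact (isVert_foldl_growStep_ends he (Or.inr (h2 ▸ hw))).1
      · rw [← h2]
        exact (isVert_foldl_growStep_ends he (Or.inl (h1 ▸ hw))).2

theorem isVert_grow_of_connected
    (hE : ∀ a b, G.Adj a b → ∃ e ∈ edges, (e.1 = a ∧ e.2.1 = b) ∨ (e.1 = b ∧ e.2.1 = a))
    (hG : G.Connected) (v : Fin n) : IsVert (grow n edges) v := by
  -- A path has fewer than `n` edges, so `n` passes are enough.
  obtain ⟨p, hp⟩ := (hG.preconnected v ⟨0, v.pos⟩).exists_isPath
  exact isVert_grow_of_walk hE rfl n p (by simpa using hp.length_lt.le)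

/-- The paths of a graph that is built up as in the list. -/
theorem exists_path_of_wellOrdered {len : Sym2 (Fin n) → ℝ≥0} {ord : List (ℕ × ℕ × ℝ)}
    (hw : WellOrdered ord)
    (hq : ∀ q ∈ ord, ∃ a b, G.Adj a b ∧ q = (a.val, b.val, (len s(a, b) : ℝ))) (x y : Fin n)
    (hx : IsVert ord x) (hy : IsVert ord y) :
    ∃ p : G.Walk x y, p.IsPath ∧ (∀ v ∈ p.support, IsVert ord v) ∧
      (((p.edges.map len).sum : ℝ≥0) : ℝ) = treeDist ord x y := by
  induction ord generalizing x y with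
  | nil =>
    obtain rfl : x = y := Fin.ext (by
      rw [show x.val = 0 by simpa [IsVert] using hx, show y.val = 0 by simpa [IsVert] using hy])
    exact ⟨.nil, .nil, by simpa using hx, by simp [treeDist]⟩
  | cons e t ih =>
    obtain ⟨hp, hc, hw⟩ := hw
    have ih := ih hw fun q hqt => hq q (List.mem_cons_of_mem _ hqt)
    obtain ⟨a, b, hab, rfl⟩ := hq e List.mem_cons_self
    have key : ∀ y : Fin n, IsVert t y → ∃ p : G.Walk b y, p.IsPath ∧
        (∀ v ∈ p.support, IsVert ((a.val, b.val, (len s(a, b) : ℝ)) :: t) v) ∧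
        (((p.edges.map len).sum : ℝ≥0) : ℝ) = len s(a, b) + treeDist t a y := by
      intro y hy
      obtain ⟨p, h1, h2, h3⟩ := ih a y hp hy
      -- The extended walk is still a path, because `p` stays among the old vertices and `b` is new.
      refine ⟨.cons hab.symm p, h1.cons fun h => hc (h2 _ h), ?_, ?_⟩
      · intro v hv
        rw [SimpleGraph.Walk.support_cons, List.mem_cons] at hv
        rcases hv with rfl | hv
        · exact (isVert_cons t).2 (Or.inl rfl)
        · exact (isVert_cons t).2 (Or.inr (h2 v hv))
      · rw [SimpleGraph.Walk.edges_cons, List.map_cons, List.sum_cons, NNReal.coe_add, h3,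
          Sym2.eq_swap]
    have hne : ∀ {v : Fin n}, IsVert t v → v.val ≠ b.val := fun hv he => hc (he ▸ hv)
    rcases (isVert_cons t).1 hx with hxb | hx' <;> rcases (isVert_cons t).1 hy with hyb | hy'
    · obtain rfl : x = b := Fin.ext hxb
      obtain rfl : y = x := Fin.ext hyb
      exact ⟨.nil, .nil, by simpa using hy, by simp [treeDist]⟩
    · obtain rfl : x = b := Fin.ext hxb
      obtain ⟨p, h1, h2, h3⟩ := key y hy'
      exact ⟨p, h1, h2, by simp only [h3, treeDist, if_true, if_neg (hne hy')]⟩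
    · obtain rfl : y = b := Fin.ext hyb
      obtain ⟨p, h1, h2, h3⟩ := key x hx'
      refine ⟨p.reverse, h1.reverse, fun v hv => h2 v (by simpa using hv), ?_⟩
      simp only [SimpleGraph.Walk.edges_reverse, List.map_reverse, List.sum_reverse, h3, treeDist,
        if_true, if_neg (hne hx'), treeDist_comm t x.val]
    · obtain ⟨p, h1, h2, h3⟩ := ih x y hx' hy'
      exact ⟨p, h1, fun v hv => (isVert_cons t).2 (Or.inr (h2 v hv)), by
        simp only [h3, treeDist, if_neg (hne hx'), if_neg (hne hy')]⟩

end

namespace TreeGathering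

variable {I : TreeGathering} {E : List (Fin I.numVertices × Fin I.numVertices)}

/-- The list of edges in the encoding of an instance. -/
def edgeList (I : TreeGathering) (E : List (Fin I.numVertices × Fin I.numVertices)) :
    List (ℕ × ℕ × ℝ) :=
  E.map fun e => (e.1.val, e.2.val, (I.len s(e.1, e.2) : ℝ))

theorem grow_edgeList (hE : ∀ e, e ∈ E.map (fun e => s(e.1, e.2)) ↔ e ∈ I.tree.edgeSet) :
    WellOrdered (grow I.numVertices (I.edgeList E)) ∧
    (∀ q ∈ grow I.numVertices (I.edgeList E), 0 ≤ q.2.2) ∧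
    (∀ v, IsVert (grow I.numVertices (I.edgeList E)) v ↔ v < I.numVertices) ∧
    ∀ x y : Fin I.numVertices,
      treeDist (grow I.numVertices (I.edgeList E)) x y = (I.dist x y : ℝ) := by
  obtain ⟨h1, h2⟩ := grow_spec (Q := fun q => ∃ a b, I.tree.Adj a b ∧
    q = (a.val, b.val, (I.len s(a, b) : ℝ))) I.numVertices (edges := I.edgeList E) (by
      intro q hq
      obtain ⟨⟨a, b⟩, he, rfl⟩ := List.mem_map.1 hq
      have hab : I.tree.Adj a b := (hE s(a, b)).1 (List.mem_map.2 ⟨_, he, rfl⟩)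
      exact ⟨⟨a, b, hab, rfl⟩, b, a, hab.symm, by simp [Sym2.eq_swap]⟩)
  have h3 : ∀ v : Fin I.numVertices, IsVert (grow I.numVertices (I.edgeList E)) v :=
    isVert_grow_of_connected (G := I.tree) (by
      intro a b hab
      obtain ⟨⟨c, d⟩, he, heq⟩ := List.mem_map.1 ((hE s(a, b)).2 hab)
      refine ⟨_, List.mem_map.2 ⟨_, he, rfl⟩, ?_⟩
      rcases Sym2.eq_iff.1 heq with ⟨h, h'⟩ | ⟨h, h'⟩
      · exact Or.inl ⟨congrArg Fin.val h, congrArg Fin.val h'⟩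
      · exact Or.inr ⟨congrArg Fin.val h, congrArg Fin.val h'⟩) I.isTree.connected
  refine ⟨h1, ?_, fun v => ⟨?_, fun hv => h3 ⟨v, hv⟩⟩, fun x y => ?_⟩
  · intro q hq
    obtain ⟨a, b, -, rfl⟩ := h2 q hq
    exact NNReal.coe_nonneg _
  · rintro (rfl | ⟨q, hq, rfl⟩)
    · exact (I.isTree.connected.nonempty.some).pos
    · obtain ⟨a, b, -, rfl⟩ := h2 q hq
      exact b.isLt
  · obtain ⟨p, hp, -, h4⟩ := exists_path_of_wellOrdered h1 h2 x y (h3 x) (h3 y)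
    rw [← h4, dist]
    congr 3
    -- The path built along the list is the chosen one by the uniqueness of paths in a tree.
    exact congrArg _ ((I.isTree.existsUnique_path x y).unique hp
      (I.isTree.existsUnique_path x y).exists.choose_spec)

theorem length_edgeList_le (hE : (E.map fun e => s(e.1, e.2)).Nodup) :
    (I.edgeList E).length ≤ I.numVertices * I.numVertices := by
  have := hE.of_map.length_le_card
  simpa [edgeList] using this

end TreeGathering

/-! ### Complete partial solutions -/

/-- The facility to which `w` assigns the user `u`. -/
def Wit.target (w : Wit) (u : ℕ) : Option ℕ :=
  w.asg.foldl (fun o q => if decide (q.1 = u) = true then some q.2 else o) none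

/-- The fold returns the last entry with key `u`; as keys are distinct, it is the only one. -/
theorem foldl_find_eq_some (u f : ℕ) (l : List (ℕ × ℕ)) (h : (l.map Prod.fst).Nodup)
    (o : Option ℕ) :
    l.foldl (fun o q => if decide (q.1 = u) = true then some q.2 else o) o = some f ↔
      (u, f) ∈ l ∨ (u ∉ l.map Prod.fst ∧ o = some f) := by
  induction l generalizing o with
  | nil => simp
  | cons q l ih =>
    obtain ⟨a, b⟩ := q
    rw [List.map_cons, List.nodup_cons] at h
    rw [List.foldl_cons, ih h.2]
    by_cases ha : a = u
    · subst ha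
      have : (a, f) ∉ l := fun hm => h.1 (List.mem_map.2 ⟨_, hm, rfl⟩)
      simp only [decide_true, if_true, Option.some.injEq, List.mem_cons, Prod.mk.injEq, true_and,
        this, or_false, List.map_cons, true_or, not_true, false_and, false_or]
      exact ⟨fun h' => h'.2.symm, fun h' => ⟨h.1, h'.symm⟩⟩
    · have ha' : u ≠ a := Ne.symm ha
      simp [ha, ha']

/-- `w` is a solution for the users `0, …, n - 1` and the facilities `0, …, m - 1`. -/
structure Wit.Solves (δ : ℕ → ℕ → ℕ) (R r n m : ℕ) (w : Wit) : Prop where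
  users : ((w.ign ++ w.asg.map Prod.fst : List ℕ) : Multiset ℕ) = (Finset.range n).val
  opened : (w.opened : Multiset ℕ) ≤ (Finset.range m).val
  full : ∀ f ∈ w.opened, r ≤ (w.asg.map Prod.snd).count f
  asg : ∀ x ∈ w.asg, x.2 ∈ w.opened ∧ δ x.1 x.2 ≤ R

theorem Wit.Sound.solves {δ : ℕ → ℕ → ℕ} {R r n m : ℕ} {α β : ℕ → ℕ} {w : Wit}
    (h : w.Sound δ R r α β (Finset.range n) (Finset.range m)) (hu : w.pu = []) (hf : w.pf = []) :
    w.Solves δ R r n m where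
  users := by simpa [hu] using h.users
  opened := h.opened
  full f hfo := by simpa [hf] using h.full f hfo
  asg := h.asg

namespace Wit.Solves

variable {δ : ℕ → ℕ → ℕ} {R r n m : ℕ} {w : Wit} (h : w.Solves δ R r n m)

include h

theorem nodup : (w.ign ++ w.asg.map Prod.fst).Nodup :=
  Multiset.coe_nodup.1 (h.users ▸ (Finset.range n).nodup)

theorem nodup_opened : w.opened.Nodup :=
  Multiset.coe_nodup.1 (Multiset.nodup_of_le h.opened (Finset.range m).nodup)

theorem lt_of_mem_opened {f : ℕ} (hf : f ∈ w.opened) : f < m :=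
  Finset.mem_range.1 (Multiset.mem_of_le h.opened hf)

theorem mem_users {u : ℕ} : u ∈ w.ign ∨ u ∈ w.asg.map Prod.fst ↔ u < n := by
  rw [← List.mem_append, ← Multiset.mem_coe, h.users, Finset.mem_val, Finset.mem_range]

theorem target_eq_some {u f : ℕ} : w.target u = some f ↔ (u, f) ∈ w.asg := by
  unfold target
  rw [foldl_find_eq_some u f w.asg (List.nodup_append.1 h.nodup).2.1]
  simp

theorem target_eq_none {u : ℕ} (hu : u < n) : w.target u = none ↔ u ∈ w.ign := by
  constructor
  · intro hn
    refine (h.mem_users.2 hu).resolve_right fun hm => ?_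
    obtain ⟨q, hq, rfl⟩ := List.mem_map.1 hm
    rw [h.target_eq_some.2 (show (q.1, q.2) ∈ w.asg from hq)] at hn
    cases hn
  · intro hi
    by_contra hn
    obtain ⟨f, hf⟩ := Option.ne_none_iff_exists'.1 hn
    exact (List.nodup_append.1 h.nodup).2.2 u hi u
      (List.mem_map.2 ⟨_, h.target_eq_some.1 hf, rfl⟩) rfl

theorem card_ign : ((Finset.range n).filter fun u => w.target u = none).card = w.ign.length := by
  rw [← List.toFinset_card_of_nodup (List.nodup_append.1 h.nodup).1]
  congr 1
  ext u
  simp only [Finset.mem_filter, Finset.mem_range, List.mem_toFinset]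
  exact ⟨fun hu => (h.target_eq_none hu.1).1 hu.2,
    fun hu => have hn := h.mem_users.1 (Or.inl hu); ⟨hn, (h.target_eq_none hn).2 hu⟩⟩

/-- Each user is assigned at most once, so counting entries with facility `f` counts distinct users.
-/
theorem le_card {f : ℕ} (hf : f ∈ w.opened) :
    r ≤ ((Finset.range n).filter fun u => w.target u = some f).card := by
  refine (h.full f hf).trans ?_
  have h1 : (w.asg.map Prod.snd).count f =
      ((w.asg.filter fun q => q.2 == f).map Prod.fst).length := by
    rw [List.length_map, List.count, List.countP_map, List.countP_eq_length_filter]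
    rfl
  have h2 : ((w.asg.filter fun q => q.2 == f).map Prod.fst).Nodup :=
    (List.filter_sublist.map _).nodup (List.nodup_append.1 h.nodup).2.1
  rw [h1, ← List.toFinset_card_of_nodup h2]
  refine Finset.card_le_card fun u hu => ?_
  simp only [List.mem_toFinset, List.mem_map, List.mem_filter, beq_iff_eq] at hu
  obtain ⟨⟨u', f'⟩, ⟨hq, rfl⟩, rfl⟩ := hu
  exact Finset.mem_filter.2 ⟨Finset.mem_range.2 (h.mem_users.1 (Or.inr
    (List.mem_map.2 ⟨_, hq, rfl⟩))), h.target_eq_some.2 hq⟩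

end Wit.Solves

theorem Fin.card_filter_val (n : ℕ) (P : ℕ → Prop) [DecidablePred P] :
    (Finset.univ.filter fun u : Fin n => P u).card = ((Finset.range n).filter P).card := by
  refine Finset.card_bij (fun u _ => u.val) ?_ (fun _ _ _ _ => Fin.ext) ?_
  · intro u hu
    simpa using hu
  · intro u hu
    simp only [Finset.mem_filter, Finset.mem_range] at hu
    exact ⟨⟨u, hu.1⟩, by simpa using hu.2, rfl⟩

/-- An element of `Fin m` with the given value. -/
def toFin? (m : ℕ) (o : Option ℕ) : Option (Fin m) :=
  o.bind fun f => if hf : f < m then some ⟨f, hf⟩ else none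

theorem toFin?_eq_some {m : ℕ} {o : Option ℕ} {f : Fin m} :
    toFin? m o = some f ↔ o = some f.val := by
  rcases o with _ | a
  · simp [toFin?]
  · simp only [toFin?, Option.bind_some, Option.some.injEq]
    split_ifs with ha
    · simp [Fin.ext_iff]
    · exact ⟨fun h => (by cases h), fun h => absurd f.isLt (h ▸ ha)⟩

theorem toFin?_eq_none {m : ℕ} {o : Option ℕ} (h : ∀ a, o = some a → a < m) :
    toFin? m o = none ↔ o = none := by
  rcases o with _ | a
  · simp [toFin?]
  · simp [toFin?, h a rfl]

theorem optVal_toFin? {m : ℕ} {o : Option ℕ} (h : ∀ a, o = some a → a < m) :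
    optVal (toFin? m o) = enc o := by
  rcases o with _ | a
  · rfl
  · simp only [toFin?, Option.bind_some, dif_pos (h a rfl)]
    rfl

namespace TreeGathering

variable {I : TreeGathering} {w : Wit} {δ : ℕ → ℕ → ℕ} {R : ℕ}

/-- The solution that is described by `w`. -/
def ofWit (I : TreeGathering) (w : Wit) : I.Solution where
  opened := Finset.univ.filter fun f => f.val ∈ w.opened
  assign u := toFin? I.numFacilities (w.target u)

theorem ofWit_assign_eq_some {u : Fin I.numUsers} {f : Fin I.numFacilities} :
    (I.ofWit w).assign u = some f ↔ w.target u = some f.val := toFin?_eq_some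

section

variable (h : w.Solves δ R I.r I.numUsers I.numFacilities)

include h

theorem target_lt (u : ℕ) : ∀ f, w.target u = some f → f < I.numFacilities := fun _ hf =>
  h.lt_of_mem_opened (h.asg _ (h.target_eq_some.1 hf)).1

theorem isGathering_ofWit : (I.ofWit w).IsGathering := by
  constructor
  · intro u f hf
    rw [ofWit_assign_eq_some, h.target_eq_some] at hf
    simpa [ofWit] using (h.asg _ hf).1
  · intro f hf
    simp only [ofWit_assign_eq_some]
    rw [Fin.card_filter_val I.numUsers fun u => w.target u = some f.val]
    exact h.le_card (by simpa [ofWit] using hf)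

theorem numIgnored_ofWit : (I.ofWit w).numIgnored = w.ign.length := by
  rw [← h.card_ign, ← Fin.card_filter_val]
  simp only [Solution.numIgnored, ofWit, toFin?_eq_none (target_lt h _)]

theorem card_opened_ofWit : (I.ofWit w).opened.card = w.opened.length := by
  rw [← List.toFinset_card_of_nodup h.nodup_opened]
  unfold ofWit
  rw [Fin.card_filter_val I.numFacilities fun f => f ∈ w.opened]
  congr 1
  ext f
  simp only [Finset.mem_filter, Finset.mem_range, List.mem_toFinset]
  exact ⟨fun hf => hf.2, fun hf => ⟨h.lt_of_mem_opened hf, hf⟩⟩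

theorem encodeSol_ofWit :
    I.encodeSol (I.ofWit w) = enc (output I.numUsers I.numFacilities w) := by
  refine Prod.ext ?_ ?_
  · refine List.ext_getElem (by simp [encodeSol, output, enc]) fun i h1 h2 => ?_
    simp only [encodeSol, output, enc, List.getElem_ofFn, List.getElem_map, List.getElem_range]
    rw [boolVal_eq_enc]
    congr 1
    rw [Bool.eq_iff_iff]
    simp [ofWit]
  · refine List.ext_getElem (by simp [encodeSol, output, enc]) fun i h1 h2 => ?_
    simp only [encodeSol, output, enc, List.getElem_ofFn, List.getElem_map, List.getElem_range]
    exact optVal_toFin? (target_lt h i)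

theorem cost_ofWit_le {C : ℝ} (hC : 0 ≤ C)
    (hδ : ∀ u f, δ u.val f.val ≤ R → (I.dist (I.userAt u) (I.facilityAt f) : ℝ) ≤ C) :
    ((I.ofWit w).cost : ℝ) ≤ C := by
  have : (I.ofWit w).cost ≤ ⟨C, hC⟩ := by
    refine Finset.sup_le fun u _ => ?_
    split
    · exact bot_le
    · next f hf =>
      rw [ofWit_assign_eq_some, h.target_eq_some] at hf
      exact NNReal.coe_le_coe.1 (hδ u f (h.asg _ hf).2)
  exact NNReal.coe_le_coe.2 this

end

/-- This puts the cost of every solution among the candidates; `0` is the distance of a vertex to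
itself. -/
theorem cost_eq (s : I.Solution) : s.cost = 0 ∨
    ∃ u f, s.cost = I.dist (I.userAt u) (I.facilityAt f) := by
  rcases isEmpty_or_nonempty (Fin I.numUsers) with hn | hn
  · left
    simp [Solution.cost, Finset.univ_eq_empty]
  · obtain ⟨u, -, hu⟩ := Finset.exists_mem_eq_sup Finset.univ Finset.univ_nonempty fun u =>
      match s.assign u with
      | none => 0
      | some f => I.dist (I.userAt u) (I.facilityAt f)
    change s.cost = _ at hu
    rw [hu]
    split
    · exact Or.inl rfl
    · next f _ => exact Or.inr ⟨u, f, rfl⟩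

theorem dist_le_cost {s : I.Solution} {u : Fin I.numUsers} {f : Fin I.numFacilities}
    (h : s.assign u = some f) : I.dist (I.userAt u) (I.facilityAt f) ≤ s.cost := by
  have := Finset.le_sup (f := fun u => match s.assign u with
      | none => 0
      | some f => I.dist (I.userAt u) (I.facilityAt f)) (Finset.mem_univ u)
  simp only [h] at this
  exact this

/-- The assignment of a solution as a function on natural numbers. -/
def Solution.tgt (s : I.Solution) (u : ℕ) : Option ℕ :=
  if hu : u < I.numUsers then (s.assign ⟨u, hu⟩).map Fin.val else none

theorem Solution.tgt_val (s : I.Solution) (u : Fin I.numUsers) :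
    s.tgt u = (s.assign u).map Fin.val := dif_pos u.isLt

theorem Solution.isTarget {s : I.Solution} (hs : s.IsGathering)
    (hδ : ∀ u f, s.assign u = some f → δ u.val f.val ≤ R) :
    IsTarget δ R I.r I.numUsers I.numFacilities s.tgt (s.opened.map Fin.valEmbedding) where
  assigned := by
    intro u hu f hf
    lift u to Fin I.numUsers using hu
    rw [tgt_val, Option.map_eq_some_iff] at hf
    obtain ⟨f, hf, rfl⟩ := hf
    exact ⟨Finset.mem_map_of_mem _ (hs.1 u f hf), hδ u f hf⟩
  subset := by
    intro f hf
    obtain ⟨f, -, rfl⟩ := Finset.mem_map.1 hf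
    exact Finset.mem_range.2 f.isLt
  full := by
    intro f hf
    obtain ⟨f, hf', rfl⟩ := Finset.mem_map.1 hf
    refine (hs.2 f hf').trans ?_
    rw [← Fin.card_filter_val]
    refine Finset.card_le_card fun u hu => ?_
    simp only [Finset.mem_filter, Finset.mem_univ, true_and] at hu ⊢
    rw [tgt_val, hu]
    rfl

theorem Solution.targetProfile_eq {s : I.Solution} (hs : s.IsGathering) (α β : ℕ → ℕ) :
    targetProfile s.tgt (s.opened.map Fin.valEmbedding) I.numUsers α β (Finset.range I.numUsers)
      (Finset.range I.numFacilities) = (s.opened.card, s.numIgnored, 0, 0) := by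
  -- Only the combinatorial part is needed, so the zero distance serves.
  have ht := isTarget (δ := fun _ _ => 0) (R := 0) hs fun _ _ _ => le_rfl
  refine Prod.ext ?_ (Prod.ext ?_ (Prod.ext ?_ ?_)) <;> simp only [targetProfile]
  · rw [Finset.inter_eq_right.2 ht.subset, Finset.card_map]
  · rw [← Fin.card_filter_val, numIgnored]
    congr 1
    ext u
    simp [tgt_val]
  · rw [leaving, Finset.filter_eq_empty_iff.2]
    · rfl
    · rintro u hu ⟨f, hf, hm⟩
      exact hm (ht.subset (ht.assigned u (Finset.mem_range.1 hu) f hf).1)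
  · rw [arriving, Finset.filter_eq_empty_iff.2]
    · rfl
    · rintro u hu ⟨hm, -⟩
      exact hm hu

end TreeGathering

/-! ### Correctness of the scheme -/

theorem foldl_if_some {α : Type} (c : α → Bool) (l : List α) (o : Option α) :
    l.foldl (fun o w => if c w = true then some w else o) o = o ∧ (∀ w ∈ l, ¬ c w = true) ∨
    ∃ w ∈ l, c w = true ∧ l.foldl (fun o w => if c w = true then some w else o) o = some w := by
  induction l generalizing o with
  | nil => exact Or.inl ⟨rfl, by simp⟩
  | cons a l ih =>
    rw [List.foldl_cons]
    rcases ih (if c a = true then some a else o) with ⟨h1, h2⟩ | ⟨w, h1, h2, h3⟩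
    · by_cases ha : c a = true
      · exact Or.inr ⟨a, by simp, ha, by rw [h1, if_pos ha]⟩
      · exact Or.inl ⟨by rw [h1, if_neg ha], by simpa [ha] using h2⟩
    · exact Or.inr ⟨w, List.mem_cons_of_mem _ h1, h2, h3⟩

theorem pick_spec (A : List (ℕ × ℕ)) (T : List Wit) :
    (pick A T = none ∧ ∀ w ∈ T, w.pu = [] → w.pf = [] →
      (w.opened.length, w.ign.length) ∉ A) ∨
    ∃ w ∈ T, w.pu = [] ∧ w.pf = [] ∧ (w.opened.length, w.ign.length) ∈ A ∧ pick A T = some w := by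
  have hc : ∀ w : Wit, (decide (w.pu.length = 0) && (decide (w.pf.length = 0) &&
      A.any fun q => decide (q = (w.opened.length, w.ign.length)))) = true ↔
      w.pu = [] ∧ w.pf = [] ∧ (w.opened.length, w.ign.length) ∈ A := by
    intro w
    simp
  rcases foldl_if_some (fun w : Wit => decide (w.pu.length = 0) && (decide (w.pf.length = 0) &&
    A.any fun q => decide (q = (w.opened.length, w.ign.length)))) T none with
    ⟨h1, h2⟩ | ⟨w, h1, h2, h3⟩
  · exact Or.inl ⟨h1, fun w hw hu hf hA => h2 w hw ((hc w).2 ⟨hu, hf, hA⟩)⟩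
  · obtain ⟨hu, hf, hA⟩ := (hc w).1 h2
    exact Or.inr ⟨w, h1, hu, hf, hA, h3⟩

/-- Minimality of the selected candidate is what yields the ratio; induction from the end matches
the left fold. -/
theorem bestOf_spec (l : List ℝ) (S : ℝ → Option Wit) :
    (bestOf l S = none ∧ ∀ b ∈ l, S b = none) ∨
    ∃ b ∈ l, ∃ w, S b = some w ∧ bestOf l S = some (b, w) ∧
      ∀ b' ∈ l, S b' ≠ none → b ≤ b' := by
  induction l using List.reverseRecOn with
  | nil => exact Or.inl ⟨rfl, by simp⟩
  | append_singleton l b ih =>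
    have hs : bestOf (l ++ [b]) S = (S b).elim (bestOf l S) (improve (bestOf l S) b) := by
      simp only [bestOf, List.foldl_append, List.foldl_cons, List.foldl_nil]
    rw [hs]
    rcases hb : S b with _ | w
    · rcases ih with ⟨h1, h2⟩ | ⟨b', h1, w', h2, h3, h4⟩
      · exact Or.inl ⟨h1, fun b' hb' => (List.mem_append.1 hb').elim (h2 b') fun h => by
          rw [List.mem_singleton.1 h, hb]⟩
      · refine Or.inr ⟨b', List.mem_append_left _ h1, w', h2, h3, fun b'' hb'' hn => ?_⟩
        rcases List.mem_append.1 hb'' with h | h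
        · exact h4 b'' h hn
        · rw [List.mem_singleton.1 h] at hn
          exact absurd hb hn
    · right
      rcases ih with ⟨h1, h2⟩ | ⟨b', h1, w', h2, h3, h4⟩
      · refine ⟨b, by simp, w, hb, by rw [h1]; rfl, fun b'' hb'' hn => ?_⟩
        rcases List.mem_append.1 hb'' with h | h
        · exact absurd (h2 b'' h) hn
        · exact (List.mem_singleton.1 h).ge
      · by_cases hlt : b < b'
        · refine ⟨b, by simp, w, hb, by simp [h3, improve, hlt], fun b'' hb'' hn => ?_⟩
          rcases List.mem_append.1 hb'' with h | h
          · exact hlt.le.trans (h4 b'' h hn)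
          · exact (List.mem_singleton.1 h).ge
        · refine ⟨b', List.mem_append_left _ h1, w', h2, by simp [h3, improve, hlt],
            fun b'' hb'' hn => ?_⟩
          rcases List.mem_append.1 hb'' with h | h
          · exact h4 b'' h hn
          · exact (not_lt.1 hlt).trans (List.mem_singleton.1 h).ge

namespace TreeGathering

variable {I : TreeGathering} {E : List (Fin I.numVertices × Fin I.numVertices)}

/-- The list of the positions of the users. -/
def userList (I : TreeGathering) : List ℕ := List.ofFn fun u => (I.userAt u).val

/-- The list of the positions of the facilities. -/
def facList (I : TreeGathering) : List ℕ := List.ofFn fun f => (I.facilityAt f).val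

theorem length_userList : I.userList.length = I.numUsers := List.length_ofFn

theorem length_facList : I.facList.length = I.numFacilities := List.length_ofFn

theorem getD_userList (u : Fin I.numUsers) : I.userList.getD u 0 = I.userAt u := by
  simp [userList]

theorem getD_facList (f : Fin I.numFacilities) : I.facList.getD f 0 = I.facilityAt f := by
  simp [facList]

/-- The rounded distances of users and facilities. -/
noncomputable def roundedDist (I : TreeGathering)
    (E : List (Fin I.numVertices × Fin I.numVertices)) (B : ℕ) (b : ℝ) (u f : ℕ) : ℕ :=
  treeDist (roundEdges B b (grow I.numVertices (I.edgeList E))).1 (I.userList.getD u 0)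
    (I.facList.getD f 0)

/-- A solution for the instance whose cost is at most `b` up to rounding. -/
noncomputable def solve (I : TreeGathering) (E : List (Fin I.numVertices × Fin I.numVertices))
    (B : ℕ) (A : List (ℕ × ℕ)) (b : ℝ) : Option Wit :=
  solveFor B I.r I.numVertices I.userList I.facList A (grow I.numVertices (I.edgeList E)) b

variable (hE : ∀ e, e ∈ E.map (fun e => s(e.1, e.2)) ↔ e ∈ I.tree.edgeSet)
  {B : ℕ} {A : List (ℕ × ℕ)} {b : ℝ}

include hE

theorem roundsTo (hB : 0 < B) (hb : 0 ≤ b) (u : Fin I.numUsers) (f : Fin I.numFacilities) :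
    ∃ ρ ρ', 0 ≤ ρ ∧ ρ ≤ b ∧ 0 ≤ ρ' ∧ ρ' ≤ b ∧ RoundsTo B b (I.roundedDist E B b u f)
      (I.dist (I.userAt u) (I.facilityAt f)) ρ ρ' := by
  obtain ⟨h1, h2, h3, h4⟩ := grow_edgeList hE
  obtain ⟨h5, h6⟩ := round_spec hB hb _ h1 h2
  have hx := (h3 _).2 (I.userAt u).isLt
  have hy := (h3 _).2 (I.facilityAt f).isLt
  refine ⟨_, _, (h5 _ hx).1, (h5 _ hx).2, (h5 _ hy).1, (h5 _ hy).2, ?_⟩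
  rw [← h4, roundedDist, getD_userList, getD_facList]
  exact h6 _ _ hx hy

theorem roundedDist_le (hB : 0 < B) (hb : 0 ≤ b) {u : Fin I.numUsers} {f : Fin I.numFacilities}
    (h : (I.dist (I.userAt u) (I.facilityAt f) : ℝ) ≤ b) : I.roundedDist E B b u f ≤ B + 2 := by
  obtain ⟨ρ, ρ', h1, -, h2, -, h3⟩ := roundsTo hE hB hb u f
  exact h3.le_of_le hb h1 h2 h

theorem dist_le_of_roundedDist_le {ε : ℝ} (hB : 0 < B) (hBε : 4 ≤ B * ε) (hb : 0 ≤ b)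
    {u : Fin I.numUsers} {f : Fin I.numFacilities} (h : I.roundedDist E B b u f ≤ B + 2) :
    (I.dist (I.userAt u) (I.facilityAt f) : ℝ) ≤ (1 + ε) * b := by
  obtain ⟨ρ, ρ', -, h1, -, h2, h3⟩ := roundsTo hE hB hb u f
  have h4 := h3.dist_le hb h1 h2 h
  have hBr : (0 : ℝ) < B := by exact_mod_cast hB
  refine le_of_mul_le_mul_left (h4.trans ?_) hBr
  nlinarith

theorem rootTable_good_instance (b : ℝ) (tgt : ℕ → Option ℕ) (S : Finset ℕ) :
    ∃ α β, TableGood (I.roundedDist E B b) (B + 2) I.r I.numUsers I.numFacilities tgt S α β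
      (Finset.range I.numUsers) (Finset.range I.numFacilities)
      (rootTable (I.userList.length + I.userList.length + I.facList.length) (B + 2) I.r
        I.numVertices I.userList I.facList
        (roundEdges B b (grow I.numVertices (I.edgeList E))).1) := by
  obtain ⟨h1, h2, h3, h4⟩ := grow_edgeList hE
  have := rootTable_good (r := I.r) (R := B + 2) (tgt := tgt) (S := S) (users := I.userList)
    (facs := I.facList) (nv := I.numVertices) (wellOrdered_roundEdges B b _ h1)
    (fun v => (isVert_roundEdges B b _ v).trans (h3 v))
    (fun u hu => by
      rw [length_userList] at hu
      exact (getD_userList ⟨u, hu⟩).trans_lt (I.userAt _).isLt)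
    (fun f hf => by
      rw [length_facList] at hf
      exact (getD_facList ⟨f, hf⟩).trans_lt (I.facilityAt _).isLt)
  simp only [length_userList, length_facList] at this ⊢
  exact ⟨_, _, this⟩

theorem solve_sound {w : Wit} (h : I.solve E B A b = some w) :
    w.Solves (I.roundedDist E B b) (B + 2) I.r I.numUsers I.numFacilities ∧
      (w.opened.length, w.ign.length) ∈ A := by
  -- Soundness does not depend on the target, so an arbitrary one is supplied.
  obtain ⟨α, β, hg⟩ := rootTable_good_instance hE (B := B) b (fun _ => none) ∅
  rcases pick_spec A (rootTable (I.userList.length + I.userList.length + I.facList.length) (B + 2)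
    I.r I.numVertices I.userList I.facList
    (roundEdges B b (grow I.numVertices (I.edgeList E))).1) with
    ⟨h1, -⟩ | ⟨w', h1, h2, h3, h4, h5⟩
  · rw [solve, solveFor, h1] at h
    cases h
  · rw [solve, solveFor, h5, Option.some.injEq] at h
    subst h
    exact ⟨(hg.1 w' h1).solves h2 h3, h4⟩

/-- A solution of cost at most `b` respects the rounded radius, so it is a target. At the root its
profile has nothing waiting, and the table contains a complete entry with the same pair of numbers,
though possibly another solution. -/
theorem solve_complete (hB : 0 < B) {s : I.Solution} (hs : s.IsGathering)
    (hA : (s.opened.card, s.numIgnored) ∈ A) (hb : (s.cost : ℝ) ≤ b) :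
    I.solve E B A b ≠ none := by
  obtain ⟨α, β, -, hg⟩ := rootTable_good_instance hE (B := B) b s.tgt
    (s.opened.map Fin.valEmbedding)
  have hb0 : 0 ≤ b := (NNReal.coe_nonneg _).trans hb
  obtain ⟨w, hw, hp⟩ := hg (Solution.isTarget hs fun u f huf =>
    roundedDist_le hE hB hb0 ((NNReal.coe_le_coe.2 (dist_le_cost huf)).trans hb))
  rw [Solution.targetProfile_eq hs, Wit.profile] at hp
  simp only [Prod.mk.injEq, Multiset.coe_eq_zero, List.map_eq_nil_iff] at hp
  obtain ⟨h1, h2, h3, h4⟩ := hp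
  rcases pick_spec A (rootTable (I.userList.length + I.userList.length + I.facList.length) (B + 2)
    I.r I.numVertices I.userList I.facList
    (roundEdges B b (grow I.numVertices (I.edgeList E))).1) with
    ⟨-, h5⟩ | ⟨w', -, -, -, -, h5⟩
  · exact absurd (h1 ▸ h2 ▸ hA) (h5 w hw h3 h4)
  · rw [solve, solveFor, h5]
    simp

theorem cost_mem_candidates (s : I.Solution) :
    (s.cost : ℝ) ∈ candidates (depths (grow I.numVertices (I.edgeList E))) := by
  obtain ⟨h1, h2, h3, h4⟩ := grow_edgeList hE
  rcases cost_eq s with h | ⟨u, f, h⟩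
  · rw [h, NNReal.coe_zero, ← treeDist_self (grow I.numVertices (I.edgeList E)) 0]
    exact treeDist_mem_candidates _ h1 h2 (Or.inl rfl) (Or.inl rfl)
  · rw [h, ← h4]
    exact treeDist_mem_candidates _ h1 h2 ((h3 _).2 (Fin.isLt _)) ((h3 _).2 (Fin.isLt _))

/-- The scheme solves the gathering problem whose feasible solutions are those with a number of
open facilities and a number of unassigned users in the list `A`. -/
theorem scheme_correct {ε : ℝ} (hε : 0 < ε) (hB : 0 < B) (hBε : 4 ≤ B * ε) :
    (∃ s : I.Solution, (enc (scheme B I.numVertices (I.edgeList E) I.userList I.facList I.r A) :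
        (Ty.opt outTy).Val) = Sum.inr (I.encodeSol s) ∧
      (s.IsGathering ∧ (s.opened.card, s.numIgnored) ∈ A) ∧
      ∀ s' : I.Solution, s'.IsGathering ∧ (s'.opened.card, s'.numIgnored) ∈ A →
        (s.cost : ℝ) ≤ (1 + ε) * s'.cost) ∨
    ((enc (scheme B I.numVertices (I.edgeList E) I.userList I.facList I.r A) :
        (Ty.opt outTy).Val) = Sum.inl () ∧
      ∀ s : I.Solution, ¬ (s.IsGathering ∧ (s.opened.card, s.numIgnored) ∈ A)) := by
  rcases bestOf_spec (candidates (depths (grow I.numVertices (I.edgeList E)))) (I.solve E B A) with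
    ⟨h1, h2⟩ | ⟨b, h1, w, h2, h3, h4⟩
  · right
    constructor
    · unfold scheme
      change bestOf _ (solveFor _ _ _ _ _ _ _) = none at h1
      rw [h1]
      rfl
    · rintro s ⟨hs, hA⟩
      -- A feasible solution would make the candidate equal to its own cost succeed.
      exact solve_complete hE hB hs hA le_rfl (h2 _ (cost_mem_candidates hE s))
  · left
    obtain ⟨hw, hA⟩ := solve_sound hE h2
    refine ⟨I.ofWit w, ?_, ⟨isGathering_ofWit hw, ?_⟩, ?_⟩
    · unfold scheme
      change bestOf _ (solveFor _ _ _ _ _ _ _) = some (b, w) at h3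
      rw [h3, encodeSol_ofWit hw, length_userList, length_facList]
      rfl
    · rwa [card_opened_ofWit hw, numIgnored_ofWit hw]
    · rintro s' ⟨hs', hA'⟩
      have hb := nonneg_of_mem_candidates h1
      refine (cost_ofWit_le hw (mul_nonneg (by linarith) hb) fun u f huf =>
        dist_le_of_roundedDist_le hE hB hBε hb huf).trans ?_
      -- The cost of `s'` is a successful candidate, so the selected `b` is at most that cost.
      exact mul_le_mul_of_nonneg_left (h4 _ (cost_mem_candidates hE s')
        (solve_complete hE hB hs' hA' le_rfl)) (by linarith)

end TreeGathering

/-! ### The final programs -/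

namespace Calc

variable {ι γ σ : Type} [Code γ] [Code σ] {g : ι → ℕ × ℕ} {e : ι → γ}

/-- Iteration of `F` until the condition `c` fails. -/
theorem iterateWhile {c : σ → Bool} {F : σ → σ} {s : ι → σ} {N : ι → ℕ} (hs : Calc g e s)
    (hc : Calc (fun _ : σ => ((0, 0) : ℕ × ℕ)) id c)
    (hF : Calc (fun _ : σ => ((0, 0) : ℕ × ℕ)) id F) (hN : PB g N)
    (hlt : ∀ i, ∀ j < N i, c (F^[j] (s i)) = true) (heq : ∀ i, c (F^[N i] (s i)) = false) :
    Calc g e (fun i => F^[N i] (s i)) := by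
  obtain ⟨p, a, hp⟩ := hc
  obtain ⟨q, b, hq⟩ := hF
  -- At the constant gauge `(0, 0)` the bounds for test and body are constants, so only the number
  -- of iterations matters.
  set S := gaugeBound a (0, 0)
  set T := gaugeBound b (0, 0)
  refine hs.comp (of_prog (.loop (.comp
    (.branch (.comp .inl (.comp q .fst)) (.comp .inr .fst)) (.pair .ident p)))
    (((hN.add (PB.const 1)).mul (PB.const (S + T + 20)))) fun i => ?_)
  refine (RunsIn.loop (st := fun j => enc (F^[j] (s i))) (N := N i) (T := S + T + 10)
    (fun j hj => ?_) ?_).mono (Nat.mul_le_mul_left _ (by omega))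
  · have h1 := hp (F^[j] (s i))
    rw [hlt i j hj] at h1
    have h2 := (((RunsIn.of_runs (.fst (b := .unit) _ ())).comp (hq (F^[j] (s i)))).comp
      (.of_runs (.inl (b := ty σ) _)))
    rw [← Function.iterate_succ_apply' F j] at h2
    exact (((RunsIn.of_runs (.ident _)).pair h1).comp (.branchInl h2)).mono (by
      show 1 + S + 1 + (1 + T + 1 + 1 + 1 + 1) + 1 ≤ _
      omega)
  · have h1 := hp (F^[N i] (s i))
    rw [heq i] at h1
    have h2 := (RunsIn.of_runs (.fst (b := .unit) (enc (F^[N i] (s i))) ())).comp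
      (.of_runs (.inr (a := ty σ) _))
    exact (((RunsIn.of_runs (.ident _)).pair h1).comp (.branchInr h2)).mono (by
      show 1 + S + 1 + (1 + 1 + 1 + 1) + 1 ≤ _
      omega)

/-- Division is avoided by adding `x` until `4` is reached. The number of additions is the result
itself, which is bounded by the parameter in the application. -/
theorem ceil_four_div {x : ι → ℝ} (hx : Calc g e x) (hpos : ∀ i, 0 < x i)
    (hb : PB g fun i => ⌈4 / x i⌉₊) : Calc g e (fun i => ⌈4 / x i⌉₊) := by
  have hit : ∀ (y : ℝ) (j : ℕ), (fun z : ℝ × ℝ × ℕ => (z.1, z.2.1 + z.1, z.2.2 + 1))^[j] (y, 0, 0)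
      = (y, j * y, j) := by
    intro y j
    induction j with
    | zero => simp
    | succ j ih =>
      rw [Function.iterate_succ_apply', ih]
      simp only [Prod.mk.injEq, and_true, true_and]
      push_cast
      ring
  have h1 : Calc (fun _ : ℝ × ℝ × ℕ => ((0, 0) : ℕ × ℕ)) id fun z => z := self
  have h2 := iterateWhile (c := fun z : ℝ × ℝ × ℕ => decide (z.2.1 < ((4 : ℕ) : ℝ)))
    (F := fun z : ℝ × ℝ × ℕ => (z.1, z.2.1 + z.1, z.2.2 + 1))
    (hx.pair (realZero.pair natZero)) (realLt h1.snd.fst (realNat 4))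
    (h1.fst.pair ((realAdd h1.snd.fst h1.fst).pair (natAdd h1.snd.snd natOne))) hb
    (fun i j hj => by
      rw [hit]
      simpa [lt_div_iff₀ (hpos i)] using Nat.lt_ceil.1 hj)
    (fun i => by
      rw [hit]
      simpa [div_le_iff₀ (hpos i)] using Nat.le_ceil (4 / x i))
  simp only [hit] at h2
  exact h2.snd.snd

end Calc

/-! #### The lists of admissible numbers of open facilities and unassigned users -/

-- The condition `j ≤ η * n` is tested by repeated addition on both sides.
open Classical in
noncomputable def outlierPairs (m n : ℕ) (η : ℝ) : List (ℕ × ℕ) :=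
  (List.range (m + 1)).flatMap fun k => (List.range (n + 1)).flatMap fun j =>
    if decide (mulNat j 1 ≤ mulNat n η) = true then [(k, j)] else []

/-- The range runs to `m`, not to `upper`, because the given bounds may be huge compared with the
size of the instance. -/
def boundedPairs (m lower upper : ℕ) : List (ℕ × ℕ) :=
  (List.range (m + 1)).flatMap fun k =>
    if (decide (lower ≤ k) && decide (k ≤ upper)) = true then [(k, 0)] else []

theorem mem_outlierPairs {m n k j : ℕ} {η : ℝ} (hk : k ≤ m) (hj : j ≤ n) :
    (k, j) ∈ outlierPairs m n η ↔ (j : ℝ) ≤ η * n := by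
  simp only [outlierPairs, mulNat_eq, List.mem_flatMap, List.mem_range, decide_eq_true_eq]
  constructor
  · rintro ⟨k', -, j', -, h⟩
    split_ifs at h with hc
    · simp only [List.mem_singleton, Prod.mk.injEq] at h
      rw [h.2]
      linarith
    · cases h
  · intro h
    refine ⟨k, by omega, j, by omega, ?_⟩
    rw [if_pos (by linarith)]
    simp

theorem mem_boundedPairs {m k j lower upper : ℕ} (hk : k ≤ m) :
    (k, j) ∈ boundedPairs m lower upper ↔ j = 0 ∧ lower ≤ k ∧ k ≤ upper := by
  simp only [boundedPairs, List.mem_flatMap, List.mem_range, Bool.and_eq_true, decide_eq_true_eq]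
  constructor
  · rintro ⟨k', -, h⟩
    split_ifs at h with hc
    · simp only [List.mem_singleton, Prod.mk.injEq] at h
      rw [h.1]
      exact ⟨h.2, hc⟩
    · cases h
  · rintro ⟨rfl, h⟩
    exact ⟨k, by omega, by rw [if_pos h]; simp⟩

namespace Calc

variable {ι γ : Type} [Code γ] {g : ι → ℕ × ℕ} {e : ι → γ}

theorem outlierPairs {m n : ι → ℕ} {η : ι → ℝ} (hm : Calc g e m) (hmb : PB g m) (hn : Calc g e n)
    (hnb : PB g n) (hη : Calc g e η) :
    Calc g e (fun i => outlierPairs (m i) (n i) (η i)) ∧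
      PB g fun i => (_root_.outlierPairs (m i) (n i) (η i)).length := by
  have hm' : PB g fun i => m i + 1 := hmb.add (PB.const 1)
  have hn' : PB g fun i => n i + 1 := hnb.add (PB.const 1)
  have hl1 : ∀ (n k : ℕ) (η : ℝ), ((List.range (n + 1)).flatMap fun j =>
      if decide (_root_.mulNat j 1 ≤ _root_.mulNat n η) = true then [(k, j)] else []).length
      ≤ n + 1 := fun n k η =>
    (List.length_flatMap_le _ _ 1 fun j _ => by split_ifs <;> simp).trans (by simp)
  constructor
  · refine flatMap (F := fun i k => (List.range (n i + 1)).flatMap fun j =>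
      if decide (_root_.mulNat j 1 ≤ _root_.mulNat (n i) (η i)) = true then [(k, j)] else [])
      (range (natAdd hm natOne) hm') (by simpa using hm') hn'
      (fun i k _ => hl1 _ _ _) fun ι' π k _ => ?_
    have hv : Calc (fun j => g (π j)) (fun j => (e (π j), k j)) k := var
    refine flatMap (F := fun i j =>
      if decide (_root_.mulNat j 1 ≤ _root_.mulNat (n (π i)) (η (π i))) = true
        then [(k i, j)] else [])
      (range (natAdd (hn.lift π _) natOne) (hn'.lift π)) (by simpa using hn'.lift π) (PB.const 1)
      (fun i j _ => by split_ifs <;> simp) fun ι'' π' j hj => ?_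
    have hj' : PB (fun i => g (π (π' i))) j := ((hn'.lift π).lift π').of_le fun i =>
      (List.mem_range.1 (hj i)).le
    exact listIte (realLe (mulNat var hj' realOne)
      (mulNat ((hn.lift π _).lift π' _) ((hnb.lift π).lift π') ((hη.lift π _).lift π' _)))
      ((hv.lift π' _).pair var)
  · refine (hm'.mul hn').of_le fun i => ?_
    exact (List.length_flatMap_le _ _ _ fun k _ => hl1 _ _ _).trans (by simp)

theorem boundedPairs {m lower upper : ι → ℕ} (hm : Calc g e m) (hmb : PB g m)
    (hl : Calc g e lower) (hu : Calc g e upper) :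
    Calc g e (fun i => boundedPairs (m i) (lower i) (upper i)) ∧
      PB g fun i => (_root_.boundedPairs (m i) (lower i) (upper i)).length := by
  have hm' : PB g fun i => m i + 1 := hmb.add (PB.const 1)
  constructor
  · exact flatMap (F := fun i k =>
      if (decide (lower i ≤ k) && decide (k ≤ upper i)) = true then [(k, 0)] else [])
      (range (natAdd hm natOne) hm') (by simpa using hm') (PB.const 1)
      (fun i k _ => by split_ifs <;> simp) fun ι' π k _ =>
        listIte (bAnd (natLe (hl.lift π _) var) (natLe var (hu.lift π _))) (var.pair natZero)
  · refine hm'.of_le fun i => ?_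
    exact (List.length_flatMap_le _ _ 1 fun k _ => by split_ifs <;> simp).trans (by simp)

end Calc

/-! #### Encoded instances -/

/-- An instance with a list of its edges and a precision. -/
structure TreeInput where
  I : TreeGathering
  E : List (Fin I.numVertices × Fin I.numVertices)
  nodup : (E.map fun e => s(e.1, e.2)).Nodup
  mem : ∀ e, e ∈ E.map (fun e => s(e.1, e.2)) ↔ e ∈ I.tree.edgeSet
  ε : ℝ
  pos : 0 < ε

namespace TreeInput

noncomputable def gauge (q : TreeInput) : ℕ × ℕ := (q.I.size, ⌈4 / q.ε⌉₊)

noncomputable def raw (q : TreeInput) :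
    ℕ × List (ℕ × ℕ × ℝ) × List ℕ × List ℕ × ℕ :=
  (q.I.numVertices, q.I.edgeList q.E, q.I.userList, q.I.facList, q.I.r)

noncomputable def run (q : TreeInput) (A : List (ℕ × ℕ)) : Option (List Bool × List (Option ℕ)) :=
  scheme ⌈4 / q.ε⌉₊ q.I.numVertices (q.I.edgeList q.E) q.I.userList q.I.facList q.I.r A

/-- Numbers are encoded by themselves, but mapping the identity over a list is the list only
propositionally. -/
theorem enc_raw (q : TreeInput) : (enc q.raw : TreeGathering.inTy.Val) =
    (q.I.numVertices, q.I.edgeList q.E, q.I.userList, q.I.facList, q.I.r) := by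
  have h1 : List.map enc (q.I.edgeList q.E) = q.I.edgeList q.E := List.map_id'' (fun _ => rfl) _
  have h2 : List.map enc q.I.userList = q.I.userList := List.map_id'' (fun _ => rfl) _
  have h3 : List.map enc q.I.facList = q.I.facList := List.map_id'' (fun _ => rfl) _
  refine Prod.ext rfl (Prod.ext h1 (Prod.ext h2 (Prod.ext h3 rfl)))

theorem run_correct (q : TreeInput) (A : List (ℕ × ℕ)) :
    (∃ s : q.I.Solution, (enc (q.run A) : (Ty.opt TreeGathering.outTy).Val) =
        Sum.inr (q.I.encodeSol s) ∧ (s.IsGathering ∧ (s.opened.card, s.numIgnored) ∈ A) ∧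
      ∀ s' : q.I.Solution, s'.IsGathering ∧ (s'.opened.card, s'.numIgnored) ∈ A →
        (s.cost : ℝ) ≤ (1 + q.ε) * s'.cost) ∨
    ((enc (q.run A) : (Ty.opt TreeGathering.outTy).Val) = Sum.inl () ∧
      ∀ s : q.I.Solution, ¬ (s.IsGathering ∧ (s.opened.card, s.numIgnored) ∈ A)) :=
  TreeGathering.scheme_correct q.mem q.pos (Nat.ceil_pos.2 (div_pos (by norm_num) q.pos))
    ((div_le_iff₀ q.pos).1 (Nat.le_ceil _))

variable {ι γ : Type} [Code γ] {e : ι → γ} {π : ι → TreeInput}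

theorem PB_numVertices : PB (fun i => (π i).gauge) fun i => (π i).I.numVertices :=
  PB.size.of_le fun i => by simp only [gauge, TreeGathering.size]; omega

theorem PB_numUsers : PB (fun i => (π i).gauge) fun i => (π i).I.numUsers :=
  PB.size.of_le fun i => by simp only [gauge, TreeGathering.size]; omega

theorem PB_numFacilities : PB (fun i => (π i).gauge) fun i => (π i).I.numFacilities :=
  PB.size.of_le fun i => by simp only [gauge, TreeGathering.size]; omega

theorem calc_numUsers (h : Calc (fun i => (π i).gauge) e fun i => (π i).raw) :
    Calc (fun i => (π i).gauge) e fun i => (π i).I.numUsers := by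
  simpa only [raw, TreeGathering.length_userList] using Calc.length h.snd.snd.fst
    (by simpa only [raw, TreeGathering.length_userList] using PB_numUsers)

theorem calc_numFacilities (h : Calc (fun i => (π i).gauge) e fun i => (π i).raw) :
    Calc (fun i => (π i).gauge) e fun i => (π i).I.numFacilities := by
  simpa only [raw, TreeGathering.length_facList] using Calc.length h.snd.snd.snd.fst
    (by simpa only [raw, TreeGathering.length_facList] using PB_numFacilities)

theorem calc_run {A : ι → List (ℕ × ℕ)} (h : Calc (fun i => (π i).gauge) e fun i => (π i).raw)
    (hε : Calc (fun i => (π i).gauge) e fun i => (π i).ε)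
    (hA : Calc (fun i => (π i).gauge) e A ∧ PB (fun i => (π i).gauge) fun i => (A i).length) :
    Calc (fun i => (π i).gauge) e fun i => (π i).run (A i) :=
  Calc.scheme (hε.ceil_four_div (fun i => (π i).pos) PB.param) ⟨fun x => x, fun _ => le_rfl⟩
    h.fst PB_numVertices h.snd.fst
    ((PB_numVertices.mul PB_numVertices).of_le fun i =>
      TreeGathering.length_edgeList_le (π i).nodup)
    h.snd.snd.fst (PB_numUsers.of_le fun _ => TreeGathering.length_userList.le)
    h.snd.snd.snd.fst (PB_numFacilities.of_le fun _ => TreeGathering.length_facList.le)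
    h.snd.snd.snd.snd hA.1 hA.2

end TreeInput

namespace TreeGathering.Solution

variable {I : TreeGathering} (s : I.Solution)

theorem card_opened_le : s.opened.card ≤ I.numFacilities :=
  (Finset.card_le_univ _).trans (Fintype.card_fin _).le

theorem numIgnored_le : s.numIgnored ≤ I.numUsers :=
  (Finset.card_le_univ _).trans (Fintype.card_fin _).le

end TreeGathering.Solution

/-- The bound `gaugeBound` is a polynomial for a fixed parameter. -/
theorem gaugeBound_eq_eval (h : ℕ → ℕ) (n k : ℕ) :
    gaugeBound h (n, k) = ((Polynomial.X + Polynomial.C 2 : Polynomial ℕ) ^ h k).eval n := by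
  simp [gaugeBound]

/-- The precision belongs to the index of the family, so one program serves all `ε`; only the degree
of the polynomial depends on it. -/
theorem outlierGathering_hasStronglyPolynomialPTAS :
    outlierGathering.HasStronglyPolynomialPTAS := by
  have h : Calc (fun i : TreeInput × ℝ => i.1.gauge) (fun i => ((i.1.raw, i.2), i.1.ε))
      fun i => i.1.run (outlierPairs i.1.I.numFacilities i.1.I.numUsers i.2) :=
    TreeInput.calc_run (π := Prod.fst) Calc.self.fst.fst Calc.self.snd
      (Calc.outlierPairs (TreeInput.calc_numFacilities (π := Prod.fst) Calc.self.fst.fst)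
        TreeInput.PB_numFacilities (TreeInput.calc_numUsers (π := Prod.fst) Calc.self.fst.fst)
        TreeInput.PB_numUsers Calc.self.fst.snd)
  obtain ⟨p, k, hp⟩ := h
  refine ⟨p, fun ε hε => ⟨(Polynomial.X + Polynomial.C 2) ^ k ⌈4 / ε⌉₊, ?_⟩⟩
  rintro I ⟨x, η⟩ ⟨⟨E, h1, h2, rfl⟩, rfl⟩
  let q : TreeInput := ⟨I.toTreeGathering, E, h1, h2, ε, hε⟩
  obtain ⟨t, ht, hr⟩ := hp (q, I.η)
  have hA : ∀ s : I.toTreeGathering.Solution, (s.opened.card, s.numIgnored) ∈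
      outlierPairs I.numFacilities I.numUsers I.η ↔ (s.numIgnored : ℝ) ≤ I.η * I.numUsers :=
    fun s => mem_outlierPairs s.card_opened_le s.numIgnored_le
  refine ⟨enc (q.run (outlierPairs I.numFacilities I.numUsers I.η)), t, ?_,
    ht.trans (gaugeBound_eq_eval _ _ _).le, ?_⟩
  · exact (congrArg (fun z : TreeGathering.inTy.Val => Runs p ((z, I.η), ε)
      (enc (q.run (outlierPairs I.numFacilities I.numUsers I.η))) t) q.enc_raw).mp hr
  · have := q.run_correct (outlierPairs I.numFacilities I.numUsers I.η)
    simp only [q, hA] at this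
    exact this

theorem boundedGathering_hasStronglyPolynomialPTAS :
    boundedGathering.HasStronglyPolynomialPTAS := by
  have h : Calc (fun i : TreeInput × ℕ × ℕ => i.1.gauge) (fun i => ((i.1.raw, i.2), i.1.ε))
      fun i => i.1.run (boundedPairs i.1.I.numFacilities i.2.1 i.2.2) :=
    TreeInput.calc_run (π := Prod.fst) Calc.self.fst.fst Calc.self.snd
      (Calc.boundedPairs (TreeInput.calc_numFacilities (π := Prod.fst) Calc.self.fst.fst)
        TreeInput.PB_numFacilities Calc.self.fst.snd.fst Calc.self.fst.snd.snd)
  obtain ⟨p, k, hp⟩ := h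
  refine ⟨p, fun ε hε => ⟨(Polynomial.X + Polynomial.C 2) ^ k ⌈4 / ε⌉₊, ?_⟩⟩
  rintro I ⟨x, η⟩ ⟨⟨E, h1, h2, rfl⟩, rfl⟩
  let q : TreeInput := ⟨I.toTreeGathering, E, h1, h2, ε, hε⟩
  obtain ⟨t, ht, hr⟩ := hp (q, I.lower, I.upper)
  have hA : ∀ s : I.toTreeGathering.Solution, (s.opened.card, s.numIgnored) ∈
      boundedPairs I.numFacilities I.lower I.upper ↔ s.numIgnored = 0 ∧ I.lower ≤ s.opened.card ∧
        s.opened.card ≤ I.upper :=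
    fun s => mem_boundedPairs s.card_opened_le
  refine ⟨enc (q.run (boundedPairs I.numFacilities I.lower I.upper)), t, ?_,
    ht.trans (gaugeBound_eq_eval _ _ _).le, ?_⟩
  · exact (congrArg (fun z : TreeGathering.inTy.Val => Runs p ((z, (I.lower, I.upper)), ε)
      (enc (q.run (boundedPairs I.numFacilities I.lower I.upper))) t) q.enc_raw).mp hr
  · have := q.run_correct (boundedPairs I.numFacilities I.lower I.upper)
    simp only [q, hA] at this
    exact this

theorem mainTheorem3 :
    outlierGathering.HasStronglyPolynomialPTAS ∧ boundedGathering.HasStronglyPolynomialPTAS :=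
  ⟨outlierGathering_hasStronglyPolynomialPTAS, boundedGathering_hasStronglyPolynomialPTAS⟩
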